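/- **Setting.** Let $d\ge 1$ and $j^*=2d+1-j$ for $1\le j\le 2d$. For finite sets of integers, $A\le B$ means that $|A|=|B|$ and, both being listed increasingly, $A_i\le B_i$ for all $i$. Let $I(d)$ be the set of $d$-element subsets of $\{1,\dots,2d\}$ containing exactly one of $j,j^*$ for each $j$; the $\epsilon$-degree of a set $\theta$ is $|\theta\setminus\{1,\dots,d\}|$. Fix $\alpha\le\beta\le\gamma$ in $I(d)$. The root set $\mathfrak R(\beta)$ is the set of all $(r,c)$ with $r\in\{1,\dots,2d\}\setminus\beta$ and $c\in\beta$. For $R\subseteq\{1,\dots,2d\}\setminus\beta$ and $S\subseteq\beta$ put $R-S:=R\cup(\beta\setminus S)$. For a set or multiset $C$ of pairs, $C_{(1)},C_{(2)}$ denote the multisets of first and second coordinates, and $C^-$, $C^+$ the parts consisting of the $(r,c)$ with $r<c$, resp. $r>c$. Let $T_\alpha,W_\gamma\subseteq\mathfrak R(\beta)$ be any subsets with $(T_\alpha)_{(1)}=\alpha\setminus\beta$, $(T_\alpha)_{(2)}=\beta\setminus\alpha$, $(W_\gamma)_{(1)}=\gamma\setminus\beta$, $(W_\gamma)_{(2)}=\beta\setminus\gamma$.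 **Multisets.** A multiset $U$ on $\mathfrak R(\beta)$ is *non-vanishing* if $r\ne c$ for all $(r,c)\in U$ (automatic here; $U=\emptyset$ is allowed); its *degree* is its number of elements with multiplicity. A *chain* is a finite set of pairs that can be listed with strictly decreasing first and strictly increasing second coordinates. $U$ is *bounded by* $T_\alpha,W_\gamma$ if every chain $C$ of elements of $U$ satisfies $(T_\alpha)_{(1)}-(T_\alpha)_{(2)}\le C^-_{(1)}-C^-_{(2)}$ and $C^+_{(1)}-C^+_{(2)}\le (W_\gamma)_{(1)}-(W_\gamma)_{(2)}$. $U$ is *special* if it is invariant under $(r,c)\mapsto(c^*,r^*)$ and every diagonal element $(c^*,c)$ has even multiplicity. **Bitableaux.** A *notched bitableau* $(P,Q)$ on $\mathfrak R(\beta)$ is a pair of fillings of one and the same finite list of nonempty left-justified rows (of arbitrary lengths), with the entries of $P$ not in $\beta$ and those of $Q$ in $\beta$. Its *degree* is the number of boxes of $P$. Let $P_i,Q_i$ be the rows from top to bottom, $1\le i\le m$. It is *non-vanishing semistandard* if all rows are strictly increasing, for each $i$ either $P_i<Q_i$ entrywise (a negative row) or $P_i>Q_i$ entrywise (a positive row),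 and $P_1-Q_1\le\cdots\le P_m-Q_m$. It is *bounded by* $T_\alpha,W_\gamma$ if it is empty, or $(T_\alpha)_{(1)}-(T_\alpha)_{(2)}\le P_1-Q_1$ and $P_m-Q_m\le (W_\gamma)_{(1)}-(W_\gamma)_{(2)}$. It is *on $\mathfrak R(\beta)^*$* if moreover: (i) $P_i=Q_i^*$ as sets for every $i$; (ii) $m$ is even, or $m$ is odd and $P_1-Q_1\le\cdots\le P_n-Q_n\le\beta\le P_{n+1}-Q_{n+1}\le\cdots\le P_m-Q_m$, where the first $n$ rows are the negative ones; (iii) letting $\delta_1,\delta_2,\dots$ be the sequence $P_1-Q_1,\dots,P_m-Q_m$ if $m$ is even, and the sequence in (ii) including $\beta$ if $m$ is odd, $\delta_j$ and $\delta_{j+1}$ have equal $\epsilon$-degrees for all odd $j$; (iv) the number of boxes of $P$ is even. **The map BRSK.** For a multiset $U$ of pairs $(a,b)$ with $a<b$, list $U$ as $(a_1,b_1),\dots,(a_t,b_t)$ with $b_1\ge\cdots\ge b_t$, and $a_i\ge a_{i+1}$ whenever $b_i=b_{i+1}$. Start with the empty pair $(P,Q)$, and for $i=1,\dots,t$ do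 the following. Ignoring the entries $\ge b_i$ of $P$ (they stay in their rows, to the right), insert $a_i$: an element $a$ inserted into a row replaces the smallest entry $\ge a$ among the entries $<b_i$ of that row, and the replaced entry is inserted into the next row in the same way; if there is no such entry, $a$ is placed directly to the right of the entries $<b_i$ of that row (a new bottom row if the rows are exhausted) and the insertion stops. Then put $b_i$ at the left end of the row of $Q$ corresponding to the row in which $P$ got its new box. The final $(P,Q)$ is $BRSK(U)$. For a multiset $U$ of pairs $(a,b)$ with $a>b$, let $(P',Q')$ be $BRSK$ of $\{(b,a):(a,b)\in U\}$; then $BRSK(U)$ is $(Q',P')$ with the order of the rows reversed. For non-vanishing $U$, $BRSK(U)$ is $BRSK(U^-)$ placed on top of $BRSK(U^+)$. **Theorem 4.4.** The map $BRSK$ is a degree-preserving bijection from the set of all non-vanishing special multisets on $\mathfrak R(\beta)$ bounded by $T_\alpha,W_\gamma$ to the set of all non-vanishing semistandard notched bitableaux on $\mathfrak R(\beta)^*$ bounded by $T_\alpha,W_\gamma$. -/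

import Mathlib

/-! ### Bounded insertion and the bounded RSK correspondence, over any linear order -/

/-- A tableau is given by the list of its rows, from top to bottom; each row is the list of its
entries, from left to right.  No relation between the lengths of the rows is imposed, so this
covers Young tableaux and notched tableaux. -/
abbrev NotchedTableau (A : Type*) := List (List A)

/-- Bounded insertion of `a` into `P` with bound `b` (used when `a < b`).  The entries `≥ b` take no
part: they stay in their rows, to the right of all entries `< b`.  On the entries `< b` this is
the Schensted insertion for tableaux with strictly increasing rows and weakly increasing columns:
`a` replaces the smallest entry `≥ a` (and `< b`) of the first row, which is then inserted in the
same way into the next row; if there is no such entry, `a` is put at the right end of the entries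
`< b` of the row, and the process stops.  The second component of the result is the
(zero-based) number of the row that received the new box. -/
def boundedInsert {A : Type*} [LinearOrder A] (b : A) :
    A → NotchedTableau A → NotchedTableau A × ℕ
  | a, [] => ([[a]], 0)
  | a, row :: P =>
    match (row.filter (fun x => x < b)).find? (fun x => a ≤ x) with
    | none => ((row.filter (fun x => x < b) ++ a :: row.filter (fun x => b ≤ x)) :: P, 0)
    | some x =>
      (row.map (fun y => if y = x then a else y) :: (boundedInsert b x P).1,
        (boundedInsert b x P).2 + 1)

/-- Put `b` at the left end of row `j` of a tableau (in a new bottom row if there is no row `j`). -/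
def placeLeft {A : Type*} (b : A) : ℕ → NotchedTableau A → NotchedTableau A
  | _, [] => [[b]]
  | 0, row :: Q => (b :: row) :: Q
  | j + 1, row :: Q => row :: placeLeft b j Q

/-- One step of the bounded RSK: `a` is inserted into `P` with bound `b`, and `b` is put at the left
end of the row of `Q` in which `P` got its new box. -/
def brskStep {A : Type*} [LinearOrder A] (B : NotchedTableau A × NotchedTableau A) (u : A × A) :
    NotchedTableau A × NotchedTableau A :=
  ((boundedInsert u.2 u.1 B.1).1, placeLeft u.2 (boundedInsert u.2 u.1 B.1).2 B.2)

/-- The elements `(a₁, b₁), …, (aₜ, bₜ)` of a multiset of pairs, listed such that `b₁ ≥ ⋯ ≥ bₜ`, and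
`aᵢ ≥ aᵢ₊₁` whenever `bᵢ = bᵢ₊₁`. -/
def insertionList {A : Type*} [LinearOrder A] (U : Multiset (A × A)) : List (A × A) :=
  ((U.map (fun u => toLex (u.2, u.1))).sort (fun x y => x ≥ y)).map
    (fun x => ((ofLex x).2, (ofLex x).1))

/-- `BRSK` on negative multisets (those with `a < b` for every element `(a, b)`). -/
def brskNegative {A : Type*} [LinearOrder A] (U : Multiset (A × A)) :
    NotchedTableau A × NotchedTableau A :=
  (insertionList U).foldl brskStep ([], [])

/-- The involution on pairs of tableaux that exchanges `P` and `Q` and reverses the order of the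
rows; it exchanges negative and positive bitableaux. -/
def flipBitableau {A : Type*} (B : NotchedTableau A × NotchedTableau A) :
    NotchedTableau A × NotchedTableau A :=
  (B.2.reverse, B.1.reverse)

/-- `BRSK` on positive multisets (those with `a > b` for every element `(a, b)`). -/
def brskPositive {A : Type*} [LinearOrder A] (U : Multiset (A × A)) :
    NotchedTableau A × NotchedTableau A :=
  flipBitableau (brskNegative (U.map Prod.swap))

/-- `BRSK` on nonvanishing multisets: the bitableau of the negative part is placed on top of the
bitableau of the positive part. -/
def brsk {A : Type*} [LinearOrder A] (U : Multiset (A × A)) :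
    NotchedTableau A × NotchedTableau A :=
  ((brskNegative (U.filter (fun u => u.1 < u.2))).1 ++
      (brskPositive (U.filter (fun u => u.2 < u.1))).1,
    (brskNegative (U.filter (fun u => u.1 < u.2))).2 ++
      (brskPositive (U.filter (fun u => u.2 < u.1))).2)

/-- The degree of a bitableau `(P, Q)`: the number of boxes of `P`. -/
def bitableauDegree {A : Type*} (B : NotchedTableau A × NotchedTableau A) : ℕ :=
  (B.1.map List.length).sum

/-- The rows `(P₁, Q₁), …, (Pᵣ, Qᵣ)` of a bitableau, from top to bottom. -/
def bitableauRows {A : Type*} (B : NotchedTableau A × NotchedTableau A) :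
    List (List A × List A) :=
  B.1.zip B.2

/-! ### The index sets

The numbers `1, …, 2d` are modelled by `Fin (2 * d)` (so that `j` stands for `j + 1`), and the
involution `j ↦ j* = 2d + 1 - j` is then `Fin.rev`. -/

/-- The order on finite subsets: `A ≤ B` if they have the same number of elements and, both being
listed increasingly, `Aᵢ ≤ Bᵢ` for all `i`. -/
def SetLE {A : Type*} [LinearOrder A] (X Y : Finset A) : Prop :=
  List.Forall₂ (fun x y => x ≤ y) (X.sort (fun x y => x ≤ y)) (Y.sort (fun x y => x ≤ y))

/-- `I(d)`: the `d`-element subsets of `{1, …, 2d}` that contain exactly one of `j`, `j*` for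
each `j`. -/
def IsSymplecticIndex {d : ℕ} (v : Finset (Fin (2 * d))) : Prop :=
  v.card = d ∧ ∀ j, (j ∈ v ↔ Fin.rev j ∉ v)

/-- `R - S`, the subset `R ∪ (β ∖ S)` of `{1, …, 2d}`, where `R` is disjoint from `β` and `S ⊆ β`.
Its inverse sends `θ` to `(θ ∖ β, β ∖ θ)`. -/
def diffSet {d : ℕ} (β R S : Finset (Fin (2 * d))) : Finset (Fin (2 * d)) :=
  R ∪ (β \ S)

/-- `(r, c)` is in the root set of `β`: `r` is not, and `c` is, an entry of `β`. -/
def IsRoot {d : ℕ} (β : Finset (Fin (2 * d))) (u : Fin (2 * d) × Fin (2 * d)) : Prop :=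
  u.1 ∉ β ∧ u.2 ∈ β

/-- `C₍₁₎ - C₍₂₎` for a finite set `C` of roots of `β`. -/
def projDiff {d : ℕ} (β : Finset (Fin (2 * d))) (C : Finset (Fin (2 * d) × Fin (2 * d))) :
    Finset (Fin (2 * d)) :=
  diffSet β (C.image Prod.fst) (C.image Prod.snd)

/-- `T` is a set of roots of `β` whose multisets of first and second coordinates are
`R_θ = θ ∖ β` and `S_θ = β ∖ θ`. -/
def Represents {d : ℕ} (β θ : Finset (Fin (2 * d)))
    (T : Finset (Fin (2 * d) × Fin (2 * d))) : Prop :=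
  (∀ u ∈ T, IsRoot β u) ∧ T.val.map Prod.fst = (θ \ β).val ∧ T.val.map Prod.snd = (β \ θ).val

/-! ### Special multisets -/

/-- A multiset of roots of `β` without elements `(a, a)`. -/
def IsNonvanishingMultiset {d : ℕ} (β : Finset (Fin (2 * d)))
    (S : Multiset (Fin (2 * d) × Fin (2 * d))) : Prop :=
  (∀ u ∈ S, IsRoot β u) ∧ ∀ u ∈ S, u.1 ≠ u.2

/-- `(r, c)^# = (c*, r*)`. -/
def sharp {d : ℕ} (u : Fin (2 * d) × Fin (2 * d)) : Fin (2 * d) × Fin (2 * d) :=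
  (Fin.rev u.2, Fin.rev u.1)

/-- Symmetric multisets in which the diagonal elements `(c*, c)` have even multiplicity. -/
def IsSpecialMultiset {d : ℕ} (S : Multiset (Fin (2 * d) × Fin (2 * d))) : Prop :=
  S.map sharp = S ∧ ∀ u, u.1 = Fin.rev u.2 → Even (S.count u)

/-- A chain is a finite set of pairs any two distinct elements of which are comparable for
`(R, C) > (r, c) ↔ R > r ∧ C < c`. -/
def IsRootChain {d : ℕ} (C : Finset (Fin (2 * d) × Fin (2 * d))) : Prop :=
  ∀ u ∈ C, ∀ v ∈ C, u ≠ v → (v.1 < u.1 ∧ u.2 < v.2) ∨ (u.1 < v.1 ∧ v.2 < u.2)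

/-- `S` is bounded by `T`, `W`: `T ≤ C⁻` and `C⁺ ≤ W` for every chain `C` in `S`, where `C⁻`, `C⁺` are
the negative and positive parts of `C`. -/
def MultisetBounded {d : ℕ} (β : Finset (Fin (2 * d)))
    (T W : Finset (Fin (2 * d) × Fin (2 * d)))
    (S : Multiset (Fin (2 * d) × Fin (2 * d))) : Prop :=
  ∀ C : Finset (Fin (2 * d) × Fin (2 * d)), (∀ u ∈ C, u ∈ S) → IsRootChain C →
    SetLE (projDiff β T) (projDiff β (C.filter (fun u => u.1 < u.2))) ∧
    SetLE (projDiff β (C.filter (fun u => u.2 < u.1))) (projDiff β W)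

/-! ### Notched bitableaux -/

/-- `Pᵢ - Qᵢ` for a row `(Pᵢ, Qᵢ)`. -/
def rowDiff {d : ℕ} (β : Finset (Fin (2 * d)))
    (w : List (Fin (2 * d)) × List (Fin (2 * d))) : Finset (Fin (2 * d)) :=
  diffSet β w.1.toFinset w.2.toFinset

/-- A negative row: `Pᵢ < Qᵢ` entry by entry. -/
def IsNegativeRow {d : ℕ} (w : List (Fin (2 * d)) × List (Fin (2 * d))) : Prop :=
  List.Forall₂ (fun x y => x < y) w.1 w.2

/-- A positive row: `Pᵢ > Qᵢ` entry by entry. -/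
def IsPositiveRow {d : ℕ} (w : List (Fin (2 * d)) × List (Fin (2 * d))) : Prop :=
  List.Forall₂ (fun x y => y < x) w.1 w.2

/-- `(P, Q)` is a nonvanishing semistandard notched bitableau on the root set of `β`. -/
structure IsNonvanishingSemistandard {d : ℕ} (β : Finset (Fin (2 * d)))
    (B : NotchedTableau (Fin (2 * d)) × NotchedTableau (Fin (2 * d))) : Prop where
  sameShape : B.1.map List.length = B.2.map List.length
  noEmptyRow : ∀ row ∈ B.1, row ≠ []
  rowStrictP : ∀ row ∈ B.1, row.Pairwise (fun x y => x < y)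
  rowStrictQ : ∀ row ∈ B.2, row.Pairwise (fun x y => x < y)
  entriesP : ∀ row ∈ B.1, ∀ x ∈ row, x ∉ β
  entriesQ : ∀ row ∈ B.2, ∀ x ∈ row, x ∈ β
  semistandard : (bitableauRows B).IsChain (fun w w' => SetLE (rowDiff β w) (rowDiff β w'))
  nonvanishing : ∀ w ∈ bitableauRows B, IsNegativeRow w ∨ IsPositiveRow w

/-- `(P, Q)` is bounded by `T`, `W`: `T₍₁₎ - T₍₂₎ ≤ P₁ - Q₁` for the top row, and
`Pᵣ - Qᵣ ≤ W₍₁₎ - W₍₂₎` for the bottom row. -/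
def BitableauBounded {d : ℕ} (β : Finset (Fin (2 * d)))
    (T W : Finset (Fin (2 * d) × Fin (2 * d)))
    (B : NotchedTableau (Fin (2 * d)) × NotchedTableau (Fin (2 * d))) : Prop :=
  (∀ w ∈ (bitableauRows B).head?, SetLE (projDiff β T) (rowDiff β w)) ∧
  (∀ w ∈ (bitableauRows B).getLast?, SetLE (rowDiff β w) (projDiff β W))

/-- The `ε`-degree of `θ`, where `ε = (1, …, d)`: the number of elements of `θ ∖ ε`. -/
def epsDegree {d : ℕ} (θ : Finset (Fin (2 * d))) : ℕ :=
  (θ \ Finset.univ.filter (fun j => j.val < d)).card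

/-- In the sequence `δ₁, δ₂, …` the members `δⱼ` and `δⱼ₊₁` have equal `ε`-degrees for every odd
`j`. -/
def PairedEpsDegrees {d : ℕ} (δ : List (Finset (Fin (2 * d)))) : Prop :=
  ∀ k x y, δ[2 * k]? = some x → δ[2 * k + 1]? = some y → epsDegree x = epsDegree y

open Classical in
/-- The sequence `P₁ - Q₁, …, Pₙ - Qₙ, β, Pₙ₊₁ - Qₙ₊₁, …, Pₙ₊ₚ - Qₙ₊ₚ`, with `β` inserted between the
negative part and the positive part. -/
noncomputable def augmentedRows {d : ℕ} (β : Finset (Fin (2 * d)))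
    (B : NotchedTableau (Fin (2 * d)) × NotchedTableau (Fin (2 * d))) :
    List (Finset (Fin (2 * d))) :=
  ((bitableauRows B).filter (fun w => IsNegativeRow w)).map (rowDiff β) ++
    β :: ((bitableauRows B).filter (fun w => IsPositiveRow w)).map (rowDiff β)

/-- The four conditions for a nonvanishing semistandard notched bitableau on the root set to be on
its starred version. -/
structure IsOnStar {d : ℕ} (β : Finset (Fin (2 * d)))
    (B : NotchedTableau (Fin (2 * d)) × NotchedTableau (Fin (2 * d))) : Prop where
  selfDual : ∀ w ∈ bitableauRows B, w.1.toFinset = w.2.toFinset.image Fin.rev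
  evenOrChain : Even B.1.length ∨ (Odd B.1.length ∧ (augmentedRows β B).IsChain SetLE)
  epsPairs : (Even B.1.length ∧ PairedEpsDegrees ((bitableauRows B).map (rowDiff β))) ∨
    (Odd B.1.length ∧ PairedEpsDegrees (augmentedRows β B))
  evenBoxes : Even (bitableauDegree B)

/-! ### The two sets -/

/-- The nonvanishing special multisets on the root set of `β` bounded by `T`, `W`. -/
def specialMultisets {d : ℕ} (β : Finset (Fin (2 * d)))
    (T W : Finset (Fin (2 * d) × Fin (2 * d))) :
    Set (Multiset (Fin (2 * d) × Fin (2 * d))) :=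
  {S | IsNonvanishingMultiset β S ∧ MultisetBounded β T W S ∧ IsSpecialMultiset S}

/-- The nonvanishing semistandard notched bitableaux on the starred root set of `β` bounded by
`T`, `W`. -/
def starBitableaux {d : ℕ} (β : Finset (Fin (2 * d)))
    (T W : Finset (Fin (2 * d) × Fin (2 * d))) :
    Set (NotchedTableau (Fin (2 * d)) × NotchedTableau (Fin (2 * d))) :=
  {B | IsNonvanishingSemistandard β B ∧ BitableauBounded β T W B ∧ IsOnStar β B}

/-! The negative and the positive part of a multiset are handled separately, and the positive part
becomes negative for `βᶜ` when coordinates are exchanged. So the core is the map `brskNegative` on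
multisets of roots `(r, c)` with `r < c`, over an arbitrary `Fin n`.

Its insertions are recorded in a growth diagram: `G x y i` counts the entries `< x` in row `i` of
`P` once all pairs with `c ≥ n - y` have been inserted, and `C x y i` counts the copies of `x` that
are inserted into row `i` with the bound `n - 1 - y`. Inserting a weakly decreasing block into a row
obeys the local rule of `IsGrowth` (`insertAll_spec`, `exists_isGrowth_brskNegative`). Each row of
the resulting bitableau is encoded by its heights, `height w b` being the number of entries `≥ b` in
`Q` minus that in `P`; these are exactly the values of the diagram on the antidiagonal `x + y = n`.
Semistandardness says that these values form partitions, and membership in `β` says at which steps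
they may grow or shrink.

Bijectivity: the local rule can be run backwards from the antidiagonal (`cell_backward`,
`exists_isCell`). A boundary sequence therefore comes from exactly one multiset of roots
(`negativeRows_injOn`, `exists_negativeRows_eq`).

Restriction to the two sets of the theorem: every condition is read off the same diagram. The rule
is symmetric in `x` and `y`, and transposition is `(r, c) ↦ (c*, r*)`, so invariant multisets
correspond to symmetric heights, that is, to `Pᵢ = Qᵢ*` (`map_sharp_iff_selfDual`). In a symmetric
diagram the alternating sum of the partition at `(d, d)` is the number of odd diagonal
multiplicities, so these are all even exactly when the heights at `d` agree in consecutive pairs;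
this is the condition on `ε`-degrees (`diagonal_even_iff`, `epsPairs_stackRows_iff`). The first part
of a partition is the length of a longest chain in a rectangle, so the bound on chains becomes a
bound on the top row (`chain_bound_iff`). The chain condition through `β` and the even number of
boxes hold automatically. -/

/-! ### Growth diagrams with vertical strips on a staircase -/

/-- `G x y` is the partition at the lattice point `(x, y)` of the growth diagram on the staircase
`x + y ≤ n` whose cell with lower left corner `(x, y)` carries the multiplicity `m x y`; row `i` of
this cell receives the carry `C x y i`. -/
structure IsGrowth (n : ℕ) (m : ℕ → ℕ → ℕ) (G C : ℕ → ℕ → ℕ → ℕ) : Prop where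
  left : ∀ y i, G 0 y i = 0
  bot : ∀ x i, G x 0 i = 0
  init : ∀ x y, x + y + 1 < n → C x y 0 = m x y
  rule : ∀ x y i, x + y + 1 < n → G (x + 1) (y + 1) i =
    max (max (G (x + 1) y i) (G x (y + 1) i)) (G x y i + if C x y i = 0 then 0 else 1)
  cons : ∀ x y i, x + y + 1 < n → C x y (i + 1) + G (x + 1) (y + 1) i + G x y i =
    C x y i + G (x + 1) y i + G x (y + 1) i
  eventually_zero : ∀ x y, x + y ≤ n → ∃ N, ∀ i, N ≤ i → G x y i = 0

namespace IsGrowth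

variable {n : ℕ} {m m' : ℕ → ℕ → ℕ} {G C G' C' : ℕ → ℕ → ℕ → ℕ}

/-- The local rule treats the corners `(x + 1, y)` and `(x, y + 1)` alike. This symmetry is the only
source of the self-duality of the rows. -/
theorem transpose (h : IsGrowth n m G C) :
    IsGrowth n (fun x y => m y x) (fun x y => G y x) (fun x y => C y x) where
  left := h.bot
  bot := h.left
  init x y hxy := h.init y x (by omega)
  rule x y i hxy := by rw [h.rule y x i (by omega), max_comm (G (y + 1) x i)]
  cons x y i hxy := by have := h.cons y x i (by omega); omega
  eventually_zero x y hxy := h.eventually_zero y x (by omega)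

/-- Induction along antidiagonals: if both middle corners exceed the lower left one by at most 1,
then the maximum in the rule exceeds either of them by at most 1. -/
theorem strip (h : IsGrowth n m G C) (i : ℕ) : ∀ k x y, x + y = k → x + y < n →
    (G x y i ≤ G (x + 1) y i ∧ G (x + 1) y i ≤ G x y i + 1) ∧
      (G x y i ≤ G x (y + 1) i ∧ G x (y + 1) i ≤ G x y i + 1) := by
  intro k
  induction k with
  | zero =>
    intro x y hk hn
    obtain ⟨rfl, rfl⟩ : x = 0 ∧ y = 0 := by omega
    simp [h.left, h.bot]
  | succ k ih =>
    intro x y hk hn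
    constructor
    · cases y with
      | zero => simp [h.bot]
      | succ y =>
        have h1 := ih x y (by omega) (by omega)
        have h2 := h.rule x y i (by omega)
        split_ifs at h2 <;> omega
    · cases x with
      | zero => simp [h.left]
      | succ x =>
        have h1 := ih x y (by omega) (by omega)
        have h2 := h.rule x y i (by omega)
        split_ifs at h2 <;> omega

theorem strip_right (h : IsGrowth n m G C) {x y : ℕ} (hxy : x + y < n) (i : ℕ) :
    G x y i ≤ G (x + 1) y i ∧ G (x + 1) y i ≤ G x y i + 1 :=
  (h.strip i _ x y rfl hxy).1

theorem strip_up (h : IsGrowth n m G C) {x y : ℕ} (hxy : x + y < n) (i : ℕ) :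
    G x y i ≤ G x (y + 1) i ∧ G x (y + 1) i ≤ G x y i + 1 :=
  (h.strip i _ x y rfl hxy).2

/-- A nonzero carry into row `i + 1` arises only if row `i` received a carry or both middle corners
grew there. In either case row `i` of the new corner is one longer than at the old corner, which
leaves room for the growth of row `i + 1`. -/
theorem antitone_row (h : IsGrowth n m G C) (i : ℕ) : ∀ k x y, x + y = k → x + y ≤ n →
    G x y (i + 1) ≤ G x y i := by
  intro k
  induction k using Nat.strong_induction_on with
  | _ k ih =>
    intro x y hk hn
    rcases x with _ | x
    · simp [h.left]
    rcases y with _ | y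
    · simp [h.bot]
    have h1 := ih _ (by omega) x y rfl (by omega)
    have h2 := ih _ (by omega) (x + 1) y rfl (by omega)
    have h3 := ih _ (by omega) x (y + 1) rfl (by omega)
    have r1 := h.rule x y i (by omega)
    have r2 := h.rule x y (i + 1) (by omega)
    have c1 := h.cons x y i (by omega)
    have s1 := h.strip_right (x := x) (y := y) (by omega) i
    have s2 := h.strip_up (x := x) (y := y) (by omega) i
    split_ifs at r1 r2 <;> omega

theorem row_succ_le (h : IsGrowth n m G C) {x y : ℕ} (hxy : x + y ≤ n) (i : ℕ) :
    G x y (i + 1) ≤ G x y i :=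
  h.antitone_row i _ x y rfl hxy

/-- The carries vanish in all rows far enough down. -/
theorem carry_eventually_zero (h : IsGrowth n m G C) {x y : ℕ} (hxy : x + y + 1 < n) :
    ∃ N, ∀ i, N ≤ i → C x y i = 0 := by
  obtain ⟨N, hN⟩ := h.eventually_zero (x + 1) (y + 1) (by omega)
  refine ⟨N, fun i hi => ?_⟩
  have r := h.rule x y i hxy
  rw [hN i hi] at r
  split_ifs at r with h0
  · exact h0
  · omega

/-- The multiplicities determine the diagram. -/
theorem unique (h : IsGrowth n m G C) (h' : IsGrowth n m G' C') : ∀ k x y, x + y = k →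
    x + y ≤ n → ∀ i, G x y i = G' x y i := by
  intro k
  induction k using Nat.strong_induction_on with
  | _ k ih =>
    intro x y hk hn
    rcases x with _ | x
    · simp [h.left, h'.left]
    rcases y with _ | y
    · simp [h.bot, h'.bot]
    have h1 := ih _ (by omega) x y rfl (by omega)
    have h2 := ih _ (by omega) (x + 1) y rfl (by omega)
    have h3 := ih _ (by omega) x (y + 1) rfl (by omega)
    have key : ∀ i, C x y i = C' x y i → G (x + 1) (y + 1) i = G' (x + 1) (y + 1) i := by
      intro i hC
      rw [h.rule x y i (by omega), h'.rule x y i (by omega), h1, h2, h3, hC]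
    have hC : ∀ i, C x y i = C' x y i := by
      intro i
      induction i with
      | zero => rw [h.init x y (by omega), h'.init x y (by omega)]
      | succ i ihi =>
        have c1 := h.cons x y i (by omega)
        have c2 := h'.cons x y i (by omega)
        have := key i ihi
        have := h1 i
        have := h2 i
        have := h3 i
        omega
    exact fun i => key i (hC i)

/-! ### Empty columns and rows, and reconstruction from the boundary -/

/-- Nothing enters the column, so by induction upwards and along the rows no carry ever appears. -/
theorem column_empty (h : IsGrowth n m G C) {x : ℕ} (hm : ∀ y, x + y + 1 < n → m x y = 0) :
    ∀ y, x + y < n → ∀ i, G (x + 1) y i = G x y i := by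
  intro y
  induction y with
  | zero => simp [h.bot]
  | succ y ih =>
    intro hn
    have ih := ih (by omega)
    have key : ∀ i, C x y i = 0 ∧ G (x + 1) (y + 1) i = G x (y + 1) i := by
      intro i
      have aux : ∀ i, C x y i = 0 → G (x + 1) (y + 1) i = G x (y + 1) i := by
        intro i h0
        have r := h.rule x y i (by omega)
        have := ih i
        have := h.strip_up (x := x) (y := y) (by omega) i
        rw [if_pos h0] at r
        omega
      have hC : C x y i = 0 := by
        induction i with
        | zero => rw [h.init x y (by omega), hm y (by omega)]
        | succ i ihi =>
          have := h.cons x y i (by omega)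
          have := aux i ihi
          have := ih i
          omega
      exact ⟨hC, aux i hC⟩
    exact fun i => (key i).2

theorem row_empty (h : IsGrowth n m G C) {y : ℕ} (hm : ∀ x, x + y + 1 < n → m x y = 0)
    (x : ℕ) (hx : x + y < n) (i : ℕ) : G x (y + 1) i = G x y i :=
  h.transpose.column_empty (x := y) (fun x hx => hm x (by omega)) x (by omega) i

/-- Given the three other corners, the carry out of row `i` determines both the old length of row
`i` and the carry into it. Carries vanish far down, so the cell is reconstructed from its lowest
rows to its top row. -/
theorem cell_backward (h : IsGrowth n m G C) (h' : IsGrowth n m' G' C') {x y : ℕ}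
    (hxy : x + y + 1 < n) (h1 : ∀ i, G (x + 1) y i = G' (x + 1) y i)
    (h2 : ∀ i, G x (y + 1) i = G' x (y + 1) i)
    (h3 : ∀ i, G (x + 1) (y + 1) i = G' (x + 1) (y + 1) i) (i : ℕ) :
    G x y i = G' x y i ∧ C x y i = C' x y i := by
  have step : ∀ i, C x y (i + 1) = C' x y (i + 1) → G x y i = G' x y i ∧ C x y i = C' x y i := by
    intro i hC
    have r1 := h.rule x y i hxy
    have r2 := h'.rule x y i hxy
    have c1 := h.cons x y i hxy
    have c2 := h'.cons x y i hxy
    have s1 := h.strip_right (x := x) (y := y) (by omega) i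
    have s2 := h.strip_up (x := x) (y := y) (by omega) i
    have s3 := h'.strip_right (x := x) (y := y) (by omega) i
    have s4 := h'.strip_up (x := x) (y := y) (by omega) i
    have := h1 i
    have := h2 i
    have := h3 i
    split_ifs at r1 r2 <;> omega
  obtain ⟨N, hN⟩ := h.carry_eventually_zero hxy
  obtain ⟨N', hN'⟩ := h'.carry_eventually_zero hxy
  -- Here `j` measures the distance above a row from which both families of carries vanish.
  have hC : ∀ j i, N + N' ≤ i + j → C x y i = C' x y i := by
    intro j
    induction j with
    | zero => intro i hi; rw [hN i (by omega), hN' i (by omega)]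
    | succ j ih => intro i hi; exact (step i (ih (i + 1) (by omega))).2
  exact step i (hC (N + N') (i + 1) (by omega))

/-- The partitions on the boundary of the staircase determine the diagram. -/
theorem unique_of_boundary (h : IsGrowth n m G C) (h' : IsGrowth n m' G' C') (B : ℕ → Prop)
    (hm : ∀ x y, x + y + 1 < n → m x y ≠ 0 → ¬ B x ∧ B (n - 1 - y))
    (hm' : ∀ x y, x + y + 1 < n → m' x y ≠ 0 → ¬ B x ∧ B (n - 1 - y))
    (hb : ∀ x y, x + y = n → ∀ i, G x y i = G' x y i) :
    ∀ k x y, x + y + k = n → ∀ i, G x y i = G' x y i := by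
  intro k
  induction k using Nat.strong_induction_on with
  | _ k ih =>
    intro x y hk i
    rcases k with _ | _ | k
    · exact hb x y (by omega) i
    -- The points with `x + y = n - 1` are the lower left corner of no cell. But either column `x`
    -- or row `y` is empty, according to `B x`, so the partition is copied from one of the two
    -- neighbouring boundary points.
    · by_cases hB : B x
      · have e : ∀ y, x + y + 1 < n → m x y = 0 := fun y hy => by
          by_contra h0; exact (hm x y hy h0).1 hB
        have e' : ∀ y, x + y + 1 < n → m' x y = 0 := fun y hy => by
          by_contra h0; exact (hm' x y hy h0).1 hB
        rw [← h.column_empty e y (by omega) i, ← h'.column_empty e' y (by omega) i]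
        exact hb _ _ (by omega) i
      · have hx : n - 1 - y = x := by omega
        have e : ∀ z, z + y + 1 < n → m z y = 0 := fun z hz => by
          by_contra h0; exact hB (hx ▸ (hm z y hz h0).2)
        have e' : ∀ z, z + y + 1 < n → m' z y = 0 := fun z hz => by
          by_contra h0; exact hB (hx ▸ (hm' z y hz h0).2)
        rw [← h.row_empty e x (by omega) i, ← h'.row_empty e' x (by omega) i]
        exact hb _ _ (by omega) i
    · exact (h.cell_backward h' (by omega) (ih (k + 1) (by omega) (x + 1) y (by omega))
        (ih (k + 1) (by omega) x (y + 1) (by omega))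
        (ih k (by omega) (x + 1) (y + 1) (by omega)) i).1

theorem multiplicity_unique (h : IsGrowth n m G C) (h' : IsGrowth n m' G' C') (B : ℕ → Prop)
    (hm : ∀ x y, x + y + 1 < n → m x y ≠ 0 → ¬ B x ∧ B (n - 1 - y))
    (hm' : ∀ x y, x + y + 1 < n → m' x y ≠ 0 → ¬ B x ∧ B (n - 1 - y))
    (hb : ∀ x y, x + y = n → ∀ i, G x y i = G' x y i) {x y : ℕ} (hxy : x + y + 1 < n) :
    m x y = m' x y := by
  have u := h.unique_of_boundary h' B hm hm' hb
  rw [← h.init x y hxy, ← h'.init x y hxy]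
  exact (h.cell_backward h' hxy (u (n - (x + 1 + y)) _ _ (by omega))
    (u (n - (x + (y + 1))) _ _ (by omega)) (u (n - (x + 1 + (y + 1))) _ _ (by omega)) 0).2

/-! #### Parity of the diagonal multiplicities -/

/-- Passing a diagonal cell changes the alternating row sum by a telescoping sum of carry parities:
the parity of the multiplicity enters at the top and that of the last carry leaves at the bottom. -/
theorem diagonal_alternating (h : IsGrowth n m G C) (hs : ∀ x y, m x y = m y x) {k : ℕ}
    (hk : k + k + 1 < n) (N : ℕ) :
    ∑ j ∈ Finset.range N, ((G (k + 1) (k + 1) (2 * j) : ℤ) - G (k + 1) (k + 1) (2 * j + 1)) =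
      ∑ j ∈ Finset.range N, ((G k k (2 * j) : ℤ) - G k k (2 * j + 1)) +
        (m k k % 2 : ℕ) - (C k k (2 * N) % 2 : ℕ) := by
  have hm : (fun x y => m y x) = m := by ext x y; exact hs y x
  have ht := h.transpose
  rw [hm] at ht
  -- The two middle corners agree by symmetry, so by `cons` the growth of row `i` has the parity of
  -- `C k k i + C k k (i + 1)`. It is 0 or 1, and two odd carries are impossible since a nonzero `C
  -- k k i` forces growth 1.
  have step : ∀ i, G (k + 1) (k + 1) i = G k k i + C k k i % 2 + C k k (i + 1) % 2 := by
    intro i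
    have e : G (k + 1) k i = G k (k + 1) i := h.unique ht _ _ _ rfl (by omega) i
    have r := h.rule k k i hk
    have c := h.cons k k i hk
    have s := h.strip_up (x := k) (y := k) (by omega) i
    split_ifs at r <;> omega
  induction N with
  | zero => simp [h.init k k hk]
  | succ N ih =>
    rw [Finset.sum_range_succ, Finset.sum_range_succ, ih, step (2 * N), step (2 * N + 1)]
    push_cast
    rw [show 2 * (N + 1) = 2 * N + 1 + 1 by ring]
    ring

/-- In a symmetric growth diagram all multiplicities on the diagonal are even if and only if all
columns of the partition at the end of the diagonal have even length. -/
theorem diagonal_even_iff (h : IsGrowth n m G C) (hs : ∀ x y, m x y = m y x) {e : ℕ}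
    (he : e + e ≤ n) :
    (∀ k, k < e → Even (m k k)) ↔ ∀ j, G e e (2 * j) = G e e (2 * j + 1) := by
  -- Summed along the diagonal, the alternating sum counts the odd multiplicities. Its terms are
  -- nonnegative, so it vanishes if and only if each of them does.
  have hN : ∃ N, ∀ N', N ≤ N' → ∑ j ∈ Finset.range N', ((G e e (2 * j) : ℤ) - G e e (2 * j + 1)) =
      ∑ k ∈ Finset.range e, ((m k k % 2 : ℕ) : ℤ) := by
    induction e with
    | zero => exact ⟨0, fun N' _ => by simp [h.left]⟩
    | succ e ih =>
      obtain ⟨N, hN⟩ := ih (by omega)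
      obtain ⟨M, hM⟩ := h.carry_eventually_zero (x := e) (y := e) (by omega)
      refine ⟨N + M, fun N' hN' => ?_⟩
      rw [h.diagonal_alternating hs (by omega), hN N' (by omega), Finset.sum_range_succ,
        hM _ (by omega)]
      simp
  obtain ⟨N, hN⟩ := hN
  have hanti : ∀ j, G e e (2 * j + 1) ≤ G e e (2 * j) := fun j => h.row_succ_le he _
  constructor
  · intro hev j
    have h0 := hN (N + j + 1) (by omega)
    rw [Finset.sum_eq_zero (s := Finset.range e) (fun k hk => by
      have := hev k (Finset.mem_range.1 hk)
      rw [Nat.even_iff.1 this]; rfl)] at h0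
    rw [Finset.sum_eq_zero_iff_of_nonneg (fun j _ => by have := hanti j; omega)] at h0
    have := h0 j (Finset.mem_range.2 (by omega))
    omega
  · intro hG k hk
    have h0 := hN N le_rfl
    rw [Finset.sum_eq_zero (s := Finset.range N) (fun j _ => by rw [hG j]; ring)] at h0
    have h1 := (Finset.sum_eq_zero_iff_of_nonneg (fun j _ => by positivity)).1 h0.symm k
      (Finset.mem_range.2 hk)
    rw [Nat.even_iff]
    exact_mod_cast h1

end IsGrowth

/-! #### Growth diagrams with prescribed boundary -/

/-- Three of the corners of a cell and the carries in it, where the partitions are vertical strips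
apart. -/
structure IsCell (ρ μ ν lam c : ℕ → ℕ) : Prop where
  rule : ∀ i, lam i = max (max (μ i) (ν i)) (ρ i + if c i = 0 then 0 else 1)
  cons : ∀ i, c (i + 1) + lam i + ρ i = c i + μ i + ν i
  le_left : ∀ i, ρ i ≤ μ i ∧ μ i ≤ ρ i + 1
  le_right : ∀ i, ρ i ≤ ν i ∧ ν i ≤ ρ i + 1

/-- Existence for the backward rule, solved from the bottom row upwards; the induction strips off
row 0. -/
theorem exists_isCell (N : ℕ) : ∀ (μ ν lam : ℕ → ℕ), (∀ i, lam (i + 1) ≤ lam i) →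
    (∀ i, μ i ≤ lam i ∧ lam i ≤ μ i + 1) → (∀ i, ν i ≤ lam i ∧ lam i ≤ ν i + 1) →
    (∀ i, N ≤ i → lam i = 0) → ∃ ρ c, IsCell ρ μ ν lam c ∧ ∀ i, N ≤ i → c i = 0 := by
  induction N with
  | zero =>
    intro μ ν lam _ hμ hν h0
    refine ⟨fun _ => 0, fun _ => 0, ⟨?_, ?_, ?_, ?_⟩, fun _ _ => rfl⟩ <;> intro i <;>
      have := hμ i <;> have := hν i <;> have := h0 i (by omega) <;> simp <;> omega
  | succ N ih =>
    intro μ ν lam ha hμ hν h0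
    obtain ⟨ρ, c, h, hc⟩ := ih (fun i => μ (i + 1)) (fun i => ν (i + 1)) (fun i => lam (i + 1))
      (fun i => ha _) (fun i => hμ _) (fun i => hν _) (fun i hi => h0 _ (by omega))
    have r := h.rule 0
    have a := ha 0
    simp only [zero_add] at r a
    have b1 := hμ 0
    have b2 := hν 0
    -- The backward rule is the forward one with maximum replaced by minimum; `c 0` is the carry out
    -- of row 0. If it is nonzero then `lam 0 ≥ lam 1 ≥ 1`, so the subtraction is not truncated.
    obtain ⟨r0, hr0⟩ : ∃ r0, r0 = min (min (μ 0) (ν 0)) (lam 0 - if c 0 = 0 then 0 else 1) :=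
      ⟨_, rfl⟩
    obtain ⟨c0, hc0⟩ : ∃ c0, c0 + μ 0 + ν 0 = c 0 + lam 0 + r0 := by
      refine ⟨c 0 + lam 0 + r0 - μ 0 - ν 0, ?_⟩
      split_ifs at hr0 r <;> omega
    have k1 : lam 0 = max (max (μ 0) (ν 0)) (r0 + if c0 = 0 then 0 else 1) := by
      split_ifs at hr0 r ⊢ <;> omega
    have k2 : c 0 + lam 0 + r0 = c0 + μ 0 + ν 0 := hc0.symm
    have k3 : (r0 ≤ μ 0 ∧ μ 0 ≤ r0 + 1) ∧ (r0 ≤ ν 0 ∧ ν 0 ≤ r0 + 1) := by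
      split_ifs at hr0 r <;> omega
    refine ⟨fun i => Nat.casesOn i r0 ρ, fun i => Nat.casesOn i c0 c, ⟨?_, ?_, ?_, ?_⟩, ?_⟩
    · rintro (_ | i)
      exacts [k1, h.rule i]
    · rintro (_ | i)
      exacts [k2, h.cons i]
    · rintro (_ | i)
      exacts [k3.1, h.le_left i]
    · rintro (_ | i)
      exacts [k3.2, h.le_right i]
    · rintro (_ | i) hi
      · omega
      · exact hc i (by omega)

/-- If `ρ (i + 1) > ρ i`, both middle corners would grow in row `i`. This sends a nonzero carry into
row `i + 1` and makes `lam (i + 1) > lam i`. -/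
theorem IsCell.antitone {ρ μ ν lam c : ℕ → ℕ} (h : IsCell ρ μ ν lam c)
    (hμ : ∀ i, μ (i + 1) ≤ μ i) (hν : ∀ i, ν (i + 1) ≤ ν i) (hl : ∀ i, lam (i + 1) ≤ lam i)
    (i : ℕ) : ρ (i + 1) ≤ ρ i := by
  have r1 := h.rule i
  have r2 := h.rule (i + 1)
  have c1 := h.cons i
  have c2 := h.cons (i + 1)
  have := h.le_left i
  have := h.le_left (i + 1)
  have := h.le_right i
  have := h.le_right (i + 1)
  have := hμ i
  have := hν i
  have := hl i
  split_ifs at r1 r2 <;> omega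

theorem IsCell.symm {ρ μ ν lam c : ℕ → ℕ} (h : IsCell ρ μ ν lam c) : IsCell ρ ν μ lam c where
  rule i := by rw [h.rule, max_comm (μ i)]
  cons i := by have := h.cons i; omega
  le_left := h.le_right
  le_right := h.le_left

/-- With `ν = lam`, conservation reads `c (i + 1) = c i + (μ i - ρ i)`, so the carries weakly
increase down the rows. Vanishing far down, they vanish everywhere. -/
theorem IsCell.degenerate {ρ μ ν lam c : ℕ → ℕ} (h : IsCell ρ μ ν lam c)
    (hc : ∃ N, ∀ i, N ≤ i → c i = 0) (hν : ∀ i, ν i = lam i) (i : ℕ) :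
    ρ i = μ i ∧ c i = 0 := by
  obtain ⟨N, hN⟩ := hc
  have step : ∀ i, c (i + 1) = 0 → ρ i = μ i ∧ c i = 0 := by
    intro i h0
    have := h.cons i
    have := h.le_left i
    have := hν i
    omega
  have key : ∀ j i, N ≤ i + j → c i = 0 := by
    intro j
    induction j with
    | zero => intro i hi; exact hN i (by omega)
    | succ j ih => intro i hi; exact (step i (ih (i + 1) (by omega))).2
  exact step i (key N _ (by omega))

open Classical in
/-- The lower left corner of a cell with given other corners, and its carries. -/
noncomputable def cellInverse (μ ν lam : ℕ → ℕ) : (ℕ → ℕ) × (ℕ → ℕ) :=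
  if h : ∃ q : (ℕ → ℕ) × (ℕ → ℕ), IsCell q.1 μ ν lam q.2 ∧ ∃ N, ∀ i, N ≤ i → q.2 i = 0 then
    h.choose
  else (0, 0)

/-- Partitions and carries of the growth diagram with boundary `L`, computed from the boundary
inwards. -/
noncomputable def backwardGrowth (n : ℕ) (L : ℕ → ℕ → ℕ) (x y : ℕ) : (ℕ → ℕ) × (ℕ → ℕ) :=
  -- Just beyond the boundary a fictitious corner is added, the larger of the two neighbouring
  -- boundary partitions. It completes the cells at `x + y = n - 1`, which are then degenerate.
  if n < x + y then (fun i => max (L (x - 1) i) (L x i), 0)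
  else if x + y = n then (L x, 0)
  else cellInverse (backwardGrowth n L (x + 1) y).1 (backwardGrowth n L x (y + 1)).1
    (backwardGrowth n L (x + 1) (y + 1)).1
termination_by n - (x + y)

/-- `L b` is a sequence of partitions from the empty one to the empty one, in which
`L (b + 1) / L b` is a vertical strip if `b` is not in `B`, and `L b / L (b + 1)` is one if it
is. -/
structure IsBoundary (n : ℕ) (B : ℕ → Prop) (L : ℕ → ℕ → ℕ) : Prop where
  first : ∀ i, L 0 i = 0
  last : ∀ i, L n i = 0
  antitone : ∀ b i, L b (i + 1) ≤ L b i
  eventually_zero : ∃ N, ∀ b i, N ≤ i → L b i = 0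
  down : ∀ b i, b < n → B b → L (b + 1) i ≤ L b i ∧ L b i ≤ L (b + 1) i + 1
  up : ∀ b i, b < n → ¬ B b → L b i ≤ L (b + 1) i ∧ L (b + 1) i ≤ L b i + 1

namespace IsBoundary

variable {n : ℕ} {B : ℕ → Prop} {L : ℕ → ℕ → ℕ}

theorem backwardGrowth_on (x y : ℕ) (h : x + y = n) :
    (backwardGrowth n L x y).1 = L x := by
  rw [backwardGrowth, if_neg (by omega), if_pos h]

theorem backwardGrowth_beyond (x y : ℕ) (h : x + y = n) :
    (backwardGrowth n L (x + 1) y).1 = fun i => max (L x i) (L (x + 1) i) := by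
  rw [backwardGrowth, if_pos (by omega)]
  simp

/-- Induction on the distance `k` to the boundary. Partitions and strips have to be carried along,
since `exists_isCell` needs them to produce the next cell. -/
theorem backwardGrowth_spec (h : IsBoundary n B L) : ∀ k x y, x + y + k = n →
    ((∀ i, (backwardGrowth n L x y).1 (i + 1) ≤ (backwardGrowth n L x y).1 i) ∧
      ∃ N, ∀ i, N ≤ i → (backwardGrowth n L x y).1 i = 0) ∧
    (0 < k → IsCell (backwardGrowth n L x y).1 (backwardGrowth n L (x + 1) y).1
        (backwardGrowth n L x (y + 1)).1 (backwardGrowth n L (x + 1) (y + 1)).1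
        (backwardGrowth n L x y).2 ∧
      ∃ N, ∀ i, N ≤ i → (backwardGrowth n L x y).2 i = 0) := by
  intro k
  induction k using Nat.strong_induction_on with
  | _ k ih =>
    intro x y hk
    rcases Nat.eq_zero_or_pos k with rfl | hpos
    · rw [backwardGrowth_on x y (by omega)]
      refine ⟨⟨h.antitone x, ?_⟩, fun h0 => absurd h0 (lt_irrefl _)⟩
      obtain ⟨N, hN⟩ := h.eventually_zero
      exact ⟨N, hN x⟩
    obtain ⟨⟨a1, z1⟩, b1⟩ := ih (k - 1) (by omega) (x + 1) y (by omega)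
    obtain ⟨⟨a2, z2⟩, b2⟩ := ih (k - 1) (by omega) x (y + 1) (by omega)
    -- For `k = 1` the upper right corner is the fictitious one and is not covered by the induction
    -- hypothesis.
    have a3 : ∀ i, (backwardGrowth n L (x + 1) (y + 1)).1 (i + 1) ≤
        (backwardGrowth n L (x + 1) (y + 1)).1 i := by
      rcases Nat.lt_or_ge k 2 with h2 | h2
      · rw [backwardGrowth_beyond x (y + 1) (by omega)]
        exact fun i => max_le_max (h.antitone x i) (h.antitone (x + 1) i)
      · exact (ih (k - 2) (by omega) (x + 1) (y + 1) (by omega)).1.1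
    have z3 : ∃ N, ∀ i, N ≤ i → (backwardGrowth n L (x + 1) (y + 1)).1 i = 0 := by
      rcases Nat.lt_or_ge k 2 with h2 | h2
      · rw [backwardGrowth_beyond x (y + 1) (by omega)]
        obtain ⟨N, hN⟩ := h.eventually_zero
        exact ⟨N, fun i hi => by simp [hN _ i hi]⟩
      · exact (ih (k - 2) (by omega) (x + 1) (y + 1) (by omega)).1.2
    have s : ∀ i, ((backwardGrowth n L (x + 1) y).1 i ≤ (backwardGrowth n L (x + 1) (y + 1)).1 i ∧
          (backwardGrowth n L (x + 1) (y + 1)).1 i ≤ (backwardGrowth n L (x + 1) y).1 i + 1) ∧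
        ((backwardGrowth n L x (y + 1)).1 i ≤ (backwardGrowth n L (x + 1) (y + 1)).1 i ∧
          (backwardGrowth n L (x + 1) (y + 1)).1 i ≤ (backwardGrowth n L x (y + 1)).1 i + 1) := by
      intro i
      rcases Nat.lt_or_ge k 2 with h2 | h2
      · rw [backwardGrowth_beyond x (y + 1) (by omega), backwardGrowth_on (x + 1) y (by omega),
          backwardGrowth_on x (y + 1) (by omega)]
        by_cases hB : B x
        · have := h.down x i (by omega) hB
          simp only []
          omega
        · have := h.up x i (by omega) hB
          simp only []
          omega
      · exact ⟨(b1 (by omega)).1.le_right i, (b2 (by omega)).1.le_left i⟩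
    have hex : ∃ q : (ℕ → ℕ) × (ℕ → ℕ), IsCell q.1 (backwardGrowth n L (x + 1) y).1
        (backwardGrowth n L x (y + 1)).1 (backwardGrowth n L (x + 1) (y + 1)).1 q.2 ∧
        ∃ N, ∀ i, N ≤ i → q.2 i = 0 := by
      obtain ⟨N, hN⟩ := z3
      obtain ⟨ρ, c, hc, hz⟩ := exists_isCell N _ _ _ a3 (fun i => (s i).1) (fun i => (s i).2) hN
      exact ⟨(ρ, c), hc, N, hz⟩
    have hq : backwardGrowth n L x y = hex.choose := by
      rw [backwardGrowth, if_neg (by omega), if_neg (by omega), cellInverse, dif_pos hex]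
    have hspec := hex.choose_spec
    rw [← hq] at hspec
    refine ⟨⟨hspec.1.antitone a1 a2 a3, ?_⟩, fun _ => hspec⟩
    obtain ⟨N, hN⟩ := z1
    exact ⟨N, fun i hi => by have := hspec.1.le_left i; have := hN i hi; omega⟩

theorem isCell (h : IsBoundary n B L) {x y : ℕ} (hxy : x + y < n) :
    IsCell (backwardGrowth n L x y).1 (backwardGrowth n L (x + 1) y).1
        (backwardGrowth n L x (y + 1)).1 (backwardGrowth n L (x + 1) (y + 1)).1
        (backwardGrowth n L x y).2 ∧
      ∃ N, ∀ i, N ≤ i → (backwardGrowth n L x y).2 i = 0 :=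
  (h.backwardGrowth_spec (n - (x + y)) x y (by omega)).2 (by omega)

theorem left_zero (h : IsBoundary n B L) (i : ℕ) : ∀ k y, y + k = n →
    (backwardGrowth n L 0 y).1 i = 0 := by
  intro k
  induction k with
  | zero => intro y hy; rw [backwardGrowth_on 0 y (by omega), h.first]
  | succ k ih =>
    intro y hy
    have := (h.isCell (x := 0) (y := y) (by omega)).1.le_right i
    have := ih (y + 1) (by omega)
    omega

theorem bot_zero (h : IsBoundary n B L) (i : ℕ) : ∀ k x, x + k = n →
    (backwardGrowth n L x 0).1 i = 0 := by
  intro k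
  induction k with
  | zero =>
    intro x hx
    obtain rfl : x = n := by omega
    rw [backwardGrowth_on x 0 (by omega), h.last]
  | succ k ih =>
    intro x hx
    have := (h.isCell (x := x) (y := 0) (by omega)).1.le_left i
    have := ih (x + 1) (by omega)
    omega

/-- At a descent of the boundary the outermost cell of the column has equal upper corners, hence
equal lower corners and no carry; this passes down the column. It puts the multiplicities only where
roots can be. -/
theorem column_degenerate (h : IsBoundary n B L) {x : ℕ} (hB : B x) : ∀ k y, x + y + 1 + k = n →
    ∀ i, (backwardGrowth n L x y).1 i = (backwardGrowth n L (x + 1) y).1 i ∧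
      (backwardGrowth n L x y).2 i = 0 := by
  intro k
  induction k with
  | zero =>
    intro y hy i
    obtain ⟨hc, hz⟩ := h.isCell (x := x) (y := y) (by omega)
    refine hc.degenerate hz (fun i => ?_) i
    rw [backwardGrowth_beyond x (y + 1) (by omega), backwardGrowth_on x (y + 1) (by omega)]
    have := h.down x i (by omega) hB
    simp only []
    omega
  | succ k ih =>
    intro y hy i
    obtain ⟨hc, hz⟩ := h.isCell (x := x) (y := y) (by omega)
    exact hc.degenerate hz (fun i => (ih (y + 1) (by omega) i).1) i

theorem row_degenerate (h : IsBoundary n B L) {y : ℕ} (hB : ¬ B (n - 1 - y)) :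
    ∀ k x, x + y + 1 + k = n → ∀ i,
      (backwardGrowth n L x y).1 i = (backwardGrowth n L x (y + 1)).1 i ∧
      (backwardGrowth n L x y).2 i = 0 := by
  intro k
  induction k with
  | zero =>
    intro x hx i
    obtain ⟨hc, hz⟩ := h.isCell (x := x) (y := y) (by omega)
    refine hc.symm.degenerate hz (fun i => ?_) i
    rw [backwardGrowth_beyond x (y + 1) (by omega), backwardGrowth_on (x + 1) y (by omega)]
    have := h.up x i (by omega) (by rwa [show x = n - 1 - y by omega])
    simp only []
    omega
  | succ k ih =>
    intro x hx i
    obtain ⟨hc, hz⟩ := h.isCell (x := x) (y := y) (by omega)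
    exact hc.symm.degenerate hz (fun i => (ih (x + 1) (by omega) i).1) i

/-- Every boundary is the boundary of a growth diagram. -/
theorem exists_isGrowth (h : IsBoundary n B L) : ∃ m G C, IsGrowth n m G C ∧
    (∀ x y, x + y + 1 < n → m x y ≠ 0 → ¬ B x ∧ B (n - 1 - y)) ∧
    ∀ x y, x + y = n → ∀ i, G x y i = L x i := by
  refine ⟨fun x y => (backwardGrowth n L x y).2 0,
    -- Cut off outside the staircase because `left` and `bot` are demanded at all lattice points.
    fun x y i => if x + y ≤ n then (backwardGrowth n L x y).1 i else 0,
    fun x y => (backwardGrowth n L x y).2, ⟨?_, ?_, ?_, ?_, ?_, ?_⟩, ?_, ?_⟩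
  · intro y i
    split_ifs with h0
    · exact h.left_zero i (n - y) y (by omega)
    · rfl
  · intro x i
    split_ifs with h0
    · exact h.bot_zero i (n - x) x (by omega)
    · rfl
  · intro x y _; rfl
  · intro x y i hxy
    simp only [if_pos (show x + 1 + (y + 1) ≤ n by omega), if_pos (show x + 1 + y ≤ n by omega),
      if_pos (show x + (y + 1) ≤ n by omega), if_pos (show x + y ≤ n by omega)]
    exact (h.isCell (by omega)).1.rule i
  · intro x y i hxy
    simp only [if_pos (show x + 1 + (y + 1) ≤ n by omega), if_pos (show x + 1 + y ≤ n by omega),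
      if_pos (show x + (y + 1) ≤ n by omega), if_pos (show x + y ≤ n by omega)]
    exact (h.isCell (by omega)).1.cons i
  · intro x y hxy
    obtain ⟨N, hN⟩ := (h.backwardGrowth_spec (n - (x + y)) x y (by omega)).1.2
    exact ⟨N, fun i hi => by simp only [if_pos hxy]; exact hN i hi⟩
  · intro x y hxy h0
    refine ⟨fun hB => h0 ?_, ?_⟩
    · exact (h.column_degenerate hB (n - (x + y + 1)) y (by omega) 0).2
    · by_contra hB
      exact h0 (h.row_degenerate hB (n - (x + y + 1)) x (by omega) 0).2
  · intro x y hxy i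
    simp only [if_pos (show x + y ≤ n by omega)]
    rw [backwardGrowth_on x y hxy]

end IsBoundary

/-! ### Insertion of a weakly decreasing list into one row -/

/-- The number of entries of `row` that are less than `x`. -/
def countBelow {n : ℕ} (row : List (Fin n)) (x : ℕ) : ℕ :=
  row.countP (fun s => s.val < x)

/-- The number of entries of `row` that are at least `x`. -/
def countFrom {n : ℕ} (row : List (Fin n)) (x : ℕ) : ℕ :=
  row.countP (fun s => x ≤ s.val)

theorem countBelow_add_countFrom {n : ℕ} (row : List (Fin n)) (x : ℕ) :
    countBelow row x + countFrom row x = row.length := by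
  induction row with
  | nil => rfl
  | cons a row ih =>
    simp only [countBelow, countFrom, List.countP_cons, List.length_cons, decide_eq_true_eq] at *
    split_ifs <;> omega

theorem countBelow_succ {n : ℕ} {row : List (Fin n)} (h : row.Pairwise (· < ·)) (x : Fin n) :
    countBelow row (x.val + 1) = countBelow row x.val + if x ∈ row then 1 else 0 := by
  induction row with
  | nil => rfl
  | cons a row ih =>
    rw [List.pairwise_cons] at h
    have ih := ih h.2
    have ha : x = a → x ∉ row := by
      rintro rfl hx
      exact lt_irrefl _ (h.1 _ hx)
    have e : x = a ↔ x.val = a.val := Fin.ext_iff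
    simp only [countBelow, List.countP_cons, decide_eq_true_eq, List.mem_cons] at *
    by_cases h1 : x = a
    · have h2 := ha h1
      rw [if_neg h2] at ih
      rw [if_pos (Or.inl h1)]
      have := e.1 h1
      split_ifs <;> omega
    · have h3 : ¬ x.val = a.val := fun h => h1 (e.2 h)
      by_cases h2 : x ∈ row
      · rw [if_pos h2] at ih
        rw [if_pos (Or.inr h2)]
        split_ifs <;> omega
      · rw [if_neg h2] at ih
        rw [if_neg (show ¬ (x = a ∨ x ∈ row) by tauto)]
        split_ifs <;> omega

theorem countBelow_mono {n : ℕ} (row : List (Fin n)) {x y : ℕ} (h : x ≤ y) :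
    countBelow row x ≤ countBelow row y :=
  List.countP_mono_left fun s _ hs => by
    simp only [decide_eq_true_eq] at *
    omega

/-- Bounded insertion of `a` into a single row: the new row and the bumped entry. -/
def bumpRow {n : ℕ} (b a : Fin n) (row : List (Fin n)) : List (Fin n) × Option (Fin n) :=
  match (row.filter (fun x => x < b)).find? (fun x => a ≤ x) with
  | none => (row.filter (fun x => x < b) ++ a :: row.filter (fun x => b ≤ x), none)
  | some x => (row.map (fun y => if y = x then a else y), some x)

theorem bumpRow_none {n : ℕ} {b a : Fin n} {row : List (Fin n)} (hr : row.Pairwise (· < ·))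
    (hab : a < b) (h : (bumpRow b a row).2 = none) :
    (bumpRow b a row).1.Pairwise (· < ·) ∧
    (∀ x, countBelow (bumpRow b a row).1 x = countBelow row x + if a.val < x then 1 else 0) ∧
    (∀ x ∈ row, x < b → x < a) := by
  unfold bumpRow at h ⊢
  split at h
  case h_2 => simp at h
  case h_1 hf =>
  rw [List.find?_eq_none] at hf
  have hlt : ∀ x ∈ row, x < b → x < a := fun x hx hxb => by
    simpa using hf x (by simp [hx, hxb])
  refine ⟨?_, ?_, hlt⟩
  · simp only [List.pairwise_append, List.pairwise_cons, List.mem_filter, decide_eq_true_eq,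
      List.mem_cons]
    refine ⟨hr.filter _, ⟨fun x hx => lt_of_lt_of_le hab hx.2, hr.filter _⟩, ?_⟩
    rintro x ⟨hx, hxb⟩ y (rfl | ⟨_, hy⟩)
    · exact hlt x hx hxb
    · exact lt_of_lt_of_le hxb hy
  · intro x
    have hp : (row.filter (fun x => x < b) ++ a :: row.filter (fun x => b ≤ x)).Perm (a :: row) := by
      refine List.perm_middle.trans (List.Perm.cons a ?_)
      have e : (fun x : Fin n => decide (b ≤ x)) = fun x => !decide (x < b) := by
        funext x; rw [← decide_not, decide_eq_decide, not_lt]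
      rw [e]
      exact List.filter_append_perm _ _
    rw [countBelow, hp.countP_eq, List.countP_cons]
    simp [countBelow]

theorem bumpRow_some {n : ℕ} {b a z : Fin n} {row : List (Fin n)} (hr : row.Pairwise (· < ·))
    (h : (bumpRow b a row).2 = some z) :
    (bumpRow b a row).1.Pairwise (· < ·) ∧
    (∀ x, countBelow (bumpRow b a row).1 x + (if z.val < x then 1 else 0) =
      countBelow row x + if a.val < x then 1 else 0) ∧
    (z ∈ row ∧ z < b ∧ a ≤ z) ∧ (∀ x ∈ row, x < z → x < a) ∧ a ∈ (bumpRow b a row).1 ∧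
    (bumpRow b a row).1.length = row.length := by
  unfold bumpRow at h ⊢
  split at h
  case h_1 => simp at h
  case h_2 z' hf =>
  simp only [Option.some.injEq] at h
  subst h
  have hz := List.find?_some hf
  have hzm := List.mem_of_find?_eq_some hf
  simp only [List.mem_filter, decide_eq_true_eq] at hz hzm
  have hlt : ∀ x ∈ row, x < z' → x < a := by
    intro x hx hxz
    rw [List.find?_eq_some_iff_append] at hf
    obtain ⟨-, as, bs, he, has⟩ := hf
    have hxm : x ∈ as ++ z' :: bs := by
      rw [← he]
      simp [hx, hxz.trans hzm.2]
    have hp : (as ++ z' :: bs).Pairwise (· < ·) := he ▸ hr.filter _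
    rw [List.pairwise_append, List.pairwise_cons] at hp
    rcases List.mem_append.1 hxm with h | h
    · simpa using has x h
    · rcases List.mem_cons.1 h with h | h
      · exact absurd hxz (by simp [h])
      · exact absurd hxz (hp.2.1.1 x h).le.not_gt
  obtain ⟨l1, l2, rfl⟩ := List.append_of_mem hzm.1
  rw [List.pairwise_append, List.pairwise_cons] at hr
  have e : List.map (fun y => if y = z' then a else y) (l1 ++ z' :: l2) = l1 ++ a :: l2 := by
    rw [List.map_append, List.map_cons, if_pos rfl]
    congr 1
    · exact (List.map_congr_left fun y hy => if_neg (hr.2.2 y hy z' (by simp)).ne).trans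
        (List.map_id _)
    · congr 1
      exact (List.map_congr_left fun y hy => if_neg (hr.2.1.1 y hy).ne').trans (List.map_id _)
  simp only [e]
  refine ⟨?_, ?_, ⟨by simp, hzm.2, hz⟩, hlt, by simp, by simp⟩
  · rw [List.pairwise_append, List.pairwise_cons]
    refine ⟨hr.1, ⟨fun y hy => lt_of_le_of_lt hz (hr.2.1.1 y hy), hr.2.1.2⟩, ?_⟩
    intro x hx y hy
    rcases List.mem_cons.1 hy with rfl | hy
    · exact hlt x (by simp [hx]) (hr.2.2 x hx z' (by simp))
    · exact hr.2.2 x hx y (by simp [hy])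
  · intro x
    simp only [countBelow, List.countP_append, List.countP_cons, decide_eq_true_eq]
    omega

/-- Bounded insertion of the elements of a list, one after the other, into a single row: the new
row, the list of the bumped entries, and the number of new boxes. -/
def insertAll {n : ℕ} (b : Fin n) : List (Fin n) → List (Fin n) → List (Fin n) × List (Fin n) × ℕ
  | [], row => (row, [], 0)
  | a :: as, row =>
    match (bumpRow b a row).2 with
    | none => ((insertAll b as (bumpRow b a row).1).1, (insertAll b as (bumpRow b a row).1).2.1,
        (insertAll b as (bumpRow b a row).1).2.2 + 1)
    | some z => ((insertAll b as (bumpRow b a row).1).1,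
        z :: (insertAll b as (bumpRow b a row).1).2.1, (insertAll b as (bumpRow b a row).1).2.2)

/-- The list `as` of entries `< b` inserted into the row `S` yields the row `S'` with `k` new boxes,
and the list `out` of bumped entries. -/
structure RowInsertion {n : ℕ} (b : Fin n) (S S' as out : List (Fin n)) (k : ℕ) : Prop where
  sorted : S'.Pairwise (· < ·)
  out_desc : out.Pairwise (· ≥ ·)
  out_lt : ∀ z ∈ out, z < b
  rule : ∀ x : Fin n, x < b → countBelow S' (x.val + 1) =
    max (max (countBelow S (x.val + 1)) (countBelow S' x.val))
      (countBelow S x.val + if as.count x = 0 then 0 else 1)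
  cons : ∀ x : Fin n, x < b → out.count x + countBelow S' (x.val + 1) + countBelow S x.val =
    as.count x + countBelow S (x.val + 1) + countBelow S' x.val
  high : ∀ x, b.val ≤ x → countBelow S' x = countBelow S x + k
  boxes_le : k ≤ 1
  length_row : S'.length = S.length + k
  length_list : out.length + k = as.length

theorem RowInsertion.refl {n : ℕ} (b : Fin n) {S : List (Fin n)} (hS : S.Pairwise (· < ·)) :
    RowInsertion b S S [] [] 0 := by
  refine ⟨hS, List.Pairwise.nil, by simp, fun x hx => ?_, by simp, by simp, by simp, by simp,
    by simp⟩
  have := countBelow_mono S (Nat.le_succ x.val)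
  simp only [List.count_nil, if_true, Nat.succ_eq_add_one] at *
  omega

theorem bumpRow_mem_of_none {n : ℕ} {b a : Fin n} {row : List (Fin n)}
    (h : (bumpRow b a row).2 = none) : a ∈ (bumpRow b a row).1 := by
  unfold bumpRow at h ⊢
  split at h
  case h_2 => simp at h
  case h_1 hf => simp

/-- An entry `≤ t` inserted into a row containing `t < b` bumps something `≤ t` and then takes over
the role of `t` for the rest of the decreasing list. Hence a block creates at most one box per row
and bumps a weakly decreasing list. -/
theorem insertAll_bounded {n : ℕ} {b t : Fin n} (htb : t < b) : ∀ {as row : List (Fin n)},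
    row.Pairwise (· < ·) → as.Pairwise (· ≥ ·) → (∀ a ∈ as, a ≤ t) → t ∈ row →
    (∀ z ∈ (insertAll b as row).2.1, z ≤ t) ∧ (insertAll b as row).2.2 = 0 := by
  intro as
  induction as generalizing t with
  | nil => intros; simp [insertAll]
  | cons a as ih =>
    intro row hr hd hle ht
    rw [List.pairwise_cons] at hd
    have hat := hle a (by simp)
    rcases hz : (bumpRow b a row).2 with _ | z
    · exact absurd ((bumpRow_none hr (hat.trans_lt htb) hz).2.2 t ht htb) hat.not_gt
    · obtain ⟨h1, h2, ⟨h3, h4, h5⟩, h6, h7, -⟩ := bumpRow_some hr hz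
      have ih := ih (hat.trans_lt htb) h1 hd.2 hd.1 h7
      simp only [insertAll, hz, List.mem_cons, forall_eq_or_imp]
      refine ⟨⟨?_, fun y hy => (ih.1 y hy).trans hat⟩, ih.2⟩
      by_contra hzt
      exact absurd (h6 t ht (not_le.1 hzt)) hat.not_gt

theorem countBelow_eq_of_gap {n : ℕ} {row : List (Fin n)} (hr : row.Pairwise (· < ·)) {x : Fin n}
    (hx : x ∉ row) : countBelow row (x.val + 1) = countBelow row x.val := by
  rw [countBelow_succ hr, if_neg hx, add_zero]

/-- Single-row insertion satisfies the local growth rule. In the induction on the list, the first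
bump shifts the counts by the indicators of `a < x` and, if there is a bumped entry `z`, of `z < x`;
values `x > a` do not occur later in the list. -/
theorem insertAll_spec {n : ℕ} {b : Fin n} : ∀ {as row : List (Fin n)}, row.Pairwise (· < ·) →
    as.Pairwise (· ≥ ·) → (∀ a ∈ as, a < b) →
    RowInsertion b row (insertAll b as row).1 as (insertAll b as row).2.1
      (insertAll b as row).2.2 := by
  intro as
  induction as with
  | nil => intro row hr _ _; exact RowInsertion.refl b hr
  | cons a as ih =>
    intro row hr hd hlt
    rw [List.pairwise_cons] at hd
    have hab := hlt a (by simp)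
    have hlt' : ∀ a ∈ as, a < b := fun c hc => hlt c (by simp [hc])
    have hcount : ∀ x : Fin n, a.val < x.val → as.count x = 0 := fun x hx =>
      List.count_eq_zero.2 fun hm => absurd (hd.1 x hm) (not_le.2 hx)
    rcases hz : (bumpRow b a row).2 with _ | z
    · obtain ⟨h1, h2, h3⟩ := bumpRow_none hr hab hz
      have ih := ih h1 hd.2 hlt'
      have hb := insertAll_bounded hab h1 hd.2 hd.1 (bumpRow_mem_of_none hz)
      simp only [insertAll, hz]
      set r := insertAll b as (bumpRow b a row).1
      -- Further insertions can only increase the counts below the bound.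
      have hmono : ∀ x : ℕ, x ≤ b.val → countBelow (bumpRow b a row).1 x ≤ countBelow r.1 x := by
        rintro (_ | x) hx
        · simp [countBelow]
        · have := ih.rule ⟨x, by omega⟩ (by rw [Fin.lt_def]; exact hx)
          simp only [] at this
          omega
      -- Nothing was bumped, so the row has no entry in `[a, b)`; when `z` is bumped, the
      -- corresponding gap is `[a, z)`.
      have hgap : ∀ x : Fin n, a ≤ x → x < b →
          countBelow row (x.val + 1) = countBelow row x.val := fun x hax hxb =>
        countBelow_eq_of_gap hr fun hx => absurd (h3 x hx hxb) hax.not_gt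
      refine ⟨ih.sorted, ih.out_desc, ih.out_lt, ?_, ?_, ?_, ?_, ?_, ?_⟩
      · intro x hx
        have r1 := ih.rule x hx
        have m1 := hmono x.val hx.le
        have c1 := h2 x.val
        have c2 := h2 (x.val + 1)
        have n1 := countBelow_mono row (Nat.le_succ x.val)
        rcases lt_trichotomy a x with hax | rfl | hax
        · have g := hgap x hax.le hx
          rw [hcount x hax] at r1
          rw [List.count_cons_of_ne hax.ne, hcount x hax]
          rw [Fin.lt_def] at hax
          rw [if_pos (by omega)] at c1 c2
          simp only [if_true] at r1 ⊢
          omega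
        · have g := hgap a le_rfl hx
          rw [List.count_cons_self, if_neg (by omega)]
          rw [if_neg (by omega)] at c1
          rw [if_pos (by omega)] at c2
          split_ifs at r1 <;> omega
        · rw [List.count_cons_of_ne hax.ne']
          rw [Fin.lt_def] at hax
          rw [if_neg (by omega)] at c1 c2
          omega
      · intro x hx
        have r1 := ih.cons x hx
        have c1 := h2 x.val
        have c2 := h2 (x.val + 1)
        rw [List.count_cons]
        have e : (a == x) = true ↔ a.val = x.val := by rw [beq_iff_eq, Fin.ext_iff]
        simp only [e]
        split_ifs at c1 c2 ⊢ <;> omega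
      · intro x hx
        have c1 := h2 x
        have := ih.high x hx
        rw [Fin.lt_def] at hab
        rw [if_pos (by omega)] at c1
        omega
      · rw [hb.2]
      · have := ih.length_row
        have c1 := h2 n
        have e : ∀ l : List (Fin n), countBelow l n = l.length := fun l => by
          rw [countBelow, List.countP_eq_length]; simp
        rw [e, e, if_pos a.isLt] at c1
        omega
      · have := ih.length_list
        simp only [List.length_cons]
        omega
    · obtain ⟨h1, h2, ⟨h3, h4, h5⟩, h6, h7, h8⟩ := bumpRow_some hr hz
      have ih := ih h1 hd.2 hlt'
      have hb := insertAll_bounded hab h1 hd.2 hd.1 h7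
      simp only [insertAll, hz]
      set r := insertAll b as (bumpRow b a row).1
      have hmono : ∀ x : ℕ, x ≤ b.val → countBelow (bumpRow b a row).1 x ≤ countBelow r.1 x := by
        rintro (_ | x) hx
        · simp [countBelow]
        · have := ih.rule ⟨x, by omega⟩ (by rw [Fin.lt_def]; exact hx)
          simp only [] at this
          omega
      have hgap : ∀ x : Fin n, a ≤ x → x < z →
          countBelow row (x.val + 1) = countBelow row x.val := fun x hax hxb =>
        countBelow_eq_of_gap hr fun hx => absurd (h6 x hx hxb) hax.not_gt
      have hzs : countBelow row (z.val + 1) = countBelow row z.val + 1 := by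
        rw [countBelow_succ hr, if_pos h3]
      refine ⟨ih.sorted, ?_, ?_, ?_, ?_, ?_, ih.boxes_le, ?_, ?_⟩
      · exact List.pairwise_cons.2 ⟨fun y hy => (hb.1 y hy).trans h5, ih.out_desc⟩
      · simpa using ⟨h4, ih.out_lt⟩
      · intro x hx
        have r1 := ih.rule x hx
        have m1 := hmono x.val hx.le
        have c1 := h2 x.val
        have c2 := h2 (x.val + 1)
        have n1 := countBelow_mono row (Nat.le_succ x.val)
        rw [Fin.le_def] at h5
        rcases lt_trichotomy a x with hax | rfl | hax
        · rw [hcount x hax] at r1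
          rw [List.count_cons_of_ne hax.ne, hcount x hax]
          simp only [if_true] at r1 ⊢
          rcases lt_trichotomy x z with hxz | rfl | hxz
          · have g := hgap x hax.le hxz
            rw [Fin.lt_def] at hax hxz
            split_ifs at c1 c2 <;> omega
          · rw [Fin.lt_def] at hax
            split_ifs at c1 c2 <;> omega
          · rw [Fin.lt_def] at hax hxz
            split_ifs at c1 c2 <;> omega
        · rw [List.count_cons_self, if_neg (by omega)]
          rcases lt_or_ge a z with hxz | hxz
          · have g := hgap a le_rfl hxz
            rw [Fin.lt_def] at hxz
            split_ifs at r1 c1 c2 <;> omega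
          · rw [Fin.le_def] at hxz
            have e : z = a := Fin.ext (by omega)
            rw [e] at hzs
            split_ifs at r1 c1 c2 <;> omega
        · rw [List.count_cons_of_ne hax.ne']
          rw [Fin.lt_def] at hax
          rw [if_neg (by omega), if_neg (by omega)] at c1 c2
          omega
      · intro x hx
        have r1 := ih.cons x hx
        have c1 := h2 x.val
        have c2 := h2 (x.val + 1)
        rw [List.count_cons, List.count_cons]
        have e : (a == x) = true ↔ a.val = x.val := by rw [beq_iff_eq, Fin.ext_iff]
        have e' : (z == x) = true ↔ z.val = x.val := by rw [beq_iff_eq, Fin.ext_iff]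
        simp only [e, e']
        split_ifs at c1 c2 ⊢ <;> omega
      · intro x hx
        have c1 := h2 x
        have := ih.high x hx
        rw [Fin.lt_def] at hab h4
        rw [if_pos (by omega), if_pos (by omega)] at c1
        omega
      · rw [ih.length_row, h8]
      · have := ih.length_list
        simp only [List.length_cons]
        omega

/-! ### Insertion of a weakly decreasing list into a tableau -/

theorem boundedInsert_cons {n : ℕ} (b a : Fin n) (row : List (Fin n)) (P : NotchedTableau (Fin n)) :
    boundedInsert b a (row :: P) =
      match (bumpRow b a row).2 with
      | none => ((bumpRow b a row).1 :: P, 0)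
      | some z => ((bumpRow b a row).1 :: (boundedInsert b z P).1, (boundedInsert b z P).2 + 1) := by
  rw [boundedInsert, bumpRow]
  cases (row.filter (fun x => x < b)).find? (fun x => a ≤ x) <;> rfl

/-- A whole block may be inserted row by row instead of entry by entry: the lower rows see only the
bumped entries, in the order in which they are bumped. -/
theorem foldl_brskStep_cons {n : ℕ} (b : Fin n) : ∀ (as row q : List (Fin n))
    (P Q : NotchedTableau (Fin n)),
    (as.map (fun a => (a, b))).foldl brskStep (row :: P, q :: Q) =
      ((insertAll b as row).1 ::
          (((insertAll b as row).2.1.map (fun a => (a, b))).foldl brskStep (P, Q)).1,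
        (List.replicate (insertAll b as row).2.2 b ++ q) ::
          (((insertAll b as row).2.1.map (fun a => (a, b))).foldl brskStep (P, Q)).2) := by
  intro as
  induction as with
  | nil => intros; simp [insertAll]
  | cons a as ih =>
    intro row q P Q
    rw [List.map_cons, List.foldl_cons, brskStep]
    simp only [boundedInsert_cons]
    rcases hz : (bumpRow b a row).2 with _ | z
    · simp only [placeLeft, ih, insertAll, hz]
      simp [List.replicate_succ']
    · simp only [placeLeft, ih, insertAll, hz]
      simp [brskStep]

/-- As soon as one entry is inserted, an absent row behaves like an empty one. This reduces the
opening of a new bottom row to the preceding lemma. -/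
theorem foldl_brskStep_nil {n : ℕ} (b a : Fin n) (as : List (Fin n)) :
    ((a :: as).map (fun a => (a, b))).foldl brskStep ([], []) =
      ((a :: as).map (fun a => (a, b))).foldl brskStep ([[]], [[]]) := by
  simp [brskStep, boundedInsert, placeLeft]

/-- The rows before and after the insertion of a list, with the lists `L i` of the entries inserted
into row `i`. -/
structure TableauInsertion {n : ℕ} (b : Fin n) (as : List (Fin n))
    (B B' : NotchedTableau (Fin n) × NotchedTableau (Fin n)) (L : ℕ → List (Fin n)) (k : ℕ → ℕ) :
    Prop where
  start : L 0 = as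
  row : ∀ i, RowInsertion b (B.1.getD i []) (B'.1.getD i []) (L i) (L (i + 1)) (k i)
  label : ∀ i, B'.2.getD i [] = List.replicate (k i) b ++ B.2.getD i []
  length_eq : B'.1.length = B'.2.length
  nonempty : (∀ r ∈ B.1, r ≠ []) → ∀ r ∈ B'.1, r ≠ []

theorem TableauInsertion.consRow {n : ℕ} {b : Fin n} {as row q : List (Fin n)}
    {P Q : NotchedTableau (Fin n)} {L : ℕ → List (Fin n)} {k : ℕ → ℕ}
    {B' : NotchedTableau (Fin n) × NotchedTableau (Fin n)}
    (h : TableauInsertion b (insertAll b as row).2.1 (P, Q) B' L k)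
    (hr : row.Pairwise (· < ·)) (has : as.Pairwise (· ≥ ·)) (hlt : ∀ a ∈ as, a < b) :
    TableauInsertion b as (row :: P, q :: Q) ((insertAll b as row).1 :: B'.1,
        (List.replicate (insertAll b as row).2.2 b ++ q) :: B'.2)
      (fun i => Nat.casesOn i as L) (fun i => Nat.casesOn i (insertAll b as row).2.2 k) where
  start := rfl
  row i := by
    cases i with
    | zero =>
      have := insertAll_spec hr has hlt
      rw [← h.start] at this
      simpa using this
    | succ i => simpa using h.row i
  label i := by
    cases i with
    | zero => simp
    | succ i => simpa using h.label i
  length_eq := by simpa using h.length_eq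
  nonempty hne r hr' := by
    simp only [List.mem_cons, forall_eq_or_imp] at hne hr'
    rcases hr' with rfl | hr'
    · intro h0
      have := (insertAll_spec hr has hlt).length_row
      rw [h0] at this
      have h1 := List.length_pos_iff.2 hne.1
      simp only [List.length_nil] at this
      omega
    · exact h.nonempty hne.2 r hr'

theorem tableauInsertion_nil {n : ℕ} (b : Fin n) : ∀ (N : ℕ) (as : List (Fin n)), as.length ≤ N →
    as.Pairwise (· ≥ ·) → (∀ a ∈ as, a < b) →
    ∃ L k, TableauInsertion b as ([], [])
      ((as.map (fun a => (a, b))).foldl brskStep ([], [])) L k := by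
  have base : ∃ L k, TableauInsertion b [] ([], [])
      (([].map (fun a => (a, b))).foldl brskStep ([], [])) L k :=
    ⟨fun _ => [], fun _ => 0, rfl,
      fun i => by simpa using RowInsertion.refl b (S := []) List.Pairwise.nil, by simp, by simp,
      by simp⟩
  intro N
  induction N with
  | zero =>
    intro as h0 _ _
    obtain rfl : as = [] := List.length_eq_zero_iff.1 (by omega)
    exact base
  | succ N ih =>
    intro as hN hd hlt
    rcases as with _ | ⟨a, as⟩
    · exact base
    have hs := insertAll_spec (b := b) (row := []) List.Pairwise.nil hd hlt
    -- The first entry of the list opens a box in the empty row, so the bumped list is shorter and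
    -- the induction on the length applies.
    have hpos : 1 ≤ (insertAll b (a :: as) []).2.2 := by simp [insertAll, bumpRow]
    have hl := hs.length_list
    obtain ⟨L, k, h⟩ := ih (insertAll b (a :: as) []).2.1 (by omega) hs.out_desc hs.out_lt
    obtain ⟨L', k', this⟩ : ∃ L' k', TableauInsertion b (a :: as) ([[]], [[]]) _ L' k' :=
      ⟨_, _, h.consRow (q := []) List.Pairwise.nil hd hlt⟩
    rw [← foldl_brskStep_cons, ← foldl_brskStep_nil] at this
    refine ⟨L', k', this.start, fun i => ?_, fun i => ?_, this.length_eq, fun _ => ?_⟩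
    · have h1 := this.row i
      cases i <;> simpa using h1
    · have h1 := this.label i
      cases i <;> simpa using h1
    · rw [foldl_brskStep_nil, foldl_brskStep_cons]
      simp only [List.mem_cons, forall_eq_or_imp]
      refine ⟨fun h0 => ?_, h.nonempty (by simp)⟩
      have h2 := hs.length_row
      rw [h0] at h2
      simp only [List.length_nil] at h2
      omega

theorem tableauInsertion {n : ℕ} (b : Fin n) : ∀ (P Q : NotchedTableau (Fin n)),
    P.length = Q.length → (∀ r ∈ P, r.Pairwise (· < ·)) → ∀ as : List (Fin n),
    as.Pairwise (· ≥ ·) → (∀ a ∈ as, a < b) →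
    ∃ L k, TableauInsertion b as (P, Q) ((as.map (fun a => (a, b))).foldl brskStep (P, Q)) L k := by
  intro P
  induction P with
  | nil =>
    intro Q hQ _ as hd hlt
    obtain rfl : Q = [] := List.length_eq_zero_iff.1 hQ.symm
    exact tableauInsertion_nil b _ as le_rfl hd hlt
  | cons row P ih =>
    intro Q hQ hP as hd hlt
    rcases Q with _ | ⟨q, Q⟩
    · simp at hQ
    have hr := hP row (by simp)
    have hs := insertAll_spec (b := b) hr hd hlt
    obtain ⟨L, k, h⟩ := ih Q (by simpa using hQ) (fun r h => hP r (by simp [h])) _ hs.out_desc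
      hs.out_lt
    have := h.consRow (q := q) hr hd hlt
    rw [← foldl_brskStep_cons] at this
    exact ⟨_, _, this⟩

/-! ### The growth diagram of a negative multiset -/

theorem coe_insertionList {A : Type*} [LinearOrder A] (U : Multiset (A × A)) :
    (insertionList U : Multiset (A × A)) = U := by
  rw [insertionList, ← Multiset.map_coe, Multiset.sort_eq, Multiset.map_map]
  exact (Multiset.map_congr rfl fun u _ => rfl).trans (Multiset.map_id _)

theorem pairwise_insertionList {A : Type*} [LinearOrder A] (U : Multiset (A × A)) :
    (insertionList U).Pairwise (fun u v => v.2 ≤ u.2 ∧ (u.2 = v.2 → v.1 ≤ u.1)) := by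
  rw [insertionList, List.pairwise_map]
  refine (Multiset.pairwise_sort _ _).imp ?_
  intro x y h
  rw [ge_iff_le, Prod.Lex.le_iff] at h
  rcases h with h | h
  · exact ⟨h.le, fun e => absurd e h.ne'⟩
  · exact ⟨h.1.le, fun _ => h.2⟩

/-- Second coordinates weakly decrease, so pairs with the bound `n - 1 - y` are processed
immediately after those with larger bounds. -/
theorem filter_succ_of_pairwise {n : ℕ} {l : List (Fin n × Fin n)}
    (hl : l.Pairwise (fun u v => v.2 ≤ u.2 ∧ (u.2 = v.2 → v.1 ≤ u.1))) (y : ℕ) :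
    l.filter (fun u => n ≤ u.2.val + (y + 1)) =
      l.filter (fun u => n ≤ u.2.val + y) ++ l.filter (fun u => u.2.val + y + 1 = n) := by
  induction l with
  | nil => rfl
  | cons u l ih =>
    rw [List.pairwise_cons] at hl
    have ih := ih hl.2
    rcases Nat.lt_trichotomy (u.2.val + y + 1) n with h | h | h
    · rw [List.filter_cons_of_neg (by simp; omega), List.filter_cons_of_neg (by simp; omega),
        List.filter_cons_of_neg (by simp; omega), ih]
    · have e : l.filter (fun u => n ≤ u.2.val + y) = [] := by
        rw [List.filter_eq_nil_iff]
        intro v hv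
        have := (hl.1 v hv).1
        rw [Fin.le_def] at this
        simp
        omega
      rw [e] at ih
      rw [List.filter_cons_of_pos (by simp; omega), List.filter_cons_of_neg (by simp; omega),
        List.filter_cons_of_pos (by simp; omega), ih, e]
      rfl
    · rw [List.filter_cons_of_pos (by simp; omega), List.filter_cons_of_pos (by simp; omega),
        List.filter_cons_of_neg (by simp; omega), ih]
      rfl

/-- The bitableau after the insertion of all elements `(r, c)` with `n - y ≤ c`. -/
def stage {n : ℕ} (l : List (Fin n × Fin n)) (y : ℕ) :
    NotchedTableau (Fin n) × NotchedTableau (Fin n) :=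
  (l.filter (fun u => n ≤ u.2.val + y)).foldl brskStep ([], [])

/-- The entries that are inserted with the bound `n - 1 - y`. -/
def block {n : ℕ} (l : List (Fin n × Fin n)) (y : ℕ) : List (Fin n) :=
  (l.filter (fun u => u.2.val + y + 1 = n)).map Prod.fst

theorem block_map {n : ℕ} (l : List (Fin n × Fin n)) {y : ℕ} {b : Fin n} (hb : b.val + y + 1 = n) :
    (block l y).map (fun a => (a, b)) = l.filter (fun u => u.2.val + y + 1 = n) := by
  rw [block, List.map_map]
  refine (List.map_congr_left fun u hu => ?_).trans (List.map_id _)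
  simp only [List.mem_filter, decide_eq_true_eq] at hu
  have e : u.2 = b := Fin.ext (by omega)
  simp [← e]

theorem stage_succ {n : ℕ} {l : List (Fin n × Fin n)}
    (hl : l.Pairwise (fun u v => v.2 ≤ u.2 ∧ (u.2 = v.2 → v.1 ≤ u.1))) {y : ℕ} {b : Fin n}
    (hb : b.val + y + 1 = n) :
    stage l (y + 1) = ((block l y).map (fun a => (a, b))).foldl brskStep (stage l y) := by
  rw [stage, filter_succ_of_pairwise hl, List.foldl_append, block_map l hb, stage]

/-- The properties of a bitableau in the course of the insertion. -/
structure StageInvariant {n : ℕ} (y : ℕ) (B : NotchedTableau (Fin n) × NotchedTableau (Fin n)) :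
    Prop where
  length_eq : B.1.length = B.2.length
  sortedP : ∀ r ∈ B.1, r.Pairwise (· < ·)
  nonempty : ∀ r ∈ B.1, r ≠ []
  row_length : ∀ i, (B.1.getD i []).length = (B.2.getD i []).length
  sortedQ : ∀ i, (B.2.getD i []).Pairwise (· < ·)
  labels : ∀ i, ∀ c ∈ B.2.getD i [], n ≤ c.val + y

theorem forall_mem_of_getD {α : Type*} {l : List α} {d : α} {p : α → Prop}
    (h : ∀ i, p (l.getD i d)) : ∀ r ∈ l, p r := by
  intro r hr
  obtain ⟨i, hi, rfl⟩ := List.getElem_of_mem hr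
  have := h i
  rwa [List.getD_eq_getElem _ _ hi] at this

theorem StageInvariant.next {n y : ℕ} {b : Fin n} (hb : b.val + y + 1 = n) {as : List (Fin n)}
    {B B' : NotchedTableau (Fin n) × NotchedTableau (Fin n)} {L : ℕ → List (Fin n)} {k : ℕ → ℕ}
    (h : StageInvariant y B) (hL : TableauInsertion b as B B' L k) : StageInvariant (y + 1) B' where
  length_eq := hL.length_eq
  sortedP := forall_mem_of_getD (d := []) fun i => (hL.row i).sorted
  nonempty := hL.nonempty h.nonempty
  row_length i := by
    rw [hL.label i, (hL.row i).length_row, List.length_append, List.length_replicate,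
      h.row_length i, add_comm]
  sortedQ i := by
    rw [hL.label i]
    have hlt : ∀ c ∈ B.2.getD i [], b < c := fun c hc => by
      have := h.labels i c hc
      rw [Fin.lt_def]
      omega
    -- More than one new box in a row would repeat the label `b` and destroy strictness in `Q`.
    have := (hL.row i).boxes_le
    rcases Nat.le_one_iff_eq_zero_or_eq_one.1 this with h0 | h1
    · simpa [h0] using h.sortedQ i
    · rw [h1]
      exact List.pairwise_cons.2 ⟨hlt, h.sortedQ i⟩
  labels i c hc := by
    rw [hL.label i, List.mem_append, List.mem_replicate] at hc
    rcases hc with hc | hc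
    · rw [hc.2]; omega
    · have := h.labels i c hc; omega

theorem block_spec {n : ℕ} {l : List (Fin n × Fin n)}
    (hl : l.Pairwise (fun u v => v.2 ≤ u.2 ∧ (u.2 = v.2 → v.1 ≤ u.1)))
    (hlt : ∀ u ∈ l, u.1 < u.2) {y : ℕ} {b : Fin n} (hb : b.val + y + 1 = n) :
    (block l y).Pairwise (· ≥ ·) ∧ ∀ a ∈ block l y, a < b := by
  constructor
  · rw [block, List.pairwise_map]
    refine List.Pairwise.imp_of_mem ?_ (hl.filter _)
    intro u v hu hv h
    simp only [List.mem_filter, decide_eq_true_eq] at hu hv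
    exact h.2 (Fin.ext (by omega))
  · intro a ha
    simp only [block, List.mem_map, List.mem_filter, decide_eq_true_eq] at ha
    obtain ⟨u, ⟨hu, hb'⟩, rfl⟩ := ha
    have e : u.2 = b := Fin.ext (by omega)
    exact e ▸ hlt u hu

theorem stage_zero {n : ℕ} (l : List (Fin n × Fin n)) : stage l 0 = ([], []) := by
  rw [stage, List.filter_eq_nil_iff.2]
  · rfl
  · intro u _
    have := u.2.isLt
    simp

theorem stage_last {n : ℕ} (l : List (Fin n × Fin n)) :
    stage l n = l.foldl brskStep ([], []) := by
  rw [stage, List.filter_eq_self.2]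
  intro u _
  simp

theorem stageInvariant {n : ℕ} {l : List (Fin n × Fin n)}
    (hl : l.Pairwise (fun u v => v.2 ≤ u.2 ∧ (u.2 = v.2 → v.1 ≤ u.1)))
    (hlt : ∀ u ∈ l, u.1 < u.2) : ∀ y, y ≤ n → StageInvariant y (stage l y) := by
  intro y
  induction y with
  | zero =>
    intro _
    rw [stage_zero]
    constructor <;> simp
  | succ y ih =>
    intro hy
    have ih := ih (by omega)
    let b : Fin n := ⟨n - 1 - y, by omega⟩
    have hb : b.val + y + 1 = n := by simp only [b]; omega
    obtain ⟨h1, h2⟩ := block_spec hl hlt hb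
    obtain ⟨L, k, hL⟩ := tableauInsertion b (stage l y).1 (stage l y).2 ih.length_eq ih.sortedP _
      h1 h2
    rw [stage_succ hl hb]
    exact ih.next hb hL

/-- The witnesses precede `b` and exist even when no bound `n - 1 - y` does, so that they can be
chosen as functions of every `y`. -/
theorem exists_insertion {n : ℕ} {l : List (Fin n × Fin n)}
    (hl : l.Pairwise (fun u v => v.2 ≤ u.2 ∧ (u.2 = v.2 → v.1 ≤ u.1)))
    (hlt : ∀ u ∈ l, u.1 < u.2) (y : ℕ) : ∃ L k, ∀ b : Fin n, b.val + y + 1 = n →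
      TableauInsertion b (block l y) (stage l y) (stage l (y + 1)) L k := by
  by_cases hy : y < n
  · let b : Fin n := ⟨n - 1 - y, by omega⟩
    have hb : b.val + y + 1 = n := by simp only [b]; omega
    have ih := stageInvariant hl hlt y (by omega)
    obtain ⟨h1, h2⟩ := block_spec hl hlt hb
    obtain ⟨L, k, hL⟩ := tableauInsertion b (stage l y).1 (stage l y).2 ih.length_eq ih.sortedP _
      h1 h2
    refine ⟨L, k, fun b' hb' => ?_⟩
    obtain rfl : b' = b := Fin.ext (by omega)
    rwa [stage_succ hl hb]
  · exact ⟨fun _ => [], fun _ => 0, fun b hb => by omega⟩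

/-- The multiplicity of the root `(x, n - 1 - y)` in `U`. -/
def cellMult {n : ℕ} (U : Multiset (Fin n × Fin n)) (x y : ℕ) : ℕ :=
  U.countP (fun u => u.1.val = x ∧ u.2.val + y + 1 = n)

theorem count_block {n : ℕ} (l : List (Fin n × Fin n)) (y : ℕ) (x : Fin n) :
    (block l y).count x = cellMult (l : Multiset (Fin n × Fin n)) x.val y := by
  rw [block, List.count, List.countP_map, List.countP_filter, cellMult, Multiset.coe_countP]
  refine List.countP_congr fun u _ => ?_
  simp [Fin.ext_iff]

/-- The numbers of small entries in the course of the insertion form a growth diagram, the boundary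
of which is read off the resulting bitableau. -/
theorem exists_isGrowth_brskNegative {n : ℕ} {U : Multiset (Fin n × Fin n)}
    (hU : ∀ u ∈ U, u.1 < u.2) : ∃ G C, IsGrowth n (cellMult U) G C ∧
      (∀ b y i, b + y = n → G b y i + countFrom ((brskNegative U).1.getD i []) b =
        countFrom ((brskNegative U).2.getD i []) b) := by
  set l := insertionList U with hlU
  have hl := pairwise_insertionList U
  have hlt : ∀ u ∈ l, u.1 < u.2 := fun u hu => hU u (by rw [← coe_insertionList U]; exact hu)
  rw [← hlU] at hl
  have hinv := stageInvariant hl hlt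
  choose L k hL using exists_insertion hl hlt
  -- The partition counts the small entries of each row at stage `y`; the carries are the
  -- multiplicities of `x` in the lists inserted into the rows.
  refine ⟨fun x y i => countBelow ((stage l y).1.getD i []) x,
    fun x y i => (L y i).countP (fun s => s.val = x), ⟨?_, ?_, ?_, ?_, ?_, ?_⟩, ?_⟩
  · intro y i
    simp [countBelow]
  · intro x i
    simp [stage_zero, countBelow]
  · intro x y hxy
    have h := hL y ⟨n - 1 - y, by omega⟩ (by simp only []; omega)
    have := count_block l y ⟨x, by omega⟩
    rw [coe_insertionList] at this
    rw [← this, h.start, List.count]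
    exact List.countP_congr fun u _ => by simp [Fin.ext_iff]
  · intro x y i hxy
    have h := (hL y ⟨n - 1 - y, by omega⟩ (by simp only []; omega)).row i
    have r := h.rule ⟨x, by omega⟩ (by rw [Fin.lt_def]; simp only []; omega)
    have e : (L y i).count ⟨x, by omega⟩ = (L y i).countP (fun s => s.val = x) :=
      List.countP_congr fun u _ => by simp [Fin.ext_iff]
    rw [e] at r
    exact r
  · intro x y i hxy
    have h := (hL y ⟨n - 1 - y, by omega⟩ (by simp only []; omega)).row i
    have r := h.cons ⟨x, by omega⟩ (by rw [Fin.lt_def]; simp only []; omega)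
    have e : ∀ i, (L y i).count ⟨x, by omega⟩ = (L y i).countP (fun s => s.val = x) := fun i =>
      List.countP_congr fun u _ => by simp [Fin.ext_iff]
    rw [e, e] at r
    simp only [] at r ⊢
    omega
  · intro x y hxy
    refine ⟨(stage l y).1.length, fun i hi => ?_⟩
    rw [List.getD_eq_default _ _ hi]
    rfl
  · intro b y i hby
    -- At stage `y = n - b` all labels are `≥ b`, so the row lengths of `P` and `Q` give the
    -- identity. Later bounds are `< b`: they neither move entries `≥ b` of `P` nor add labels `≥
    -- b`.
    have key : ∀ j, y + j ≤ n → countBelow ((stage l y).1.getD i []) b +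
        countFrom ((stage l (y + j)).1.getD i []) b =
        countFrom ((stage l (y + j)).2.getD i []) b := by
      intro j
      induction j with
      | zero =>
        intro hj
        have h := hinv y (by omega)
        rw [add_zero, countBelow_add_countFrom, h.row_length i, eq_comm, countFrom,
          List.countP_eq_length]
        intro c hc
        have := h.labels i c hc
        simp
        omega
      | succ j ih =>
        intro hj
        have ih := ih (by omega)
        have h := hL (y + j) ⟨n - 1 - (y + j), by omega⟩ (by simp only []; omega)
        have h1 := (h.row i).high b (by simp only []; omega)
        have h2 := (h.row i).length_row
        have h3 := countBelow_add_countFrom ((stage l (y + j)).1.getD i []) b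
        have h4 := countBelow_add_countFrom ((stage l (y + j + 1)).1.getD i []) b
        have h5 : countFrom ((stage l (y + j + 1)).2.getD i []) b =
            countFrom ((stage l (y + j)).2.getD i []) b := by
          rw [h.label i, countFrom, List.countP_append, List.countP_replicate, if_neg, zero_add]
          · rfl
          · simp
            omega
        rw [← add_assoc, h5]
        omega
    have := key (n - y) (by omega)
    rw [show y + (n - y) = n by omega, stage_last] at this
    exact this

theorem stageInvariant_brskNegative {n : ℕ} {U : Multiset (Fin n × Fin n)}
    (hU : ∀ u ∈ U, u.1 < u.2) : StageInvariant n (brskNegative U) := by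
  have hlt : ∀ u ∈ insertionList U, u.1 < u.2 := fun u hu =>
    hU u (by rw [← coe_insertionList U]; exact hu)
  have := stageInvariant (pairwise_insertionList U) hlt n le_rfl
  rwa [stage_last] at this

/-! ### Entries and degree -/

theorem boundedInsert_mem {A : Type*} [LinearOrder A] {p : A → Prop} (b : A) :
    ∀ (P : NotchedTableau A) (a : A), p a → (∀ r ∈ P, ∀ x ∈ r, p x) →
      ∀ r ∈ (boundedInsert b a P).1, ∀ x ∈ r, p x := by
  intro P
  induction P with
  | nil => intro a ha _; simpa [boundedInsert] using ha
  | cons row P ih =>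
    intro a ha hP
    simp only [List.mem_cons, forall_eq_or_imp] at hP
    rw [boundedInsert]
    split
    · simp only [List.mem_cons, forall_eq_or_imp]
      refine ⟨fun x hx => ?_, hP.2⟩
      simp only [List.mem_append, List.mem_filter, List.mem_cons] at hx
      rcases hx with hx | rfl | hx
      exacts [hP.1 x hx.1, ha, hP.1 x hx.1]
    · next z hz =>
      have hzr : z ∈ row := (List.mem_filter.1 (List.mem_of_find?_eq_some hz)).1
      simp only [List.mem_cons, forall_eq_or_imp]
      refine ⟨fun x hx => ?_, ih z (hP.1 z hzr) hP.2⟩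
      obtain ⟨y, hy, rfl⟩ := List.mem_map.1 hx
      split_ifs
      exacts [ha, hP.1 y hy]

theorem placeLeft_mem {A : Type*} {p : A → Prop} {b : A} (hb : p b) :
    ∀ (Q : NotchedTableau A) (j : ℕ), (∀ r ∈ Q, ∀ x ∈ r, p x) →
      ∀ r ∈ placeLeft b j Q, ∀ x ∈ r, p x := by
  intro Q
  induction Q with
  | nil => intro j _; simpa [placeLeft] using hb
  | cons row Q ih =>
    intro j hQ
    simp only [List.mem_cons, forall_eq_or_imp] at hQ
    rcases j with _ | j
    · simp only [placeLeft, List.mem_cons, forall_eq_or_imp]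
      exact ⟨⟨hb, hQ.1⟩, hQ.2⟩
    · simp only [placeLeft, List.mem_cons, forall_eq_or_imp]
      exact ⟨hQ.1, ih j hQ.2⟩

theorem foldl_brskStep_mem {A : Type*} [LinearOrder A] {p q : A → Prop} :
    ∀ (l : List (A × A)) (B : NotchedTableau A × NotchedTableau A),
      (∀ u ∈ l, p u.1 ∧ q u.2) → (∀ r ∈ B.1, ∀ x ∈ r, p x) → (∀ r ∈ B.2, ∀ x ∈ r, q x) →
      (∀ r ∈ (l.foldl brskStep B).1, ∀ x ∈ r, p x) ∧
        (∀ r ∈ (l.foldl brskStep B).2, ∀ x ∈ r, q x) := by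
  intro l
  induction l with
  | nil => intro B _ h1 h2; exact ⟨h1, h2⟩
  | cons u l ih =>
    intro B hl h1 h2
    simp only [List.mem_cons, forall_eq_or_imp] at hl
    exact ih _ hl.2 (boundedInsert_mem _ _ _ hl.1.1 h1) (placeLeft_mem hl.1.2 _ _ h2)

theorem brskNegative_mem {A : Type*} [LinearOrder A] {p q : A → Prop} {U : Multiset (A × A)}
    (hU : ∀ u ∈ U, p u.1 ∧ q u.2) : (∀ r ∈ (brskNegative U).1, ∀ x ∈ r, p x) ∧
      (∀ r ∈ (brskNegative U).2, ∀ x ∈ r, q x) :=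
  foldl_brskStep_mem _ _ (fun u hu => hU u (by rw [← coe_insertionList U]; exact hu))
    (by simp) (by simp)

theorem boundedInsert_degree {A : Type*} [LinearOrder A] (b : A) :
    ∀ (P : NotchedTableau A) (a : A),
      ((boundedInsert b a P).1.map List.length).sum = (P.map List.length).sum + 1 := by
  intro P
  induction P with
  | nil => intro a; simp [boundedInsert]
  | cons row P ih =>
    intro a
    rw [boundedInsert]
    split
    · have h := List.length_eq_length_filter_add (l := row) (fun x => decide (x < b))
      have e : (fun x : A => decide (b ≤ x)) = fun x => !decide (x < b) := by
        funext x; rw [← decide_not, decide_eq_decide, not_lt]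
      simp only [List.map_cons, List.sum_cons, List.length_append, List.length_cons, e]
      omega
    · simp only [List.map_cons, List.sum_cons, List.length_map, ih]
      omega

theorem bitableauDegree_brskNegative {A : Type*} [LinearOrder A] (U : Multiset (A × A)) :
    bitableauDegree (brskNegative U) = Multiset.card U := by
  have key : ∀ (l : List (A × A)) (B : NotchedTableau A × NotchedTableau A),
      bitableauDegree (l.foldl brskStep B) = bitableauDegree B + l.length := by
    intro l
    induction l with
    | nil => intro B; rfl
    | cons u l ih =>
      intro B
      rw [List.foldl_cons, ih, List.length_cons]
      simp only [bitableauDegree, brskStep, boundedInsert_degree]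
      omega
  rw [brskNegative, key]
  conv_rhs => rw [← coe_insertionList U, Multiset.coe_card]
  simp [bitableauDegree]

/-! ### Chains -/

/-- The length of the longest chain in a rectangle is the first part of a partition of the growth
diagram. -/
theorem IsGrowth.card_chain_le {d : ℕ} {U : Multiset (Fin (2 * d) × Fin (2 * d))}
    {G C : ℕ → ℕ → ℕ → ℕ} (h : IsGrowth (2 * d) (cellMult U) G C) : ∀ k x y, x + y = k →
    x + y ≤ 2 * d → ∀ K : Finset (Fin (2 * d) × Fin (2 * d)), IsRootChain K →
    (∀ u ∈ K, u ∈ U ∧ u.1.val < x ∧ 2 * d ≤ u.2.val + y) → K.card ≤ G x y 0 := by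
  intro k
  induction k using Nat.strong_induction_on with
  | _ k ih =>
    intro x y hk hn K hK hKU
    rcases x with _ | x
    · rw [Finset.card_eq_zero.2]
      · omega
      · rw [Finset.eq_empty_iff_forall_notMem]
        intro u hu
        have := (hKU u hu).2.1
        omega
    rcases y with _ | y
    · rw [Finset.card_eq_zero.2]
      · omega
      · rw [Finset.eq_empty_iff_forall_notMem]
        intro u hu
        have := (hKU u hu).2.2
        have := u.2.isLt
        omega
    have r := h.rule x y 0 (by omega)
    rw [h.init x y (by omega)] at r
    -- The root of the cell `(x, y)`: the largest first and the smallest second coordinate in the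
    -- rectangle, hence the largest possible element of a chain there.
    let u₀ : Fin (2 * d) × Fin (2 * d) := (⟨x, by omega⟩, ⟨2 * d - 1 - y, by omega⟩)
    by_cases hu : u₀ ∈ K
    · have hm : cellMult U x y ≠ 0 := by
        rw [cellMult, Ne, ← Nat.le_zero, not_le, Multiset.countP_pos]
        exact ⟨u₀, (hKU _ hu).1, rfl, by simp only [u₀]; omega⟩
      have h1 := ih (x + y) (by omega) x y rfl (by omega) (K.erase u₀)
        (fun u hu v hv => hK u (Finset.mem_of_mem_erase hu) v (Finset.mem_of_mem_erase hv)) (by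
          intro v hv
          rw [Finset.mem_erase] at hv
          have h2 := hKU v hv.2
          have h3 := hK u₀ hu v hv.2 hv.1.symm
          simp only [Fin.lt_def, u₀] at h3
          refine ⟨h2.1, ?_, ?_⟩ <;> omega)
      rw [Finset.card_erase_of_mem hu] at h1
      rw [if_neg hm] at r
      omega
    · by_cases hx : ∀ v ∈ K, v.1.val < x
      · have := ih (x + (y + 1)) (by omega) x (y + 1) rfl (by omega) K hK
          fun v hv => ⟨(hKU v hv).1, hx v hv, (hKU v hv).2.2⟩
        omega
      · by_cases hy : ∀ v ∈ K, 2 * d ≤ v.2.val + y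
        · have := ih (x + 1 + y) (by omega) (x + 1) y rfl (by omega) K hK
            fun v hv => ⟨(hKU v hv).1, (hKU v hv).2.1, hy v hv⟩
          omega
        -- A chain without `u₀` cannot meet both the last column and the last row: distinct elements
        -- there would be incomparable, and a common one would be `u₀`.
        · exfalso
          push Not at hx hy
          obtain ⟨v, hv, hvx⟩ := hx
          obtain ⟨w, hw, hwy⟩ := hy
          have h1 := hKU v hv
          have h2 := hKU w hw
          by_cases hvw : v = w
          · subst hvw
            refine hu ?_
            have e : u₀ = v := by
              refine Prod.ext (Fin.ext ?_) (Fin.ext ?_) <;> simp only [u₀] <;> omega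
            rwa [e]
          · have h3 := hK v hv w hw hvw
            simp only [Fin.lt_def] at h3
            omega

/-- The rule in row 0 is the recursion for longest chains: the maximum is attained in one of the two
smaller rectangles, or by adding the root of the cell to a chain of the inner rectangle. -/
theorem IsGrowth.exists_chain {d : ℕ} {U : Multiset (Fin (2 * d) × Fin (2 * d))}
    {G C : ℕ → ℕ → ℕ → ℕ} (h : IsGrowth (2 * d) (cellMult U) G C) : ∀ k x y, x + y = k →
    x + y ≤ 2 * d → ∃ K : Finset (Fin (2 * d) × Fin (2 * d)), IsRootChain K ∧
    (∀ u ∈ K, u ∈ U ∧ u.1.val < x ∧ 2 * d ≤ u.2.val + y) ∧ K.card = G x y 0 := by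
  intro k
  induction k using Nat.strong_induction_on with
  | _ k ih =>
    intro x y hk hn
    rcases x with _ | x
    · exact ⟨∅, by simp [IsRootChain], by simp, by simp [h.left]⟩
    rcases y with _ | y
    · exact ⟨∅, by simp [IsRootChain], by simp, by simp [h.bot]⟩
    have r := h.rule x y 0 (by omega)
    rw [h.init x y (by omega)] at r
    have hcases : G (x + 1) (y + 1) 0 = G (x + 1) y 0 ∨ G (x + 1) (y + 1) 0 = G x (y + 1) 0 ∨
        (cellMult U x y ≠ 0 ∧ G (x + 1) (y + 1) 0 = G x y 0 + 1) := by
      have := h.strip_right (x := x) (y := y) (by omega) 0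
      split_ifs at r with h0
      · omega
      · by_cases e : G (x + 1) (y + 1) 0 = G x y 0 + 1
        · exact Or.inr (Or.inr ⟨h0, e⟩)
        · omega
    rcases hcases with e | e | ⟨h0, e⟩
    · obtain ⟨K, h1, h2, h3⟩ := ih (x + 1 + y) (by omega) (x + 1) y rfl (by omega)
      refine ⟨K, h1, fun u hu => ?_, by rw [h3, e]⟩
      have := h2 u hu
      exact ⟨this.1, this.2.1, by omega⟩
    · obtain ⟨K, h1, h2, h3⟩ := ih (x + (y + 1)) (by omega) x (y + 1) rfl (by omega)
      refine ⟨K, h1, fun u hu => ?_, by rw [h3, e]⟩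
      have := h2 u hu
      exact ⟨this.1, by omega, this.2.2⟩
    · obtain ⟨K, h1, h2, h3⟩ := ih (x + y) (by omega) x y rfl (by omega)
      rw [cellMult, Ne, ← Nat.le_zero, not_le, Multiset.countP_pos] at h0
      obtain ⟨u₀, hU, hx, hy⟩ := h0
      have hnot : u₀ ∉ K := fun hu => by
        have := (h2 _ hu).2.1
        omega
      have hlt : ∀ v ∈ K, v.1 < u₀.1 ∧ u₀.2 < v.2 := fun v hv => by
        have := (h2 v hv).2
        rw [Fin.lt_def, Fin.lt_def]
        omega
      refine ⟨insert u₀ K, ?_, ?_, by rw [Finset.card_insert_of_notMem hnot, h3, e]⟩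
      · intro u hu v hv huv
        rcases Finset.mem_insert.1 hu with hu' | hu'
        · rcases Finset.mem_insert.1 hv with hv' | hv'
          · exact absurd (hu'.trans hv'.symm) huv
          · exact Or.inl (hu' ▸ hlt v hv')
        · rcases Finset.mem_insert.1 hv with hv' | hv'
          · exact Or.inr (hv' ▸ hlt u hu')
          · exact h1 u hu' v hv' huv
      · intro u hu
        rcases Finset.mem_insert.1 hu with rfl | hu
        · exact ⟨hU, by omega, by omega⟩
        · have := h2 u hu
          exact ⟨this.1, by omega, by omega⟩

/-! ### The order on sets by counting -/

/-- Counting from above turns the entrywise order into inequalities that add up well; every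
comparison below goes through this form. -/
theorem forall₂_le_iff {n : ℕ} : ∀ {xs ys : List (Fin n)}, xs.Pairwise (· < ·) →
    ys.Pairwise (· < ·) → (List.Forall₂ (fun x y => x ≤ y) xs ys ↔
      xs.length = ys.length ∧ ∀ b, countFrom xs b ≤ countFrom ys b) := by
  intro xs
  induction xs with
  | nil =>
    intro ys _ _
    rcases ys with _ | ⟨y, ys⟩ <;> simp [countFrom]
  | cons x xs ih =>
    intro ys hx hy
    rcases ys with _ | ⟨y, ys⟩
    · simp
    rw [List.pairwise_cons] at hx hy
    rw [List.forall₂_cons, ih hx.2 hy.2]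
    have c : ∀ (z : Fin n) (zs : List (Fin n)) b,
        countFrom (z :: zs) b = countFrom zs b + if b ≤ z.val then 1 else 0 := by
      intro z zs b
      simp [countFrom, List.countP_cons]
    have full : ∀ (z : Fin n) (zs : List (Fin n)) b, (∀ a' ∈ zs, z < a') → b ≤ z.val →
        countFrom zs b = zs.length := by
      intro z zs b hz hb
      rw [countFrom, List.countP_eq_length]
      intro a ha
      have := hz a ha
      rw [Fin.lt_def] at this
      simp
      omega
    have le_length : ∀ (zs : List (Fin n)) b, countFrom zs b ≤ zs.length := fun zs b =>
      List.countP_le_length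
    constructor
    · rintro ⟨h1, h2, h3⟩
      refine ⟨by simpa using h2, fun b => ?_⟩
      rw [c, c]
      have := h3 b
      rw [Fin.le_def] at h1
      split_ifs <;> omega
    · rintro ⟨h2, h3⟩
      simp only [List.length_cons, add_left_inj] at h2
      -- Testing at `b = x` counts all of `x :: xs`, so all of `y :: ys` must be `≥ x`.
      have h1 : x ≤ y := by
        have := h3 x.val
        rw [c, c, full x xs _ hx.1 le_rfl, if_pos le_rfl] at this
        have := le_length ys x.val
        rw [Fin.le_def]
        split_ifs at * <;> omega
      refine ⟨h1, h2, fun b => ?_⟩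
      by_cases hb : b ≤ y.val
      · rw [full y ys b hy.1 hb, ← h2]
        exact le_length _ _
      · have := h3 b
        rw [Fin.le_def] at h1
        rw [c, c, if_neg hb, if_neg (by omega)] at this
        simpa using this

/-- The number of elements of `X` that are at least `b`. -/
def cardFrom {n : ℕ} (X : Finset (Fin n)) (b : ℕ) : ℕ :=
  (X.filter (fun x => b ≤ x.val)).card

theorem setLE_iff {n : ℕ} {X Y : Finset (Fin n)} :
    SetLE X Y ↔ X.card = Y.card ∧ ∀ b, cardFrom X b ≤ cardFrom Y b := by
  have e : ∀ (Z : Finset (Fin n)) b, countFrom (Z.sort (fun x y => x ≤ y)) b = cardFrom Z b := by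
    intro Z b
    rw [countFrom, ← Multiset.coe_countP, Finset.sort_eq, cardFrom, Finset.card_def,
      Finset.filter_val, Multiset.countP_eq_card_filter]
  rw [SetLE, forall₂_le_iff (Finset.sortedLT_sort X).pairwise (Finset.sortedLT_sort Y).pairwise]
  simp [e]

theorem SetLE.trans {n : ℕ} {X Y Z : Finset (Fin n)} (h : SetLE X Y) (h' : SetLE Y Z) :
    SetLE X Z := by
  rw [setLE_iff] at *
  exact ⟨h.1.trans h'.1, fun b => (h.2 b).trans (h'.2 b)⟩

theorem cardFrom_zero {n : ℕ} (X : Finset (Fin n)) : cardFrom X 0 = X.card := by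
  simp [cardFrom]

theorem cardFrom_toFinset {n : ℕ} {row : List (Fin n)} (h : row.Pairwise (· < ·)) (b : ℕ) :
    cardFrom row.toFinset b = countFrom row b := by
  have hn : row.Nodup := h.imp ne_of_lt
  rw [cardFrom, countFrom, List.countP_eq_length_filter, ← List.toFinset_card_of_nodup (hn.filter _),
    List.toFinset_filter]
  simp

/-- The counting function of `R - S` differs from that of `β` by the counts of `R` and `S` alone, so
comparing such sets amounts to comparing heights. -/
theorem cardFrom_diffSet {d : ℕ} {β R S : Finset (Fin (2 * d))} (hR : ∀ x ∈ R, x ∉ β)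
    (hS : S ⊆ β) (b : ℕ) : cardFrom (diffSet β R S) b + cardFrom S b =
      cardFrom β b + cardFrom R b := by
  have hd : Disjoint R (β \ S) := by
    rw [Finset.disjoint_left]
    exact fun x hx h => hR x hx (Finset.mem_sdiff.1 h).1
  have h1 : cardFrom (diffSet β R S) b = cardFrom R b + cardFrom (β \ S) b := by
    rw [cardFrom, diffSet, Finset.filter_union,
      Finset.card_union_of_disjoint (Finset.disjoint_filter_filter hd)]
    rfl
  have h2 : cardFrom (β \ S) b + cardFrom S b = cardFrom β b := by
    rw [cardFrom, cardFrom, cardFrom, ← Finset.card_union_of_disjoint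
      (Finset.disjoint_filter_filter Finset.sdiff_disjoint), ← Finset.filter_union,
      Finset.sdiff_union_of_subset hS]
  omega

/-! ### Rows and their heights -/

/-- The number of entries `≥ b` of the second component minus that of the first component. -/
def height {n : ℕ} (w : List (Fin n) × List (Fin n)) (b : ℕ) : ℤ :=
  countFrom w.2 b - countFrom w.1 b

/-- A pair of strictly increasing rows of equal length, the first with entries outside of `β` and
the second with entries in `β`. -/
structure IsRowPair {n : ℕ} (β : Finset (Fin n)) (w : List (Fin n) × List (Fin n)) : Prop where
  length_eq : w.1.length = w.2.length
  sortedP : w.1.Pairwise (· < ·)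
  sortedQ : w.2.Pairwise (· < ·)
  memP : ∀ x ∈ w.1, x ∉ β
  memQ : ∀ x ∈ w.2, x ∈ β

theorem isRowPair_nil {n : ℕ} (β : Finset (Fin n)) : IsRowPair β ([], []) := by
  constructor <;> simp

/-- Exchanging the components replaces `β` by its complement and negates the heights. This is how
all results on negative rows apply to positive ones. -/
theorem IsRowPair.swap {n : ℕ} {β : Finset (Fin n)} {w : List (Fin n) × List (Fin n)}
    (h : IsRowPair β w) : IsRowPair βᶜ w.swap where
  length_eq := h.length_eq.symm
  sortedP := h.sortedQ
  sortedQ := h.sortedP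
  memP x hx := by simpa using h.memQ x hx
  memQ x hx := by simpa using h.memP x hx

theorem height_swap {n : ℕ} (w : List (Fin n) × List (Fin n)) (b : ℕ) :
    height w.swap b = - height w b := by
  simp [height]

theorem countFrom_succ {n : ℕ} {row : List (Fin n)} (h : row.Pairwise (· < ·)) (x : Fin n) :
    countFrom row x.val = countFrom row (x.val + 1) + if x ∈ row then 1 else 0 := by
  have h1 := countBelow_succ h x
  have h2 := countBelow_add_countFrom row x.val
  have h3 := countBelow_add_countFrom row (x.val + 1)
  omega

theorem height_of_le {n : ℕ} (w : List (Fin n) × List (Fin n)) {b : ℕ} (hb : n ≤ b) :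
    height w b = 0 := by
  have e : ∀ l : List (Fin n), countFrom l b = 0 := fun l => by
    rw [countFrom, List.countP_eq_zero]
    intro x _
    have := x.isLt
    simp
    omega
  simp [height, e]

namespace IsRowPair

variable {n : ℕ} {β : Finset (Fin n)} {w w' : List (Fin n) × List (Fin n)}

theorem height_zero (h : IsRowPair β w) : height w 0 = 0 := by
  simp [height, countFrom, h.length_eq]

theorem height_sub (h : IsRowPair β w) (x : Fin n) : height w x.val - height w (x.val + 1) =
    (if x ∈ w.2 then 1 else 0) - (if x ∈ w.1 then 1 else 0) := by
  rw [height, height, countFrom_succ h.sortedP, countFrom_succ h.sortedQ]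
  push_cast
  ring

/-- Because `β` separates the entries of the two components, no cancellation occurs at `x` and the
step of the height reveals which component contains `x`. -/
theorem mem_fst_iff (h : IsRowPair β w) (x : Fin n) :
    x ∈ w.1 ↔ height w (x.val + 1) = height w x.val + 1 := by
  have h1 := h.height_sub x
  have h2 : x ∈ w.1 → x ∉ w.2 := fun h3 h4 => h.memP x h3 (h.memQ x h4)
  by_cases h3 : x ∈ w.1
  · rw [if_neg (h2 h3), if_pos h3] at h1
    exact iff_of_true h3 (by omega)
  · rw [if_neg h3] at h1
    refine iff_of_false h3 ?_
    split_ifs at h1 <;> omega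

theorem mem_snd_iff (h : IsRowPair β w) (x : Fin n) :
    x ∈ w.2 ↔ height w x.val = height w (x.val + 1) + 1 := by
  have := h.swap.mem_fst_iff x
  rw [height_swap, height_swap] at this
  simp only [Prod.fst_swap] at this
  rw [this]
  constructor <;> intro <;> omega

/-- A row is determined by its heights. -/
theorem ext_height (h : IsRowPair β w) (h' : IsRowPair β w')
    (e : ∀ b, b ≤ n → height w b = height w' b) : w = w' := by
  refine Prod.ext ?_ ?_
  · refine List.Pairwise.eq_of_mem_iff h.sortedP h'.sortedP fun x => ?_
    rw [h.mem_fst_iff, h'.mem_fst_iff, e _ (by omega), e _ (by omega)]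
  · refine List.Pairwise.eq_of_mem_iff h.sortedQ h'.sortedQ fun x => ?_
    rw [h.mem_snd_iff, h'.mem_snd_iff, e _ (by omega), e _ (by omega)]

/-- Reversal exchanges entries `≥ b` and entries `< n - b`. In the other direction, an up-step of a
symmetric height at `x` matches a down-step at `x*`. -/
theorem selfDual_iff (h : IsRowPair β w) : w.1.toFinset = w.2.toFinset.image Fin.rev ↔
    ∀ b, b ≤ n → height w b = height w (n - b) := by
  constructor
  · intro e b hb
    have key : ∀ b, b ≤ n → (countFrom w.1 b : ℤ) = w.2.length - countFrom w.2 (n - b) := by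
      intro b hb
      have h1 := countBelow_add_countFrom w.2 (n - b)
      have h2 : countFrom w.1 b = countBelow w.2 (n - b) := by
        rw [← cardFrom_toFinset h.sortedP, e, cardFrom, Finset.filter_image,
          Finset.card_image_of_injective _ Fin.rev_injective, countBelow,
          List.countP_eq_length_filter, ← List.toFinset_card_of_nodup
            ((h.sortedQ.imp ne_of_lt : w.2.Nodup).filter _), List.toFinset_filter]
        congr 1
        refine Finset.filter_congr fun x _ => ?_
        rw [Fin.val_rev]
        simp
        omega
      omega
    have h1 := key b hb
    have h2 := key (n - b) (by omega)
    rw [show n - (n - b) = b by omega] at h2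
    rw [height, height]
    omega
  · intro e
    ext x
    simp only [List.mem_toFinset, Finset.mem_image]
    have hr : ∀ x : Fin n, x ∈ w.1 ↔ x.rev ∈ w.2 := by
      intro x
      have := x.isLt
      rw [h.mem_fst_iff, h.mem_snd_iff, e _ (by omega), e x.val (by omega), Fin.val_rev,
        show n - (x.val + 1) + 1 = n - x.val by omega]
    rw [hr]
    exact ⟨fun hx => ⟨_, hx, Fin.rev_rev x⟩, by rintro ⟨y, hy, rfl⟩; rwa [Fin.rev_rev]⟩

end IsRowPair

/-- A list of rows is determined by the heights of its rows. -/
theorem rows_ext {n : ℕ} {β : Finset (Fin n)} {R R' : List (List (Fin n) × List (Fin n))}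
    (h : ∀ w ∈ R, IsRowPair β w ∧ w.1 ≠ []) (h' : ∀ w ∈ R', IsRowPair β w ∧ w.1 ≠ [])
    (e : ∀ i b, b ≤ n → height (R.getD i ([], [])) b = height (R'.getD i ([], [])) b) :
    R = R' := by
  have hp : ∀ {S : List (List (Fin n) × List (Fin n))}, (∀ w ∈ S, IsRowPair β w ∧ w.1 ≠ []) →
      ∀ i, IsRowPair β (S.getD i ([], [])) := by
    intro S hS i
    rcases lt_or_ge i S.length with hi | hi
    · rw [List.getD_eq_getElem _ _ hi]
      exact (hS _ (List.getElem_mem hi)).1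
    · rw [List.getD_eq_default _ _ hi]
      exact isRowPair_nil β
  have he : ∀ i, R.getD i ([], []) = R'.getD i ([], []) := fun i =>
    (hp h i).ext_height (hp h' i) (e i)
  have hl : ∀ {S S' : List (List (Fin n) × List (Fin n))}, (∀ w ∈ S, IsRowPair β w ∧ w.1 ≠ []) →
      (∀ i, S.getD i ([], []) = S'.getD i ([], [])) → S.length ≤ S'.length := by
    intro S S' hS hSS
    by_contra hlt
    push Not at hlt
    have h1 := hSS S'.length
    rw [List.getD_eq_getElem _ _ hlt, List.getD_eq_default _ _ le_rfl] at h1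
    exact (hS _ (List.getElem_mem hlt)).2 (by rw [h1])
  refine List.ext_getElem (le_antisymm (hl h he) (hl h' fun i => (he i).symm)) fun i h1 h2 => ?_
  have := he i
  rwa [List.getD_eq_getElem _ _ h1, List.getD_eq_getElem _ _ h2] at this

/-! ### The correspondence on negative multisets -/

/-- All elements of `U` are roots `(r, c)` of `β` with `r < c`. -/
def IsNegativeMultiset {n : ℕ} (β : Finset (Fin n)) (U : Multiset (Fin n × Fin n)) : Prop :=
  ∀ u ∈ U, u.1 ∉ β ∧ u.2 ∈ β ∧ u.1 < u.2

/-- The rows of a nonvanishing semistandard notched bitableau all rows of which are negative. -/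
structure IsNegativeRows {n : ℕ} (β : Finset (Fin n)) (R : List (List (Fin n) × List (Fin n))) :
    Prop where
  rows : ∀ w ∈ R, IsRowPair β w ∧ w.1 ≠ []
  nonneg : ∀ w ∈ R, ∀ b, 0 ≤ height w b
  chain : R.Pairwise (fun w w' => ∀ b, height w' b ≤ height w b)

/-- The rows of the bitableau of a negative multiset. -/
def negativeRows {n : ℕ} (U : Multiset (Fin n × Fin n)) : List (List (Fin n) × List (Fin n)) :=
  bitableauRows (brskNegative U)

theorem getD_zip {α γ : Type*} {P : List α} {Q : List γ} (h : P.length = Q.length) (a : α) (c : γ)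
    (i : ℕ) : (P.zip Q).getD i (a, c) = (P.getD i a, Q.getD i c) := by
  rcases lt_or_ge i P.length with hi | hi
  · rw [List.getD_eq_getElem _ _ (by simp; omega), List.getD_eq_getElem _ _ hi,
      List.getD_eq_getElem _ _ (by omega), List.getElem_zip]
  · rw [List.getD_eq_default _ _ (by simp; omega), List.getD_eq_default _ _ hi,
      List.getD_eq_default _ _ (by omega)]

theorem IsNegativeRows.isRowPair_getD {n : ℕ} {β : Finset (Fin n)}
    {R : List (List (Fin n) × List (Fin n))} (h : IsNegativeRows β R) (i : ℕ) :
    IsRowPair β (R.getD i ([], [])) := by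
  rcases lt_or_ge i R.length with hi | hi
  · rw [List.getD_eq_getElem _ _ hi]
    exact (h.rows _ (List.getElem_mem hi)).1
  · rw [List.getD_eq_default _ _ hi]
    exact isRowPair_nil β

theorem IsNegativeRows.nonneg_getD {n : ℕ} {β : Finset (Fin n)}
    {R : List (List (Fin n) × List (Fin n))} (h : IsNegativeRows β R) (i b : ℕ) :
    0 ≤ height (R.getD i ([], [])) b := by
  rcases lt_or_ge i R.length with hi | hi
  · rw [List.getD_eq_getElem _ _ hi]
    exact h.nonneg _ (List.getElem_mem hi) b
  · rw [List.getD_eq_default _ _ hi]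
    simp [height, countFrom]

theorem IsNegativeRows.antitone_getD {n : ℕ} {β : Finset (Fin n)}
    {R : List (List (Fin n) × List (Fin n))} (h : IsNegativeRows β R) (i b : ℕ) :
    height (R.getD (i + 1) ([], [])) b ≤ height (R.getD i ([], [])) b := by
  rcases lt_or_ge (i + 1) R.length with hi | hi
  · rw [List.getD_eq_getElem _ _ hi, List.getD_eq_getElem _ _ (by omega)]
    exact List.pairwise_iff_getElem.1 h.chain i (i + 1) (by omega) hi (by omega) b
  · rw [List.getD_eq_default _ _ hi]
    have := h.nonneg_getD i b
    simpa [height, countFrom] using this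

theorem cellMult_eq_count {n : ℕ} (U : Multiset (Fin n × Fin n)) (u : Fin n × Fin n) :
    cellMult U u.1.val (n - 1 - u.2.val) = U.count u := by
  rw [cellMult, Multiset.count]
  refine Multiset.countP_congr rfl fun v _ => ?_
  have := u.2.isLt
  have := v.2.isLt
  rw [eq_iff_iff]
  constructor
  · intro h
    exact Prod.ext (Fin.ext (by omega)) (Fin.ext (by omega))
  · rintro rfl
    constructor <;> omega

theorem ext_cellMult {n : ℕ} {U V : Multiset (Fin n × Fin n)}
    (h : ∀ x y, cellMult U x y = cellMult V x y) : U = V := by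
  ext u
  rw [← cellMult_eq_count, ← cellMult_eq_count, h]

section Negative

variable {n : ℕ} {β : Finset (Fin n)} {U V : Multiset (Fin n × Fin n)}

/-- Supplies the hypotheses on empty columns and rows needed to reconstruct a diagram from its
boundary, with membership in `β` as the predicate. -/
theorem IsNegativeMultiset.cellMult_ne_zero (hU : IsNegativeMultiset β U) {x y : ℕ}
    (h : cellMult U x y ≠ 0) : x + y + 1 < n ∧ ¬ (∃ hx : x < n, ⟨x, hx⟩ ∈ β) ∧
      ∃ hy : n - 1 - y < n, ⟨n - 1 - y, hy⟩ ∈ β := by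
  rw [cellMult, Ne, ← Nat.le_zero, not_le, Multiset.countP_pos] at h
  obtain ⟨u, hu, rfl, hy⟩ := h
  obtain ⟨h1, h2, h3⟩ := hU u hu
  rw [Fin.lt_def] at h3
  have e : (⟨n - 1 - y, by omega⟩ : Fin n) = u.2 := Fin.ext (by simp only []; omega)
  exact ⟨by omega, fun ⟨_, hx⟩ => h1 hx, by omega, e ▸ h2⟩

theorem IsNegativeMultiset.exists_isGrowth (hU : IsNegativeMultiset β U) :
    ∃ G C, IsGrowth n (cellMult U) G C ∧ ∀ b y i, b + y = n →
      (G b y i : ℤ) = height ((negativeRows U).getD i ([], [])) b := by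
  obtain ⟨G, C, h, hb⟩ := exists_isGrowth_brskNegative fun u hu => (hU u hu).2.2
  refine ⟨G, C, h, fun b y i hby => ?_⟩
  have hs := stageInvariant_brskNegative fun u hu => (hU u hu).2.2
  rw [negativeRows, bitableauRows, getD_zip hs.length_eq, height]
  have := hb b y i hby
  simp only []
  omega

theorem IsNegativeMultiset.isNegativeRows (hU : IsNegativeMultiset β U) :
    IsNegativeRows β (negativeRows U) := by
  obtain ⟨G, C, h, hb⟩ := hU.exists_isGrowth
  have hs := stageInvariant_brskNegative fun u hu => (hU u hu).2.2
  have hm := brskNegative_mem (p := fun x => x ∉ β) (q := fun x => x ∈ β)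
    fun u hu => ⟨(hU u hu).1, (hU u hu).2.1⟩
  have hrow : ∀ w ∈ negativeRows U, ∃ i, i < (negativeRows U).length ∧
      (negativeRows U).getD i ([], []) = w := by
    intro w hw
    obtain ⟨i, hi, rfl⟩ := List.getElem_of_mem hw
    exact ⟨i, hi, List.getD_eq_getElem _ _ hi⟩
  refine ⟨?_, ?_, ?_⟩
  · intro w hw
    have h1 := (List.of_mem_zip hw).1
    have h2 := (List.of_mem_zip hw).2
    obtain ⟨i, hi, hw'⟩ := hrow w hw
    rw [negativeRows, bitableauRows, getD_zip hs.length_eq] at hw'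
    subst hw'
    exact ⟨⟨hs.row_length i, hs.sortedP _ h1, hs.sortedQ i, hm.1 _ h1, hm.2 _ h2⟩,
      hs.nonempty _ h1⟩
  · intro w hw b
    obtain ⟨i, hi, rfl⟩ := hrow w hw
    rcases le_or_gt b n with hbn | hbn
    · rw [← hb b (n - b) i (by omega)]
      positivity
    · rw [height_of_le _ hbn.le]
  · rw [List.pairwise_iff_getElem]
    intro i j hi hj hij b
    rcases le_or_gt b n with hbn | hbn
    · have h1 := hb b (n - b) i (by omega)
      have h2 := hb b (n - b) j (by omega)
      rw [List.getD_eq_getElem _ _ hi] at h1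
      rw [List.getD_eq_getElem _ _ hj] at h2
      rw [← h1, ← h2]
      have hanti : Antitone (G b (n - b)) :=
        antitone_nat_of_succ_le fun i => h.row_succ_le (by omega) i
      exact_mod_cast hanti hij.le
    · rw [height_of_le _ hbn.le, height_of_le _ hbn.le]

theorem brskNegative_eq_map (hU : IsNegativeMultiset β U) :
    brskNegative U = ((negativeRows U).map Prod.fst, (negativeRows U).map Prod.snd) := by
  have hs := stageInvariant_brskNegative fun u hu => (hU u hu).2.2
  rw [negativeRows, bitableauRows, List.map_fst_zip hs.length_eq.le,
    List.map_snd_zip hs.length_eq.ge]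

theorem negativeRows_injOn (hU : IsNegativeMultiset β U) (hV : IsNegativeMultiset β V)
    (e : negativeRows U = negativeRows V) : U = V := by
  obtain ⟨G, C, h, hb⟩ := hU.exists_isGrowth
  obtain ⟨G', C', h', hb'⟩ := hV.exists_isGrowth
  refine ext_cellMult fun x y => ?_
  by_cases hxy : x + y + 1 < n
  · refine h.multiplicity_unique h' (fun x => ∃ hx : x < n, ⟨x, hx⟩ ∈ β)
      (fun x y _ h0 => (hU.cellMult_ne_zero h0).2) (fun x y _ h0 => (hV.cellMult_ne_zero h0).2)
      (fun x y hxy i => ?_) hxy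
    have h1 := hb x y i hxy
    have h2 := hb' x y i hxy
    rw [e, ← h2] at h1
    exact_mod_cast h1
  · rw [not_not.1 fun h0 => hxy (hU.cellMult_ne_zero h0).1,
      not_not.1 fun h0 => hxy (hV.cellMult_ne_zero h0).1]

/-- The height can only drop when passing an element of `β` and only rise otherwise. `toNat` loses
nothing, as heights of negative rows are nonnegative. -/
theorem IsNegativeRows.isBoundary {R : List (List (Fin n) × List (Fin n))}
    (hR : IsNegativeRows β R) : IsBoundary n (fun x => ∃ hx : x < n, ⟨x, hx⟩ ∈ β)
      (fun b i => (height (R.getD i ([], [])) b).toNat) where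
  first i := by rw [(hR.isRowPair_getD i).height_zero]; rfl
  last i := by rw [height_of_le _ le_rfl]; rfl
  antitone b i := by
    have := hR.antitone_getD i b
    omega
  eventually_zero := by
    refine ⟨R.length, fun b i hi => ?_⟩
    rw [List.getD_eq_default _ _ hi]
    simp [height, countFrom]
  down b i hb := by
    rintro ⟨hx, hmem⟩
    have h1 := (hR.isRowPair_getD i).height_sub ⟨b, hx⟩
    have h2 := hR.nonneg_getD i b
    have h3 := hR.nonneg_getD i (b + 1)
    rw [if_neg fun h0 => (hR.isRowPair_getD i).memP _ h0 hmem] at h1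
    simp only [] at h1 ⊢
    split_ifs at h1 <;> omega
  up b i hb hB := by
    have h1 := (hR.isRowPair_getD i).height_sub ⟨b, hb⟩
    have h2 := hR.nonneg_getD i b
    have h3 := hR.nonneg_getD i (b + 1)
    rw [if_neg fun h0 => hB ⟨hb, (hR.isRowPair_getD i).memQ _ h0⟩] at h1
    simp only [] at h1 ⊢
    split_ifs at h1 <;> omega

/-- The multiset of negative pairs with given multiplicities. -/
def multisetOfCells (n : ℕ) (m : ℕ → ℕ → ℕ) : Multiset (Fin n × Fin n) :=
  ∑ u ∈ Finset.univ.filter (fun u : Fin n × Fin n => u.1 < u.2),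
    m u.1.val (n - 1 - u.2.val) • {u}

theorem count_multisetOfCells (m : ℕ → ℕ → ℕ) (u : Fin n × Fin n) :
    (multisetOfCells n m).count u = if u.1 < u.2 then m u.1.val (n - 1 - u.2.val) else 0 := by
  rw [multisetOfCells, Multiset.count_sum']
  simp only [Multiset.count_nsmul, Multiset.count_singleton, mul_ite, mul_one, mul_zero]
  rw [Finset.sum_ite_eq]
  simp

/-- The backward diagram of the heights yields multiplicities, hence a multiset. Its insertion
diagram has the same multiplicities, so it is the same diagram and has the same boundary. -/
theorem exists_negativeRows_eq {R : List (List (Fin n) × List (Fin n))}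
    (hR : IsNegativeRows β R) : ∃ U, IsNegativeMultiset β U ∧ negativeRows U = R := by
  obtain ⟨m, G, C, h, hm, hG⟩ := hR.isBoundary.exists_isGrowth
  have hU : IsNegativeMultiset β (multisetOfCells n m) := by
    intro u hu
    have hlt := u.1.isLt
    have hlt' := u.2.isLt
    rw [← Multiset.count_ne_zero, count_multisetOfCells] at hu
    split_ifs at hu with h1
    · have h2 := h1
      rw [Fin.lt_def] at h2
      obtain ⟨h3, _, h4⟩ := hm _ _ (by omega) hu
      have e : (⟨n - 1 - (n - 1 - u.2.val), by omega⟩ : Fin n) = u.2 :=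
        Fin.ext (by simp only []; omega)
      exact ⟨fun h5 => h3 ⟨hlt, h5⟩, e ▸ h4, h1⟩
    · exact absurd rfl hu
  have hcell : ∀ x y, x + y + 1 < n → cellMult (multisetOfCells n m) x y = m x y := by
    intro x y hxy
    have := cellMult_eq_count (multisetOfCells n m) (⟨x, by omega⟩, ⟨n - 1 - y, by omega⟩)
    rw [count_multisetOfCells] at this
    simp only [Fin.mk_lt_mk] at this
    rwa [if_pos (by omega), show n - 1 - (n - 1 - y) = y by omega] at this
  refine ⟨_, hU, rows_ext hU.isNegativeRows.rows hR.rows fun i b hb => ?_⟩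
  obtain ⟨G', C', h', hb'⟩ := hU.exists_isGrowth
  -- The two multiplicity functions agree only inside the staircase, which is all that `init` uses.
  have h'' : IsGrowth n m G' C' :=
    { h' with init := fun x y hxy => by rw [h'.init x y hxy, hcell x y hxy] }
  rw [← hb' b (n - b) i (by omega), ← h.unique h'' _ b (n - b) rfl (by omega) i,
    hG b (n - b) (by omega)]
  exact Int.toNat_of_nonneg (hR.nonneg_getD i b)

end Negative

/-! ### Symmetry, parity and chains -/

section Symmetric

variable {d : ℕ} {β : Finset (Fin (2 * d))} {U : Multiset (Fin (2 * d) × Fin (2 * d))}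

theorem cellMult_sharp (U : Multiset (Fin (2 * d) × Fin (2 * d))) (x y : ℕ) :
    cellMult (U.map sharp) x y = cellMult U y x := by
  rw [cellMult, Multiset.countP_map, ← Multiset.countP_eq_card_filter, cellMult]
  refine Multiset.countP_congr rfl fun u _ => ?_
  have := u.1.isLt
  have := u.2.isLt
  rw [eq_iff_iff]
  simp only [sharp, Fin.val_rev]
  omega

theorem map_sharp_eq_iff : U.map sharp = U ↔ ∀ x y, cellMult U x y = cellMult U y x := by
  constructor
  · intro h x y
    conv_lhs => rw [← h, cellMult_sharp]
  · intro h
    exact ext_cellMult fun x y => by rw [cellMult_sharp, h]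

/-- Both sides say that the diagram is symmetric: `sharp` transposes the multiplicities, and
self-dual rows have symmetric boundary values. -/
theorem map_sharp_iff_selfDual (hβ : ∀ j, j ∈ β ↔ Fin.rev j ∉ β) (hU : IsNegativeMultiset β U) :
    U.map sharp = U ↔ ∀ w ∈ negativeRows U, w.1.toFinset = w.2.toFinset.image Fin.rev := by
  obtain ⟨G, C, h, hb⟩ := hU.exists_isGrowth
  have hR := hU.isNegativeRows
  have h1 : (∀ w ∈ negativeRows U, w.1.toFinset = w.2.toFinset.image Fin.rev) ↔
      ∀ x y, x + y = 2 * d → ∀ i, G x y i = G y x i := by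
    constructor
    · intro hw x y hxy i
      have h2 := hb x y i hxy
      have h3 := hb y x i (by omega)
      have h4 : height ((negativeRows U).getD i ([], [])) x =
          height ((negativeRows U).getD i ([], [])) y := by
        rcases lt_or_ge i (negativeRows U).length with hi | hi
        · rw [List.getD_eq_getElem _ _ hi]
          have hm := List.getElem_mem hi
          rw [((hR.rows _ hm).1.selfDual_iff).1 (hw _ hm) x (by omega)]
          congr 1
          omega
        · rw [List.getD_eq_default _ _ hi]
          rfl
      rw [h4, ← h3] at h2
      exact_mod_cast h2
    · intro hG w hw
      obtain ⟨i, hi, rfl⟩ := List.getElem_of_mem hw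
      rw [(hR.rows _ hw).1.selfDual_iff]
      intro b hbn
      have h2 := hb b (2 * d - b) i (by omega)
      have h3 := hb (2 * d - b) b i (by omega)
      rw [List.getD_eq_getElem _ _ hi] at h2 h3
      rw [← h2, ← h3, hG b (2 * d - b) (by omega)]
  rw [h1, map_sharp_eq_iff]
  constructor
  · intro hs x y hxy
    have ht := h.transpose
    rw [show (fun x y => cellMult U y x) = cellMult U from by ext x y; exact hs y x] at ht
    exact h.unique ht _ x y rfl hxy.le
  · intro hG x y
    by_cases hxy : x + y + 1 < 2 * d
    -- The transposed multiplicities have the same empty columns and rows because `β` contains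
    -- exactly one of `j` and `j*`.
    · refine h.multiplicity_unique h.transpose (fun x => ∃ hx : x < 2 * d, ⟨x, hx⟩ ∈ β)
        (fun x y _ h0 => (hU.cellMult_ne_zero h0).2) (fun x y hxy h0 => ?_) hG hxy
      obtain ⟨-, h2, h3, h4⟩ := hU.cellMult_ne_zero h0
      constructor
      · rintro ⟨hx, hxβ⟩
        refine (hβ _).1 hxβ ?_
        convert h4
        rw [Fin.val_rev]
        simp only []
        omega
      · refine ⟨by omega, ?_⟩
        rw [hβ]
        intro h5
        refine h2 ⟨by omega, ?_⟩
        convert h5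
        rw [Fin.val_rev]
        simp only []
        omega
    · rw [not_not.1 fun h0 => hxy (hU.cellMult_ne_zero (x := x) (y := y) h0).1,
        not_not.1 fun h0 : cellMult U y x ≠ 0 => hxy (by
          have := (hU.cellMult_ne_zero h0).1
          omega)]

/-- The diagonal of the diagram ends at the boundary point `(d, d)`, where the partition consists of
the heights at `d`. -/
theorem diagonal_even_iff_paired (hU : IsNegativeMultiset β U) (hs : U.map sharp = U) :
    (∀ u, u.1 = Fin.rev u.2 → Even (U.count u)) ↔ ∀ j,
      height ((negativeRows U).getD (2 * j) ([], [])) d =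
        height ((negativeRows U).getD (2 * j + 1) ([], [])) d := by
  obtain ⟨G, C, h, hb⟩ := hU.exists_isGrowth
  have h1 := h.diagonal_even_iff (map_sharp_eq_iff.1 hs) (e := d) (by omega)
  have h2 : ∀ i, height ((negativeRows U).getD i ([], [])) d = G d d i := fun i =>
    (hb d d i (by omega)).symm
  simp only [h2, Nat.cast_inj]
  rw [← h1]
  constructor
  · intro he k hk
    have := he (⟨k, by omega⟩, ⟨2 * d - 1 - k, by omega⟩) (by
      rw [Fin.ext_iff, Fin.val_rev]
      simp only []
      omega)
    rw [← cellMult_eq_count] at this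
    simp only [] at this
    rwa [show 2 * d - 1 - (2 * d - 1 - k) = k by omega] at this
  · intro he u hu
    rw [← cellMult_eq_count]
    rw [Fin.ext_iff, Fin.val_rev] at hu
    have := u.2.isLt
    rw [show 2 * d - 1 - u.2.val = u.1.val by omega]
    by_cases hk : u.1.val < d
    · exact he _ hk
    · have e : cellMult U u.1.val u.1.val = 0 := by
        by_contra h0
        have := (hU.cellMult_ne_zero h0).1
        omega
      rw [e]
      exact Even.zero

/-- For a negative chain the difference of the two counts is the number of elements with `r < b ≤
c`. These form a chain in a rectangle whose upper corner lies on the boundary, where the longest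
length is the height of the first row. -/
theorem chain_bound_iff (hU : IsNegativeMultiset β U) (f : ℕ → ℤ) :
    (∀ K : Finset (Fin (2 * d) × Fin (2 * d)), (∀ u ∈ K, u ∈ U) → IsRootChain K → ∀ b : ℕ,
      ((K.filter (fun u => b ≤ u.2.val)).card : ℤ) ≤
        f b + (K.filter (fun u => b ≤ u.1.val)).card) ↔
    ∀ b, height ((negativeRows U).getD 0 ([], [])) b ≤ f b := by
  obtain ⟨G, C, h, hb⟩ := hU.exists_isGrowth
  have hcount : ∀ K : Finset (Fin (2 * d) × Fin (2 * d)), (∀ u ∈ K, u ∈ U) → ∀ b : ℕ,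
      (K.filter (fun u => b ≤ u.2.val)).card = (K.filter (fun u => b ≤ u.1.val)).card +
        (K.filter (fun u => u.1.val < b ∧ b ≤ u.2.val)).card := by
    intro K hK b
    rw [← Finset.card_union_of_disjoint]
    · congr 1
      ext u
      simp only [Finset.mem_filter, Finset.mem_union]
      have : u ∈ K → u.1.val < u.2.val := fun hu => (hU u (hK u hu)).2.2
      constructor
      · intro hu
        have := this hu.1
        by_cases h0 : b ≤ u.1.val
        · exact Or.inl ⟨hu.1, h0⟩
        · exact Or.inr ⟨hu.1, by omega, hu.2⟩
      · rintro (hu | hu)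
        · have := this hu.1
          exact ⟨hu.1, by omega⟩
        · exact ⟨hu.1, hu.2.2⟩
    · rw [Finset.disjoint_filter]
      intro u _ h1 h2
      omega
  constructor
  · intro hK b
    rcases le_or_gt b (2 * d) with hbn | hbn
    · rw [← hb b (2 * d - b) 0 (by omega)]
      obtain ⟨K, h1, h2, h3⟩ := h.exists_chain _ b (2 * d - b) rfl (by omega)
      have h4 := hK K (fun u hu => (h2 u hu).1) h1 b
      rw [hcount K (fun u hu => (h2 u hu).1) b] at h4
      rw [Finset.filter_true_of_mem (p := fun u : Fin (2 * d) × Fin (2 * d) => u.1.val < b ∧ b ≤ u.2.val)] at h4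
      · rw [← h3]
        push_cast at h4
        omega
      · intro u hu
        have := h2 u hu
        omega
    · rw [height_of_le _ hbn.le]
      simpa using hK ∅ (by simp) (by simp [IsRootChain]) b
  · intro hf K hKU hK b
    rw [hcount K hKU b]
    have h1 := hf b
    rcases le_or_gt b (2 * d) with hbn | hbn
    · rw [← hb b (2 * d - b) 0 (by omega)] at h1
      have h2 := h.card_chain_le _ b (2 * d - b) rfl (by omega)
        (K.filter (fun u => u.1.val < b ∧ b ≤ u.2.val))
        (fun u hu v hv => hK u (Finset.mem_filter.1 hu).1 v (Finset.mem_filter.1 hv).1)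
        (fun u hu => by
          rw [Finset.mem_filter] at hu
          exact ⟨hKU u hu.1, hu.2.1, by omega⟩)
      push_cast
      omega
    · rw [height_of_le _ hbn.le] at h1
      rw [Finset.filter_false_of_mem (p := fun u : Fin (2 * d) × Fin (2 * d) => u.1.val < b ∧ b ≤ u.2.val)]
      · simp
        omega
      · intro u _
        have := u.2.isLt
        omega

end Symmetric

/-! ### Lists with equal consecutive pairs -/

/-- The first two members of the list are equal, and so are the next two, and so on. -/
def PairedList {α : Type*} : List α → Prop
  | x :: y :: t => x = y ∧ PairedList t
  | _ => True

theorem pairedList_iff {α : Type*} : ∀ l : List α, PairedList l ↔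
    ∀ k x y, l[2 * k]? = some x → l[2 * k + 1]? = some y → x = y
  | [] => by simp [PairedList]
  | [x] => by
    refine iff_of_true trivial fun k x y _ h => ?_
    simp at h
  | x :: y :: t => by
    rw [PairedList, pairedList_iff t]
    constructor
    · rintro ⟨rfl, h⟩ k a b ha hb
      rcases k with _ | k
      · simp only [mul_zero, List.getElem?_cons_zero, zero_add, List.getElem?_cons_succ,
          Option.some.injEq] at ha hb
        rw [← ha, ← hb]
      · exact h k a b (by simpa [Nat.mul_add] using ha) (by simpa [Nat.mul_add] using hb)
    · intro h
      refine ⟨h 0 x y (by simp) (by simp), fun k a b ha hb => h (k + 1) a b ?_ ?_⟩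
      · simpa [Nat.mul_add] using ha
      · simpa [Nat.mul_add] using hb

theorem pairedList_map {α γ : Type*} {f : α → γ} (hf : Function.Injective f) :
    ∀ l : List α, PairedList (l.map f) ↔ PairedList l
  | [] => Iff.rfl
  | [_] => Iff.rfl
  | x :: y :: t => by
    simp only [List.map_cons, PairedList, pairedList_map hf t, hf.eq_iff]

theorem pairedList_append {α : Type*} (l' : List α) : ∀ l : List α, Even l.length →
    (PairedList (l ++ l') ↔ PairedList l ∧ PairedList l')
  | [], _ => by simp [PairedList]
  | [x], h => by simp at h
  | x :: y :: t, h => by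
    simp only [List.cons_append, PairedList]
    rw [pairedList_append l' t (by simpa [Nat.even_add_one] using h), and_assoc]

theorem pairedList_reverse {α : Type*} : ∀ l : List α, Even l.length →
    (PairedList l.reverse ↔ PairedList l)
  | [], _ => Iff.rfl
  | [x], h => by simp at h
  | x :: y :: t, h => by
    have ht : Even t.length := by simpa [Nat.even_add_one] using h
    rw [List.reverse_cons, List.reverse_cons, List.append_assoc,
      pairedList_append _ _ (by simpa using ht), pairedList_reverse t ht]
    simp only [List.cons_append, List.nil_append, PairedList, and_true]
    rw [and_comm, eq_comm]

/-- The list, prolonged by zeros, has equal consecutive pairs. -/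
def PaddedPaired (a : List ℤ) : Prop :=
  ∀ j, a.getD (2 * j) 0 = a.getD (2 * j + 1) 0

theorem paddedPaired_cons_cons (x y : ℤ) (t : List ℤ) :
    PaddedPaired (x :: y :: t) ↔ x = y ∧ PaddedPaired t := by
  constructor
  · intro h
    refine ⟨by simpa using h 0, fun j => ?_⟩
    simpa [Nat.mul_add] using h (j + 1)
  · rintro ⟨rfl, h⟩ j
    rcases j with _ | j
    · simp
    · simpa [Nat.mul_add] using h j

theorem pairedList_iff_padded : ∀ a : List ℤ,
    (Even a.length → (PairedList a ↔ PaddedPaired a)) ∧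
      (¬ Even a.length → (PairedList (a ++ [0]) ↔ PaddedPaired a))
  | [] => by simp [PairedList, PaddedPaired]
  | [x] => by
    refine ⟨fun h => by simp at h, fun _ => ?_⟩
    simp only [List.cons_append, List.nil_append, PairedList, and_true]
    constructor
    · rintro rfl j
      rcases j with _ | j <;> simp
    · intro h
      simpa using h 0
  | x :: y :: t => by
    have ih := pairedList_iff_padded t
    simp only [List.length_cons, Nat.even_add_one, not_not, List.cons_append, PairedList,
      paddedPaired_cons_cons]
    exact ⟨fun h => and_congr_right' (ih.1 h), fun h => and_congr_right' (ih.2 h)⟩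

/-- If both lengths are odd, the middle pair is formed by the last terms of the two lists, with
opposite signs. Equality of a nonnegative and a nonpositive number forces both to be 0, just as
padding by zeros does. -/
theorem pairedList_even {a c : List ℤ} (ha : ∀ x ∈ a, 0 ≤ x) (hc : ∀ x ∈ c, 0 ≤ x)
    (h : Even (a.length + c.length)) :
    PairedList (a ++ (c.map (fun x => -x)).reverse) ↔ PaddedPaired a ∧ PaddedPaired c := by
  have hneg : Function.Injective (fun x : ℤ => -x) := neg_injective
  by_cases hea : Even a.length
  · have hec : Even c.length := (Nat.even_add.1 h).1 hea
    rw [pairedList_append _ _ hea, pairedList_reverse _ (by simpa using hec), pairedList_map hneg,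
      (pairedList_iff_padded a).1 hea, (pairedList_iff_padded c).1 hec]
  · have hec : ¬ Even c.length := fun h0 => hea ((Nat.even_add.1 h).2 h0)
    rw [← (pairedList_iff_padded a).2 hea, ← (pairedList_iff_padded c).2 hec]
    rcases List.eq_nil_or_concat a with rfl | ⟨a', x, rfl⟩
    · simp at hea
    rcases List.eq_nil_or_concat c with rfl | ⟨c', y, rfl⟩
    · simp at hec
    simp only [List.concat_eq_append] at *
    have hea' : Even a'.length := by simpa [Nat.even_add_one] using hea
    have hec' : Even c'.length := by simpa [Nat.even_add_one] using hec
    have hx := ha x (by simp)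
    have hy := hc y (by simp)
    rw [List.map_append, List.reverse_append, List.append_assoc, List.append_assoc,
      List.append_assoc, pairedList_append _ _ hea', pairedList_append _ _ hea',
      pairedList_append _ _ hec']
    simp only [List.map_cons, List.map_nil, List.reverse_cons, List.reverse_nil, List.nil_append,
      List.cons_append, PairedList, and_true]
    rw [pairedList_reverse _ (by simpa using hec'), pairedList_map hneg]
    constructor
    · rintro ⟨h1, h2, h3⟩
      exact ⟨⟨h1, by omega⟩, h3, by omega⟩
    · rintro ⟨⟨h1, h2⟩, h3, h4⟩
      exact ⟨h1, by omega, h3⟩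

/-- The inserted 0, which stands for `β`, pads whichever of the two lists has odd length. -/
theorem pairedList_odd {a c : List ℤ} (h : ¬ Even (a.length + c.length)) :
    PairedList (a ++ 0 :: (c.map (fun x => -x)).reverse) ↔ PaddedPaired a ∧ PaddedPaired c := by
  have hneg : Function.Injective (fun x : ℤ => -x) := neg_injective
  by_cases hea : Even a.length
  · have hec : ¬ Even c.length := fun h0 => h (Nat.even_add.2 (iff_of_true hea h0))
    have e : 0 :: (c.map (fun x => -x)).reverse = ((c ++ [0]).map (fun x => -x)).reverse := by
      simp
    rw [pairedList_append _ _ hea, e, pairedList_reverse _ (by simpa [Nat.even_add_one] using hec),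
      pairedList_map hneg, (pairedList_iff_padded a).1 hea, (pairedList_iff_padded c).2 hec]
  · have hec : Even c.length := by
      by_contra h0
      exact h (Nat.even_add.2 (iff_of_false hea h0))
    rw [List.append_cons, pairedList_append _ _ (by simpa [Nat.even_add_one] using hea),
      pairedList_reverse _ (by simpa using hec), pairedList_map hneg,
      (pairedList_iff_padded a).2 hea, (pairedList_iff_padded c).1 hec]

/-! ### Decomposition of bitableaux into negative and positive rows -/

/-- The bitableau with given rows. -/
def ofRows {A : Type*} (R : List (List A × List A)) : NotchedTableau A × NotchedTableau A :=
  (R.map Prod.fst, R.map Prod.snd)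

theorem bitableauRows_ofRows {A : Type*} (R : List (List A × List A)) :
    bitableauRows (ofRows R) = R := by
  induction R with
  | nil => rfl
  | cons w R ih => simpa [bitableauRows, ofRows] using ih

theorem ofRows_bitableauRows {A : Type*} {B : NotchedTableau A × NotchedTableau A}
    (h : B.1.length = B.2.length) : ofRows (bitableauRows B) = B := by
  rw [ofRows, bitableauRows, List.map_fst_zip h.le, List.map_snd_zip h.ge]

/-- The negative rows `R` on top of the positive rows obtained by flipping `R'`. -/
def stackRows {A : Type*} (R R' : List (List A × List A)) : List (List A × List A) :=
  R ++ (R'.map Prod.swap).reverse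

section Rows

variable {d : ℕ} {β : Finset (Fin (2 * d))} {w w' : List (Fin (2 * d)) × List (Fin (2 * d))}

theorem IsRowPair.cardFrom_rowDiff (h : IsRowPair β w) (b : ℕ) :
    (cardFrom (rowDiff β w) b : ℤ) = cardFrom β b - height w b := by
  have := cardFrom_diffSet (β := β) (R := w.1.toFinset) (S := w.2.toFinset)
    (fun x hx => h.memP x (by simpa using hx)) (fun x hx => h.memQ x (by simpa using hx)) b
  rw [cardFrom_toFinset h.sortedP, cardFrom_toFinset h.sortedQ] at this
  rw [rowDiff, height]
  omega

theorem IsRowPair.card_rowDiff (h : IsRowPair β w) : (rowDiff β w).card = β.card := by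
  have := h.cardFrom_rowDiff 0
  rw [h.height_zero, cardFrom_zero, cardFrom_zero] at this
  omega

theorem setLE_rowDiff_iff (h : IsRowPair β w) (h' : IsRowPair β w') :
    SetLE (rowDiff β w) (rowDiff β w') ↔ ∀ b, height w' b ≤ height w b := by
  rw [setLE_iff, h.card_rowDiff, h'.card_rowDiff]
  simp only [true_and]
  refine forall_congr' fun b => ?_
  have := h.cardFrom_rowDiff b
  have := h'.cardFrom_rowDiff b
  omega

theorem setLE_rowDiff_right_iff {θ : Finset (Fin (2 * d))} (hθ : θ.card = β.card)
    (h : IsRowPair β w) :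
    SetLE θ (rowDiff β w) ↔ ∀ b, height w b ≤ cardFrom β b - cardFrom θ b := by
  rw [setLE_iff, h.card_rowDiff]
  simp only [hθ, true_and]
  refine forall_congr' fun b => ?_
  have := h.cardFrom_rowDiff b
  omega

theorem setLE_rowDiff_left_iff {θ : Finset (Fin (2 * d))} (hθ : θ.card = β.card)
    (h : IsRowPair β w) :
    SetLE (rowDiff β w) θ ↔ ∀ b, - height w b ≤ cardFrom θ b - cardFrom β b := by
  rw [setLE_iff, h.card_rowDiff]
  simp only [hθ, true_and]
  refine forall_congr' fun b => ?_
  have := h.cardFrom_rowDiff b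
  omega

/-- An entry outside of `β` never equals one in `β`, so the strict comparison is equivalent to the
weak one, which is a counting condition. -/
theorem isNegativeRow_iff (h : IsRowPair β w) : IsNegativeRow w ↔ ∀ b, 0 ≤ height w b := by
  have h1 : IsNegativeRow w ↔ List.Forall₂ (fun x y => x ≤ y) w.1 w.2 := by
    constructor
    · exact fun h => h.imp fun _ _ => le_of_lt
    · intro h2
      have h3 : List.Forall₂ (fun x y => x ∉ β ∧ y ∈ β) w.1 w.2 := by
        rw [List.forall₂_iff_zip]
        exact ⟨h.length_eq, fun hz => ⟨h.memP _ (List.of_mem_zip hz).1,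
          h.memQ _ (List.of_mem_zip hz).2⟩⟩
      rw [List.forall₂_iff_zip] at h2 h3
      rw [IsNegativeRow, List.forall₂_iff_zip]
      refine ⟨h2.1, fun hz => lt_of_le_of_ne (h2.2 hz) fun e => (h3.2 hz).1 (e ▸ (h3.2 hz).2)⟩
  rw [h1, forall₂_le_iff h.sortedP h.sortedQ]
  simp only [h.length_eq, true_and]
  refine forall_congr' fun b => ?_
  rw [height]
  omega

theorem isPositiveRow_iff (h : IsRowPair β w) : IsPositiveRow w ↔ ∀ b, height w b ≤ 0 := by
  have h1 : IsPositiveRow w ↔ IsNegativeRow w.swap :=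
    ⟨fun h => List.Forall₂.flip h, fun h => List.Forall₂.flip h⟩
  rw [h1, isNegativeRow_iff h.swap]
  simp [height_swap]

/-- A row of height identically 0 has no entries; thus the sign of a nonempty row is unambiguous. -/
theorem not_positive_of_negative (h : IsRowPair β w) (hne : w.1 ≠ [])
    (hneg : ∀ b, 0 ≤ height w b) (hpos : ∀ b, height w b ≤ 0) : False := by
  obtain ⟨x, hx⟩ := List.exists_mem_of_ne_nil _ hne
  have h1 := (h.mem_fst_iff x).1 hx
  have := hneg x.val
  have := hpos (x.val + 1)
  omega

end Rows

theorem eq_filter_append_filter {α : Type*} (p : α → Prop) [DecidablePred p] {l : List α}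
    (h : l.Pairwise (fun a b => p b → p a)) :
    l = l.filter (fun a => p a) ++ l.filter (fun a => ¬ p a) := by
  induction l with
  | nil => rfl
  | cons a l ih =>
    rw [List.pairwise_cons] at h
    by_cases ha : p a
    · rw [List.filter_cons_of_pos (by simpa using ha), List.filter_cons_of_neg (by simpa using ha),
        List.cons_append, ← ih h.2]
    · have e1 : l.filter (fun a => p a) = [] := by
        rw [List.filter_eq_nil_iff]
        intro b hb
        simpa using fun hpb => ha (h.1 b hb hpb)
      have e2 : l.filter (fun a => ¬ p a) = l := by
        rw [List.filter_eq_self]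
        intro b hb
        simpa using fun hpb => ha (h.1 b hb hpb)
      rw [List.filter_cons_of_neg (by simpa using ha), List.filter_cons_of_pos (by simpa using ha),
        e1, e2]
      rfl

section Decomposition

variable {d : ℕ} {β : Finset (Fin (2 * d))}
  {R R' : List (List (Fin (2 * d)) × List (Fin (2 * d)))}

theorem mem_flip {A : Type*} {R' : List (List A × List A)} {w : List A × List A} :
    w ∈ (R'.map Prod.swap).reverse ↔ w.swap ∈ R' := by
  rw [List.mem_reverse, List.mem_map]
  constructor
  · rintro ⟨v, hv, rfl⟩
    simpa using hv
  · exact fun h => ⟨_, h, Prod.swap_swap w⟩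

theorem IsNegativeRows.isRowPair_flip (hR' : IsNegativeRows βᶜ R') {w}
    (hw : w ∈ (R'.map Prod.swap).reverse) : IsRowPair β w ∧ w.1 ≠ [] ∧ ∀ b, height w b ≤ 0 := by
  rw [mem_flip] at hw
  have h1 := (hR'.rows _ hw).1.swap
  rw [compl_compl, Prod.swap_swap] at h1
  refine ⟨h1, fun h0 => (hR'.rows _ hw).2 ?_, fun b => ?_⟩
  · have := h1.length_eq
    rw [h0] at this
    exact List.length_eq_zero_iff.1 this.symm
  · have := hR'.nonneg _ hw b
    rw [height_swap] at this
    omega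

theorem isRowPair_stackRows (hR : IsNegativeRows β R) (hR' : IsNegativeRows βᶜ R') {w}
    (hw : w ∈ stackRows R R') : IsRowPair β w ∧ w.1 ≠ [] := by
  rcases List.mem_append.1 hw with h | h
  · exact hR.rows w h
  · exact ⟨(hR'.isRowPair_flip h).1, (hR'.isRowPair_flip h).2.1⟩

theorem pairwise_flip (hR' : IsNegativeRows βᶜ R') :
    (R'.map Prod.swap).reverse.Pairwise (fun w w' => ∀ b, height w' b ≤ height w b) := by
  rw [List.pairwise_reverse, List.pairwise_map]
  refine hR'.chain.imp fun h b => ?_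
  rw [height_swap, height_swap]
  exact neg_le_neg (h b)

theorem pairwise_stackRows (hR : IsNegativeRows β R) (hR' : IsNegativeRows βᶜ R') :
    (stackRows R R').Pairwise (fun w w' => ∀ b, height w' b ≤ height w b) := by
  rw [stackRows, List.pairwise_append]
  exact ⟨hR.chain, pairwise_flip hR', fun w hw w' hw' b =>
    ((hR'.isRowPair_flip hw').2.2 b).trans (hR.nonneg w hw b)⟩

theorem isNonvanishingSemistandard_stackRows (hR : IsNegativeRows β R)
    (hR' : IsNegativeRows βᶜ R') : IsNonvanishingSemistandard β (ofRows (stackRows R R')) := by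
  have hrow := fun w => isRowPair_stackRows hR hR' (w := w)
  constructor
  · simp only [ofRows, List.map_map]
    exact List.map_congr_left fun w hw => (hrow w hw).1.length_eq
  · simp only [ofRows, List.mem_map]
    rintro _ ⟨w, hw, rfl⟩
    exact (hrow w hw).2
  · simp only [ofRows, List.mem_map]
    rintro _ ⟨w, hw, rfl⟩
    exact (hrow w hw).1.sortedP
  · simp only [ofRows, List.mem_map]
    rintro _ ⟨w, hw, rfl⟩
    exact (hrow w hw).1.sortedQ
  · simp only [ofRows, List.mem_map]
    rintro _ ⟨w, hw, rfl⟩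
    exact (hrow w hw).1.memP
  · simp only [ofRows, List.mem_map]
    rintro _ ⟨w, hw, rfl⟩
    exact (hrow w hw).1.memQ
  · rw [bitableauRows_ofRows]
    refine List.Pairwise.isChain (List.Pairwise.imp_of_mem ?_ (pairwise_stackRows hR hR'))
    intro w w' hw hw' h
    exact (setLE_rowDiff_iff (hrow w hw).1 (hrow w' hw').1).2 h
  · rw [bitableauRows_ofRows]
    intro w hw
    rcases List.mem_append.1 hw with h | h
    · exact Or.inl ((isNegativeRow_iff (hrow w hw).1).2 (hR.nonneg w h))
    · exact Or.inr ((isPositiveRow_iff (hrow w hw).1).2 (hR'.isRowPair_flip h).2.2)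

theorem filter_negative_stackRows (hR : IsNegativeRows β R) (hR' : IsNegativeRows βᶜ R')
    [DecidablePred (fun w : List (Fin (2 * d)) × List (Fin (2 * d)) => IsNegativeRow w)] :
    (stackRows R R').filter (fun w => IsNegativeRow w) = R := by
  rw [stackRows, List.filter_append, List.filter_eq_self.2, List.filter_eq_nil_iff.2,
    List.append_nil]
  · intro w hw hn
    have h := hR'.isRowPair_flip hw
    exact not_positive_of_negative h.1 h.2.1 ((isNegativeRow_iff h.1).1 (by simpa using hn)) h.2.2
  · intro w hw
    simpa using (isNegativeRow_iff (hR.rows w hw).1).2 (hR.nonneg w hw)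

theorem filter_positive_stackRows (hR : IsNegativeRows β R) (hR' : IsNegativeRows βᶜ R')
    [DecidablePred (fun w : List (Fin (2 * d)) × List (Fin (2 * d)) => IsPositiveRow w)] :
    (stackRows R R').filter (fun w => IsPositiveRow w) = (R'.map Prod.swap).reverse := by
  rw [stackRows, List.filter_append, List.filter_eq_nil_iff.2, List.filter_eq_self.2,
    List.nil_append]
  · intro w hw
    have h := hR'.isRowPair_flip hw
    simpa using (isPositiveRow_iff h.1).2 h.2.2
  · intro w hw hn
    have h := hR.rows w hw
    exact not_positive_of_negative h.1 h.2 (hR.nonneg w hw)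
      ((isPositiveRow_iff h.1).1 (by simpa using hn))

open Classical in
-- Heights decrease from top to bottom, so the rows of nonnegative height form an initial segment
-- and all remaining rows are positive.
theorem exists_stackRows {B : NotchedTableau (Fin (2 * d)) × NotchedTableau (Fin (2 * d))}
    (hB : IsNonvanishingSemistandard β B) : ∃ R R', IsNegativeRows β R ∧ IsNegativeRows βᶜ R' ∧
      ofRows (stackRows R R') = B := by
  have hlen : B.1.length = B.2.length := by simpa using congrArg List.length hB.sameShape
  have hrow : ∀ w ∈ bitableauRows B, IsRowPair β w ∧ w.1 ≠ [] := by
    intro w hw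
    have h1 := (List.of_mem_zip hw).1
    have h2 := (List.of_mem_zip hw).2
    refine ⟨⟨?_, hB.rowStrictP _ h1, hB.rowStrictQ _ h2, hB.entriesP _ h1, hB.entriesQ _ h2⟩,
      hB.noEmptyRow _ h1⟩
    rcases hB.nonvanishing w hw with h | h
    · exact h.length_eq
    · exact h.length_eq
  have hpair : (bitableauRows B).Pairwise (fun w w' => ∀ b, height w' b ≤ height w b) := by
    have : IsTrans (List (Fin (2 * d)) × List (Fin (2 * d)))
        (fun w w' => SetLE (rowDiff β w) (rowDiff β w')) := ⟨fun _ _ _ h h' => h.trans h'⟩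
    refine List.Pairwise.imp_of_mem ?_ (List.isChain_iff_pairwise.1 hB.semistandard)
    intro w w' hw hw' h
    exact (setLE_rowDiff_iff (hrow w hw).1 (hrow w' hw').1).1 h
  have hsplit := eq_filter_append_filter (fun w => IsNegativeRow w) (l := bitableauRows B) (by
    refine List.Pairwise.imp_of_mem ?_ hpair
    intro w w' hw hw' h hn
    rw [isNegativeRow_iff (hrow w hw).1]
    exact fun b => ((isNegativeRow_iff (hrow w' hw').1).1 hn b).trans (h b))
  set R := (bitableauRows B).filter (fun w => IsNegativeRow w) with hRdef
  set S := (bitableauRows B).filter (fun w => ¬ IsNegativeRow w) with hSdef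
  have hRsub : ∀ w ∈ R, w ∈ bitableauRows B ∧ IsNegativeRow w := by
    intro w hw
    rw [hRdef] at hw
    simpa using hw
  have hSsub : ∀ w ∈ S, w ∈ bitableauRows B ∧ ¬ IsNegativeRow w := by
    intro w hw
    rw [hSdef] at hw
    simpa using hw
  have hSpos : ∀ w ∈ S, ∀ b, height w b ≤ 0 := fun w hw =>
    (isPositiveRow_iff (hrow w (hSsub w hw).1).1).1
      ((hB.nonvanishing w (hSsub w hw).1).resolve_left (hSsub w hw).2)
  refine ⟨R, (S.map Prod.swap).reverse, ⟨fun w hw => hrow w (hRsub w hw).1, fun w hw => ?_,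
    hpair.filter _⟩, ⟨fun w hw => ?_, fun w hw => ?_, ?_⟩, ?_⟩
  · exact (isNegativeRow_iff (hrow w (hRsub w hw).1).1).1 (hRsub w hw).2
  · rw [mem_flip] at hw
    have h := hrow _ (hSsub _ hw).1
    have h1 := h.1.swap
    rw [Prod.swap_swap] at h1
    refine ⟨h1, fun h0 => h.2 ?_⟩
    have := h1.length_eq
    rw [h0] at this
    exact List.length_eq_zero_iff.1 this.symm
  · rw [mem_flip] at hw
    intro b
    have := hSpos _ hw b
    rw [height_swap] at this
    omega
  · rw [List.pairwise_reverse, List.pairwise_map]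
    refine (hpair.filter _).imp fun h b => ?_
    rw [height_swap, height_swap]
    exact neg_le_neg (h b)
  · have e : stackRows R (S.map Prod.swap).reverse = bitableauRows B := by
      rw [stackRows, List.map_reverse, List.reverse_reverse, List.map_map]
      conv_rhs => rw [hsplit]
      simp
    rw [e, ofRows_bitableauRows hlen]

end Decomposition

/-! ### The conditions on bitableaux in terms of heights -/

section Star

variable {d : ℕ} {β : Finset (Fin (2 * d))}
  {R R' : List (List (Fin (2 * d)) × List (Fin (2 * d)))}

/-- The top row may be positive, namely if there are no negative rows. Then its bound follows from
`α ≤ β`, and the right side concerns the empty default row of height 0; likewise at the bottom. -/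
theorem bitableauBounded_stackRows_iff (hR : IsNegativeRows β R) (hR' : IsNegativeRows βᶜ R')
    {α γ : Finset (Fin (2 * d))} {T W : Finset (Fin (2 * d) × Fin (2 * d))}
    (hα : projDiff β T = α) (hγ : projDiff β W = γ) (hαβ : SetLE α β) (hβγ : SetLE β γ) :
    BitableauBounded β T W (ofRows (stackRows R R')) ↔
      (∀ b, height (R.getD 0 ([], [])) b ≤ cardFrom β b - cardFrom α b) ∧
        ∀ b, height (R'.getD 0 ([], [])) b ≤ cardFrom γ b - cardFrom β b := by
  rw [BitableauBounded, bitableauRows_ofRows, hα, hγ]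
  have h1 := (setLE_iff.1 hαβ)
  have h2 := (setLE_iff.1 hβγ)
  have hnil : ∀ b, height (([], []) : List (Fin (2 * d)) × List (Fin (2 * d))) b = 0 := fun b => by
    simp [height, countFrom]
  refine and_congr ?_ ?_
  · rcases R with _ | ⟨w, R⟩
    · refine iff_of_true ?_ ?_
      · intro w hw
        have hw' : w ∈ (R'.map Prod.swap).reverse := List.mem_of_mem_head? hw
        have h := hR'.isRowPair_flip hw'
        rw [setLE_rowDiff_right_iff h1.1 h.1]
        intro b
        have := h.2.2 b
        have := h1.2 b
        omega
      · intro b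
        have := h1.2 b
        rw [List.getD_nil, hnil]
        omega
    · simp only [stackRows, List.cons_append, List.head?_cons, Option.mem_def, Option.some.injEq,
        forall_eq', List.getD_cons_zero]
      exact setLE_rowDiff_right_iff h1.1 (hR.rows w (by simp)).1
  · rcases R' with _ | ⟨w, R'⟩
    · refine iff_of_true ?_ ?_
      · intro w hw
        have hw' : w ∈ R := by
          have := List.mem_of_mem_getLast? hw
          simpa [stackRows] using this
        rw [setLE_rowDiff_left_iff h2.1.symm (hR.rows w hw').1]
        intro b
        have := hR.nonneg w hw' b
        have := h2.2 b
        omega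
      · intro b
        have := h2.2 b
        rw [List.getD_nil, hnil]
        omega
    · simp only [stackRows, List.map_cons, List.reverse_cons, ← List.append_assoc,
        List.getLast?_append, List.getLast?_singleton, Option.some_or, Option.mem_def,
        Option.some.injEq, forall_eq', List.getD_cons_zero]
      rw [setLE_rowDiff_left_iff h2.1.symm (hR'.isRowPair_flip (by simp)).1]
      simp [height_swap]

theorem epsDegree_eq_cardFrom (θ : Finset (Fin (2 * d))) : epsDegree θ = cardFrom θ d := by
  rw [epsDegree, cardFrom]
  congr 1
  ext x
  simp

/-- Subtracting from the value of `β` turns `ε`-degrees of rows into heights at `d` and that of `β`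
itself into 0. -/
theorem pairedEpsDegrees_iff (δ : List (Finset (Fin (2 * d)))) :
    PairedEpsDegrees δ ↔ PairedList (δ.map (fun θ => (cardFrom β d : ℤ) - cardFrom θ d)) := by
  have e : (fun θ : Finset (Fin (2 * d)) => (cardFrom β d : ℤ) - cardFrom θ d) =
      (fun z : ℕ => (cardFrom β d : ℤ) - z) ∘ epsDegree := by
    funext θ
    simp [epsDegree_eq_cardFrom]
  have hinj : Function.Injective (fun z : ℕ => (cardFrom β d : ℤ) - z) := by
    intro a b h
    simp only [] at h
    omega
  rw [e, ← List.map_map, pairedList_map hinj, pairedList_iff]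
  simp only [PairedEpsDegrees, List.getElem?_map, Option.map_eq_some_iff]
  constructor
  · rintro h k _ _ ⟨a, ha, rfl⟩ ⟨b, hb, rfl⟩
    exact h k a b ha hb
  · intro h k a b ha hb
    exact h k _ _ ⟨a, ha, rfl⟩ ⟨b, hb, rfl⟩

theorem map_eps_rowDiff (h : ∀ w ∈ R, IsRowPair β w) :
    (R.map (rowDiff β)).map (fun θ => (cardFrom β d : ℤ) - cardFrom θ d) =
      R.map (fun w => height w d) := by
  rw [List.map_map]
  refine List.map_congr_left fun w hw => ?_
  have := (h w hw).cardFrom_rowDiff d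
  simp only [Function.comp]
  omega

theorem map_height_flip (R' : List (List (Fin (2 * d)) × List (Fin (2 * d)))) :
    (R'.map Prod.swap).reverse.map (fun w => height w d) =
      ((R'.map (fun w => height w d)).map (fun x => -x)).reverse := by
  rw [List.map_reverse, List.map_map, List.map_map]
  congr 1
  exact List.map_congr_left fun w _ => height_swap w d

theorem paddedPaired_heights (R : List (List (Fin (2 * d)) × List (Fin (2 * d)))) :
    PaddedPaired (R.map (fun w => height w d)) ↔ ∀ j,
      height (R.getD (2 * j) ([], [])) d = height (R.getD (2 * j + 1) ([], [])) d := by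
  have e : ∀ i, (R.map (fun w => height w d)).getD i 0 = height (R.getD i ([], [])) d := by
    intro i
    rcases lt_or_ge i R.length with hi | hi
    · rw [List.getD_eq_getElem _ _ (by simpa using hi), List.getD_eq_getElem _ _ hi,
        List.getElem_map]
    · rw [List.getD_eq_default _ _ (by simpa using hi), List.getD_eq_default _ _ hi]
      simp [height, countFrom]
  simp only [PaddedPaired, e]

theorem selfDual_swap_iff {w : List (Fin (2 * d)) × List (Fin (2 * d))} :
    w.swap.1.toFinset = w.swap.2.toFinset.image Fin.rev ↔
      w.1.toFinset = w.2.toFinset.image Fin.rev := by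
  have key : ∀ X Y : Finset (Fin (2 * d)), X = Y.image Fin.rev → Y = X.image Fin.rev := by
    rintro _ Y rfl
    rw [Finset.image_image, Fin.rev_involutive.comp_self, Finset.image_id]
  exact ⟨key _ _, key _ _⟩

theorem setLE_rowDiff_self_iff {w : List (Fin (2 * d)) × List (Fin (2 * d))} (h : IsRowPair β w) :
    (SetLE (rowDiff β w) β ↔ ∀ b, 0 ≤ height w b) ∧
      (SetLE β (rowDiff β w) ↔ ∀ b, height w b ≤ 0) := by
  rw [setLE_rowDiff_left_iff rfl h, setLE_rowDiff_right_iff rfl h]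
  simp

open Classical in
theorem augmentedRows_stackRows (hR : IsNegativeRows β R) (hR' : IsNegativeRows βᶜ R') :
    augmentedRows β (ofRows (stackRows R R')) =
      R.map (rowDiff β) ++ β :: (R'.map Prod.swap).reverse.map (rowDiff β) := by
  rw [augmentedRows, bitableauRows_ofRows, filter_negative_stackRows hR hR',
    filter_positive_stackRows hR hR']

/-- Negative rows lie below `β` and positive ones above, so the chain through `β` imposes no
restriction. -/
theorem isChain_augmentedRows (hR : IsNegativeRows β R) (hR' : IsNegativeRows βᶜ R') :
    (augmentedRows β (ofRows (stackRows R R'))).IsChain SetLE := by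
  rw [augmentedRows_stackRows hR hR']
  apply List.Pairwise.isChain
  have hS := fun w => hR'.isRowPair_flip (w := w)
  rw [List.pairwise_append, List.pairwise_cons, List.pairwise_map, List.pairwise_map]
  refine ⟨?_, ⟨?_, ?_⟩, ?_⟩
  · refine List.Pairwise.imp_of_mem ?_ hR.chain
    intro w w' hw hw' h
    exact (setLE_rowDiff_iff (hR.rows w hw).1 (hR.rows w' hw').1).2 h
  · intro θ hθ
    obtain ⟨w, hw, rfl⟩ := List.mem_map.1 hθ
    exact (setLE_rowDiff_self_iff (hS w hw).1).2.2 (hS w hw).2.2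
  · refine List.Pairwise.imp_of_mem ?_ (pairwise_flip hR')
    intro w w' hw hw' h
    exact (setLE_rowDiff_iff (hS w hw).1 (hS w' hw').1).2 h
  · intro θ hθ θ' hθ'
    obtain ⟨w, hw, rfl⟩ := List.mem_map.1 hθ
    have h1 := (setLE_rowDiff_self_iff (hR.rows w hw).1).1.2 (hR.nonneg w hw)
    rcases List.mem_cons.1 hθ' with rfl | hθ'
    · exact h1
    · obtain ⟨w', hw', rfl⟩ := List.mem_map.1 hθ'
      exact h1.trans ((setLE_rowDiff_self_iff (hS w' hw').1).2.2 (hS w' hw').2.2)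

theorem epsPairs_stackRows_iff (hR : IsNegativeRows β R) (hR' : IsNegativeRows βᶜ R') :
    (Even (ofRows (stackRows R R')).1.length ∧
        PairedEpsDegrees ((bitableauRows (ofRows (stackRows R R'))).map (rowDiff β)) ∨
      Odd (ofRows (stackRows R R')).1.length ∧
        PairedEpsDegrees (augmentedRows β (ofRows (stackRows R R')))) ↔
    (∀ j, height (R.getD (2 * j) ([], [])) d = height (R.getD (2 * j + 1) ([], [])) d) ∧
      ∀ j, height (R'.getD (2 * j) ([], [])) d = height (R'.getD (2 * j + 1) ([], [])) d := by
  have hlen : (ofRows (stackRows R R')).1.length = R.length + R'.length := by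
    simp [ofRows, stackRows]
  have hflip := fun w hw => (hR'.isRowPair_flip (w := w) hw).1
  have hnn : ∀ {β' : Finset (Fin (2 * d))} {S : List (List (Fin (2 * d)) × List (Fin (2 * d)))},
      IsNegativeRows β' S → ∀ x ∈ S.map (fun w => height w d), 0 ≤ x := by
    intro β' S hS x hx
    obtain ⟨w, hw, rfl⟩ := List.mem_map.1 hx
    exact hS.nonneg w hw d
  have heven : Even (R.length + R'.length) →
      (PairedEpsDegrees ((bitableauRows (ofRows (stackRows R R'))).map (rowDiff β)) ↔
        PaddedPaired (R.map (fun w => height w d)) ∧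
          PaddedPaired (R'.map (fun w => height w d))) := by
    intro he
    rw [pairedEpsDegrees_iff (β := β), bitableauRows_ofRows,
      map_eps_rowDiff fun w hw => (isRowPair_stackRows hR hR' hw).1, stackRows, List.map_append,
      map_height_flip, pairedList_even (hnn hR) (hnn hR') (by simpa using he)]
  have hodd : Odd (R.length + R'.length) →
      (PairedEpsDegrees (augmentedRows β (ofRows (stackRows R R'))) ↔
        PaddedPaired (R.map (fun w => height w d)) ∧
          PaddedPaired (R'.map (fun w => height w d))) := by
    intro ho
    rw [pairedEpsDegrees_iff (β := β), augmentedRows_stackRows hR hR', List.map_append,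
      List.map_cons, map_eps_rowDiff fun w hw => (hR.rows w hw).1, map_eps_rowDiff hflip,
      map_height_flip, sub_self, pairedList_odd (by simpa using ho)]
  rw [hlen, ← paddedPaired_heights, ← paddedPaired_heights]
  rcases Nat.even_or_odd (R.length + R'.length) with he | ho
  · have := heven he
    have := Nat.not_odd_iff_even.2 he
    tauto
  · have := hodd ho
    have := Nat.not_even_iff_odd.2 ho
    tauto

theorem isOnStar_stackRows_iff (hR : IsNegativeRows β R) (hR' : IsNegativeRows βᶜ R') :
    IsOnStar β (ofRows (stackRows R R')) ↔
      ((∀ w ∈ R, w.1.toFinset = w.2.toFinset.image Fin.rev) ∧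
        ∀ w ∈ R', w.1.toFinset = w.2.toFinset.image Fin.rev) ∧
      ((∀ j, height (R.getD (2 * j) ([], [])) d = height (R.getD (2 * j + 1) ([], [])) d) ∧
        ∀ j, height (R'.getD (2 * j) ([], [])) d = height (R'.getD (2 * j + 1) ([], [])) d) ∧
      Even (bitableauDegree (ofRows (stackRows R R'))) := by
  have hdual : (∀ w ∈ bitableauRows (ofRows (stackRows R R')),
      w.1.toFinset = w.2.toFinset.image Fin.rev) ↔
      ((∀ w ∈ R, w.1.toFinset = w.2.toFinset.image Fin.rev) ∧
        ∀ w ∈ R', w.1.toFinset = w.2.toFinset.image Fin.rev) := by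
    rw [bitableauRows_ofRows, stackRows]
    simp only [List.mem_append, or_imp, forall_and]
    refine and_congr_right' ⟨fun h w hw => ?_, fun h w hw => ?_⟩
    · rw [← selfDual_swap_iff]
      exact h _ (mem_flip.2 (by simpa using hw))
    · rw [← selfDual_swap_iff]
      exact h _ (mem_flip.1 hw)
  rw [← hdual, ← epsPairs_stackRows_iff hR hR']
  constructor
  · exact fun h => ⟨h.selfDual, h.epsPairs, h.evenBoxes⟩
  · rintro ⟨h1, h2, h3⟩
    refine ⟨h1, ?_, h2, h3⟩
    rcases Nat.even_or_odd (ofRows (stackRows R R')).1.length with he | ho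
    · exact Or.inl he
    · exact Or.inr ⟨ho, isChain_augmentedRows hR hR'⟩

end Star

/-! ### The negative and the positive part of a multiset -/

section Parts

variable {d : ℕ} {β : Finset (Fin (2 * d))} {S : Multiset (Fin (2 * d) × Fin (2 * d))}

/-- The negative part of a multiset. -/
def negativePart (S : Multiset (Fin (2 * d) × Fin (2 * d))) :
    Multiset (Fin (2 * d) × Fin (2 * d)) :=
  S.filter (fun u => u.1 < u.2)

/-- The positive part of a multiset, with the coordinates interchanged. -/
def swappedPositivePart (S : Multiset (Fin (2 * d) × Fin (2 * d))) :
    Multiset (Fin (2 * d) × Fin (2 * d)) :=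
  (S.filter (fun u => u.2 < u.1)).map Prod.swap

theorem mem_negativePart {u} : u ∈ negativePart S ↔ u ∈ S ∧ u.1 < u.2 :=
  Multiset.mem_filter

theorem mem_swappedPositivePart {u} : u ∈ swappedPositivePart S ↔ u.swap ∈ S ∧ u.1 < u.2 := by
  rw [swappedPositivePart, Multiset.mem_map]
  constructor
  · rintro ⟨v, hv, rfl⟩
    simpa using hv
  · exact fun h => ⟨u.swap, by simpa using h, Prod.swap_swap u⟩

theorem isNegativeMultiset_negativePart (hS : IsNonvanishingMultiset β S) :
    IsNegativeMultiset β (negativePart S) := fun u hu =>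
  ⟨(hS.1 u (mem_negativePart.1 hu).1).1, (hS.1 u (mem_negativePart.1 hu).1).2,
    (mem_negativePart.1 hu).2⟩

theorem isNegativeMultiset_swappedPositivePart (hS : IsNonvanishingMultiset β S) :
    IsNegativeMultiset βᶜ (swappedPositivePart S) := fun u hu => by
  rw [mem_swappedPositivePart] at hu
  have := hS.1 _ hu.1
  exact ⟨by simpa using this.2, by simpa using this.1, hu.2⟩

theorem count_eq_of_ne (u : Fin (2 * d) × Fin (2 * d)) (hu : u.1 ≠ u.2) :
    S.count u = (negativePart S).count u + (swappedPositivePart S).count u.swap := by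
  rw [swappedPositivePart, Multiset.count_map_eq_count' _ _ Prod.swap_injective, negativePart,
    Multiset.count_filter, Multiset.count_filter]
  rcases lt_or_gt_of_ne hu with h | h
  · rw [if_pos h, if_neg h.not_gt, add_zero]
  · rw [if_neg h.not_gt, if_pos h, zero_add]

theorem ext_parts {S' : Multiset (Fin (2 * d) × Fin (2 * d))} (hS : IsNonvanishingMultiset β S)
    (hS' : IsNonvanishingMultiset β S') (h1 : negativePart S = negativePart S')
    (h2 : swappedPositivePart S = swappedPositivePart S') : S = S' := by
  ext u
  by_cases hu : u.1 = u.2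
  · rw [Multiset.count_eq_zero_of_notMem fun h => hS.2 u h hu,
      Multiset.count_eq_zero_of_notMem fun h => hS'.2 u h hu]
  · rw [count_eq_of_ne (S := S) u hu, count_eq_of_ne (S := S') u hu, h1, h2]

theorem parts_of_add {U V : Multiset (Fin (2 * d) × Fin (2 * d))} (hU : IsNegativeMultiset β U)
    (hV : IsNegativeMultiset βᶜ V) : IsNonvanishingMultiset β (U + V.map Prod.swap) ∧
      negativePart (U + V.map Prod.swap) = U ∧ swappedPositivePart (U + V.map Prod.swap) = V := by
  have hV' : ∀ u ∈ V.map Prod.swap, IsRoot β u ∧ u.2 < u.1 := by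
    intro u hu
    obtain ⟨v, hv, rfl⟩ := Multiset.mem_map.1 hu
    obtain ⟨h1, h2, h3⟩ := hV v hv
    exact ⟨⟨by simpa using h2, by simpa using h1⟩, h3⟩
  refine ⟨⟨fun u hu => ?_, fun u hu => ?_⟩, ?_, ?_⟩
  · rcases Multiset.mem_add.1 hu with h | h
    · exact ⟨(hU u h).1, (hU u h).2.1⟩
    · exact (hV' u h).1
  · rcases Multiset.mem_add.1 hu with h | h
    · exact (hU u h).2.2.ne
    · exact (hV' u h).2.ne'
  · rw [negativePart, Multiset.filter_add, Multiset.filter_eq_self.2 fun u hu => (hU u hu).2.2,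
      Multiset.filter_eq_nil.2 fun u hu => (hV' u hu).2.not_gt, add_zero]
  · rw [swappedPositivePart, Multiset.filter_add,
      Multiset.filter_eq_nil.2 fun u hu => (hU u hu).2.2.not_gt,
      Multiset.filter_eq_self.2 fun u hu => (hV' u hu).2, zero_add, Multiset.map_map]
    simp

theorem brsk_eq (hS : IsNonvanishingMultiset β S) :
    brsk S = ofRows (stackRows (negativeRows (negativePart S))
      (negativeRows (swappedPositivePart S))) := by
  have h1 := brskNegative_eq_map (isNegativeMultiset_negativePart hS)
  have h2 := brskNegative_eq_map (isNegativeMultiset_swappedPositivePart hS)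
  rw [brsk, brskPositive, flipBitableau]
  change ((brskNegative (negativePart S)).1 ++ (brskNegative (swappedPositivePart S)).2.reverse,
    (brskNegative (negativePart S)).2 ++ (brskNegative (swappedPositivePart S)).1.reverse) = _
  rw [h1, h2, ofRows, stackRows]
  simp [List.map_append, List.map_reverse, Function.comp_def]

theorem bitableauDegree_brsk (hS : IsNonvanishingMultiset β S) :
    bitableauDegree (brsk S) = Multiset.card S := by
  have hshape : ((brskNegative (swappedPositivePart S)).2.map List.length).sum =
      bitableauDegree (brskNegative (swappedPositivePart S)) := by
    rw [brskNegative_eq_map (isNegativeMultiset_swappedPositivePart hS), bitableauDegree,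
      List.map_map, List.map_map]
    congr 1
    exact List.map_congr_left fun w hw =>
      (((isNegativeMultiset_swappedPositivePart hS).isNegativeRows.rows w hw).1.length_eq).symm
  have hsplit : bitableauDegree (brsk S) = bitableauDegree (brskNegative (negativePart S)) +
      bitableauDegree (brskNegative (swappedPositivePart S)) := by
    rw [← hshape]
    change (((brskNegative (negativePart S)).1 ++
      (brskNegative (swappedPositivePart S)).2.reverse).map List.length).sum = _
    rw [List.map_append, List.sum_append, List.map_reverse, List.sum_reverse]
    rfl
  have hcard : S = negativePart S + S.filter (fun u => u.2 < u.1) := by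
    conv_lhs => rw [← Multiset.filter_add_not (fun u : Fin (2 * d) × Fin (2 * d) => u.1 < u.2) S]
    congr 1
    refine Multiset.filter_congr fun u hu => ?_
    have := hS.2 u hu
    rw [not_lt]
    exact ⟨fun h => lt_of_le_of_ne h this.symm, le_of_lt⟩
  rw [hsplit, bitableauDegree_brskNegative, bitableauDegree_brskNegative, swappedPositivePart,
    Multiset.card_map]
  conv_rhs => rw [hcard]
  rw [Multiset.card_add]

theorem sharp_injective : Function.Injective (sharp (d := d)) := by
  intro u v h
  simp only [sharp, Prod.mk.injEq, Fin.rev_inj] at h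
  exact Prod.ext h.2 h.1

theorem sharp_sharp (u : Fin (2 * d) × Fin (2 * d)) : sharp (sharp u) = u := by
  simp [sharp]

theorem negativePart_map_sharp : negativePart (S.map sharp) = (negativePart S).map sharp := by
  rw [negativePart, negativePart, Multiset.filter_map]
  congr 1
  refine Multiset.filter_congr fun u _ => ?_
  simp [sharp, Fin.rev_lt_rev]

theorem swappedPositivePart_map_sharp :
    swappedPositivePart (S.map sharp) = (swappedPositivePart S).map sharp := by
  rw [swappedPositivePart, swappedPositivePart, Multiset.filter_map, Multiset.map_map,
    Multiset.map_map]
  refine (congrArg _ (Multiset.filter_congr fun u _ => ?_)).trans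
    (Multiset.map_congr rfl fun u _ => ?_)
  · simp [sharp, Fin.rev_lt_rev]
  · rfl

/-- Since `Fin.rev` reverses the order, `sharp` preserves the sign of a root. No diagonal root has
equal coordinates, as `2 * d` is even, so each lies in exactly one part. -/
theorem isSpecialMultiset_iff (hS : IsNonvanishingMultiset β S) : IsSpecialMultiset S ↔
    ((negativePart S).map sharp = negativePart S ∧
      (swappedPositivePart S).map sharp = swappedPositivePart S) ∧
    (∀ u, u.1 = Fin.rev u.2 → Even ((negativePart S).count u)) ∧
      ∀ u, u.1 = Fin.rev u.2 → Even ((swappedPositivePart S).count u) := by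
  have hdiag : ∀ u : Fin (2 * d) × Fin (2 * d), u.1 = Fin.rev u.2 → u.1 ≠ u.2 := by
    intro u hu h
    rw [Fin.ext_iff, Fin.val_rev] at hu
    rw [Fin.ext_iff] at h
    omega
  have hswap : ∀ u : Fin (2 * d) × Fin (2 * d), u.1 = Fin.rev u.2 →
      u.swap.1 = Fin.rev u.swap.2 := by
    intro u hu
    simp [hu]
  rw [IsSpecialMultiset]
  refine and_congr ⟨fun h => ?_, fun h => ?_⟩ ⟨fun h => ⟨fun u hu => ?_, fun u hu => ?_⟩,
    fun h u hu => ?_⟩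
  · rw [← negativePart_map_sharp, ← swappedPositivePart_map_sharp, h]
    exact ⟨rfl, rfl⟩
  · rw [← negativePart_map_sharp, ← swappedPositivePart_map_sharp] at h
    ext u
    by_cases hu : u.1 = u.2
    · have hu' : (sharp u).1 = (sharp u).2 := by simp [sharp, hu]
      rw [Multiset.count_eq_zero_of_notMem fun h => hS.2 u h hu, ← sharp_sharp u,
        Multiset.count_map_eq_count' _ _ sharp_injective,
        Multiset.count_eq_zero_of_notMem fun h => hS.2 _ h hu']
    · rw [count_eq_of_ne (S := S.map sharp) u hu, count_eq_of_ne (S := S) u hu, h.1, h.2]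
  · have h1 := h u hu
    rw [negativePart, Multiset.count_filter]
    split_ifs
    exacts [h1, Even.zero]
  · have h1 := h u.swap (hswap u hu)
    rw [← Prod.swap_swap u, swappedPositivePart,
      Multiset.count_map_eq_count' _ _ Prod.swap_injective, Multiset.count_filter]
    split_ifs
    exacts [h1, Even.zero]
  · rw [count_eq_of_ne u (hdiag u hu)]
    exact (h.1 u hu).add (h.2 _ (hswap u hu))

/-- The involution `sharp` pairs off the nondiagonal roots, and its fixed points are the diagonal
ones, which have even multiplicity. So the evenness of the number of boxes is automatic. -/
theorem even_card_of_special (hS : IsSpecialMultiset S) : Even (Multiset.card S) := by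
  have h1 : ∀ u, S.count (sharp u) = S.count u := fun u => by
    conv_lhs => rw [← hS.1]
    rw [Multiset.count_map_eq_count' _ _ sharp_injective]
  have h2 : ∑ u : Fin (2 * d) × Fin (2 * d), (S.count u : ZMod 2) = 0 := by
    refine Finset.sum_involution (fun u _ => sharp u) (fun u _ => ?_) (fun u _ hne h => hne ?_)
      (fun _ _ => Finset.mem_univ _) (fun u _ => sharp_sharp u)
    · rw [h1]
      exact CharTwo.add_self_eq_zero _
    · rw [ZMod.natCast_eq_zero_iff_even]
      exact hS.2 u (congrArg Prod.fst h).symm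
  rw [← ZMod.natCast_eq_zero_iff_even, ← h2, ← Nat.cast_sum, Multiset.sum_count_eq_card]
  exact fun u _ => Finset.mem_univ u

theorem IsRootChain.subset {K K' : Finset (Fin (2 * d) × Fin (2 * d))} (h : IsRootChain K)
    (hK : K' ⊆ K) : IsRootChain K' :=
  fun u hu v hv => h u (hK hu) v (hK hv)

theorem IsRootChain.swap {K : Finset (Fin (2 * d) × Fin (2 * d))} (h : IsRootChain K) :
    IsRootChain (K.image Prod.swap) := by
  intro u hu v hv huv
  obtain ⟨u', hu', rfl⟩ := Finset.mem_image.1 hu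
  obtain ⟨v', hv', rfl⟩ := Finset.mem_image.1 hv
  have := h u' hu' v' hv' fun e => huv (by rw [e])
  simp only [Prod.fst_swap, Prod.snd_swap]
  tauto

/-- Both projections are injective on a chain, so passing from multisets of coordinates to sets
loses nothing. -/
theorem cardFrom_projDiff {K : Finset (Fin (2 * d) × Fin (2 * d))} (hK : IsRootChain K)
    (hroot : ∀ u ∈ K, IsRoot β u) (b : ℕ) :
    cardFrom (projDiff β K) b + (K.filter (fun u => b ≤ u.2.val)).card =
      cardFrom β b + (K.filter (fun u => b ≤ u.1.val)).card := by
  have h1 : cardFrom (K.image Prod.fst) b = (K.filter (fun u => b ≤ u.1.val)).card := by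
    rw [cardFrom, Finset.filter_image, Finset.card_image_of_injOn]
    intro u hu v hv huv
    by_contra hne
    have := hK u (Finset.mem_filter.1 hu).1 v (Finset.mem_filter.1 hv).1 hne
    rw [huv] at this
    simp at this
  have h2 : cardFrom (K.image Prod.snd) b = (K.filter (fun u => b ≤ u.2.val)).card := by
    rw [cardFrom, Finset.filter_image, Finset.card_image_of_injOn]
    intro u hu v hv huv
    by_contra hne
    have := hK u (Finset.mem_filter.1 hu).1 v (Finset.mem_filter.1 hv).1 hne
    rw [huv] at this
    simp at this
  rw [← h1, ← h2, projDiff]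
  refine cardFrom_diffSet (fun x hx => ?_) (fun x hx => ?_) b
  · obtain ⟨u, hu, rfl⟩ := Finset.mem_image.1 hx
    exact (hroot u hu).1
  · obtain ⟨u, hu, rfl⟩ := Finset.mem_image.1 hx
    exact (hroot u hu).2

theorem card_projDiff {K : Finset (Fin (2 * d) × Fin (2 * d))} (hK : IsRootChain K)
    (hroot : ∀ u ∈ K, IsRoot β u) : (projDiff β K).card = β.card := by
  have := cardFrom_projDiff hK hroot 0
  rw [cardFrom_zero, cardFrom_zero] at this
  simpa using this

/-- The negative and positive parts of a chain are again chains, so the two bounds decouple and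
`chain_bound_iff` applies to each, for the positive part after a swap. -/
theorem multisetBounded_iff (hS : IsNonvanishingMultiset β S) {α γ : Finset (Fin (2 * d))}
    {T W : Finset (Fin (2 * d) × Fin (2 * d))} (hα : projDiff β T = α) (hγ : projDiff β W = γ)
    (hαβ : SetLE α β) (hβγ : SetLE β γ) : MultisetBounded β T W S ↔
      (∀ b, height ((negativeRows (negativePart S)).getD 0 ([], [])) b ≤
        cardFrom β b - cardFrom α b) ∧
      ∀ b, height ((negativeRows (swappedPositivePart S)).getD 0 ([], [])) b ≤
        cardFrom γ b - cardFrom β b := by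
  rw [← chain_bound_iff (isNegativeMultiset_negativePart hS),
    ← chain_bound_iff (isNegativeMultiset_swappedPositivePart hS), MultisetBounded, hα, hγ]
  have cα := (setLE_iff.1 hαβ).1
  have cγ := (setLE_iff.1 hβγ).1
  have hswapcard : ∀ (K : Finset (Fin (2 * d) × Fin (2 * d))) (b : ℕ),
      ((K.image Prod.swap).filter (fun u => b ≤ u.1.val)).card =
        (K.filter (fun u => b ≤ u.2.val)).card ∧
      ((K.image Prod.swap).filter (fun u => b ≤ u.2.val)).card =
        (K.filter (fun u => b ≤ u.1.val)).card := by
    intro K b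
    constructor <;>
    · rw [Finset.filter_image, Finset.card_image_of_injective _ Prod.swap_injective]
      rfl
  constructor
  · intro h
    constructor
    · intro K hKS hK b
      have hroot : ∀ u ∈ K, IsRoot β u := fun u hu => hS.1 u (mem_negativePart.1 (hKS u hu)).1
      have h1 := (h K (fun u hu => (mem_negativePart.1 (hKS u hu)).1) hK).1
      rw [Finset.filter_true_of_mem fun u hu => (mem_negativePart.1 (hKS u hu)).2, setLE_iff] at h1
      have h2 := h1.2 b
      have h3 := cardFrom_projDiff hK hroot b
      omega
    · intro K hKS hK b
      have hmem : ∀ u ∈ K.image Prod.swap, u ∈ S ∧ u.2 < u.1 := by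
        intro u hu
        obtain ⟨v, hv, rfl⟩ := Finset.mem_image.1 hu
        exact mem_swappedPositivePart.1 (hKS v hv)
      have h1 := (h (K.image Prod.swap) (fun u hu => (hmem u hu).1) hK.swap).2
      rw [Finset.filter_true_of_mem fun u hu => (hmem u hu).2, setLE_iff] at h1
      have h2 := h1.2 b
      have h3 := cardFrom_projDiff hK.swap (fun u hu => hS.1 u (hmem u hu).1) b
      have h4 := hswapcard K b
      omega
  · rintro ⟨hneg, hpos⟩ K hKS hK
    constructor
    · have hK' := hK.subset (Finset.filter_subset (fun u => u.1 < u.2) K)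
      have hroot : ∀ u ∈ K.filter (fun u => u.1 < u.2), IsRoot β u := fun u hu =>
        hS.1 u (hKS u (Finset.mem_filter.1 hu).1)
      rw [setLE_iff, card_projDiff hK' hroot]
      refine ⟨cα, fun b => ?_⟩
      have h1 := hneg _ (fun u hu => mem_negativePart.2
        ⟨hKS u (Finset.mem_filter.1 hu).1, (Finset.mem_filter.1 hu).2⟩) hK' b
      have h2 := cardFrom_projDiff hK' hroot b
      omega
    · have hK' := hK.subset (Finset.filter_subset (fun u => u.2 < u.1) K)
      have hroot : ∀ u ∈ K.filter (fun u => u.2 < u.1), IsRoot β u := fun u hu =>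
        hS.1 u (hKS u (Finset.mem_filter.1 hu).1)
      rw [setLE_iff, card_projDiff hK' hroot]
      refine ⟨cγ, fun b => ?_⟩
      have hmem : ∀ u ∈ (K.filter (fun u => u.2 < u.1)).image Prod.swap,
          u ∈ swappedPositivePart S := by
        intro u hu
        obtain ⟨v, hv, rfl⟩ := Finset.mem_image.1 hu
        rw [Finset.mem_filter] at hv
        rw [mem_swappedPositivePart, Prod.swap_swap]
        exact ⟨hKS v hv.1, hv.2⟩
      have h1 := hpos _ hmem hK'.swap b
      have h2 := cardFrom_projDiff hK' hroot b
      have h3 := hswapcard (K.filter (fun u => u.2 < u.1)) b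
      omega

theorem projDiff_of_represents {θ : Finset (Fin (2 * d))}
    {T : Finset (Fin (2 * d) × Fin (2 * d))} (h : Represents β θ T) : projDiff β T = θ := by
  have h1 : T.image Prod.fst = θ \ β := by
    ext x
    rw [← Finset.mem_val, ← Finset.mem_val, ← h.2.1]
    simp
  have h2 : T.image Prod.snd = β \ θ := by
    ext x
    rw [← Finset.mem_val, ← Finset.mem_val, ← h.2.2]
    simp
  rw [projDiff, diffSet, h1, h2]
  ext x
  simp only [Finset.mem_union, Finset.mem_sdiff]
  tauto

/-- A nonvanishing multiset is special and bounded if and only if its bitableau is on the starred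
root set and bounded. -/
theorem mem_specialMultisets_iff (hβ : IsSymplecticIndex β) (hS : IsNonvanishingMultiset β S)
    {α γ : Finset (Fin (2 * d))} {T W : Finset (Fin (2 * d) × Fin (2 * d))}
    (hα : projDiff β T = α) (hγ : projDiff β W = γ) (hαβ : SetLE α β) (hβγ : SetLE β γ) :
    S ∈ specialMultisets β T W ↔ brsk S ∈ starBitableaux β T W := by
  have hU := isNegativeMultiset_negativePart hS
  have hV := isNegativeMultiset_swappedPositivePart hS
  have hR := hU.isNegativeRows
  have hR' := hV.isNegativeRows
  have hβc : ∀ j, j ∈ βᶜ ↔ Fin.rev j ∉ βᶜ := by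
    intro j
    rw [Finset.mem_compl, Finset.mem_compl, hβ.2 j]
  have hspecial : IsSpecialMultiset S ↔ IsOnStar β (brsk S) := by
    have heven : IsSpecialMultiset S → Even (bitableauDegree (brsk S)) := fun h => by
      rw [bitableauDegree_brsk hS]
      exact even_card_of_special h
    have e1 := map_sharp_iff_selfDual hβ.2 hU
    have e2 := map_sharp_iff_selfDual hβc hV
    have e3 := isSpecialMultiset_iff hS
    have e4 := isOnStar_stackRows_iff hR hR'
    rw [← brsk_eq hS, ← e1, ← e2] at e4
    rw [e4]
    constructor
    · intro h
      have h1 := e3.1 h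
      exact ⟨h1.1, ⟨(diagonal_even_iff_paired hU h1.1.1).1 h1.2.1,
        (diagonal_even_iff_paired hV h1.1.2).1 h1.2.2⟩, heven h⟩
    · rintro ⟨h1, h2, -⟩
      exact e3.2 ⟨h1, (diagonal_even_iff_paired hU h1.1).2 h2.1,
        (diagonal_even_iff_paired hV h1.2).2 h2.2⟩
  have hbound : MultisetBounded β T W S ↔ BitableauBounded β T W (brsk S) := by
    rw [multisetBounded_iff hS hα hγ hαβ hβγ, brsk_eq hS,
      bitableauBounded_stackRows_iff hR hR' hα hγ hαβ hβγ]
  have hsst : IsNonvanishingSemistandard β (brsk S) := by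
    rw [brsk_eq hS]
    exact isNonvanishingSemistandard_stackRows hR hR'
  simp only [specialMultisets, starBitableaux, Set.mem_ofPred_eq, ← hspecial, ← hbound]
  tauto

/-! ### Bijectivity without the special and boundedness conditions -/

/-- The signs of the rows recover the two halves of the stacked bitableau, and each half determines
its part of the multiset. -/
theorem brsk_injOn {S' : Multiset (Fin (2 * d) × Fin (2 * d))} (hS : IsNonvanishingMultiset β S)
    (hS' : IsNonvanishingMultiset β S') (h : brsk S = brsk S') : S = S' := by
  have hU := isNegativeMultiset_negativePart hS
  have hV := isNegativeMultiset_swappedPositivePart hS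
  have hU' := isNegativeMultiset_negativePart hS'
  have hV' := isNegativeMultiset_swappedPositivePart hS'
  have e : stackRows (negativeRows (negativePart S)) (negativeRows (swappedPositivePart S)) =
      stackRows (negativeRows (negativePart S')) (negativeRows (swappedPositivePart S')) := by
    rw [brsk_eq hS, brsk_eq hS'] at h
    rw [← bitableauRows_ofRows (stackRows _ _), h, bitableauRows_ofRows]
  classical
  have h1 := congrArg (List.filter (fun w => IsNegativeRow w)) e
  have h2 := congrArg (List.filter (fun w => IsPositiveRow w)) e
  rw [filter_negative_stackRows hU.isNegativeRows hV.isNegativeRows,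
    filter_negative_stackRows hU'.isNegativeRows hV'.isNegativeRows] at h1
  rw [filter_positive_stackRows hU.isNegativeRows hV.isNegativeRows,
    filter_positive_stackRows hU'.isNegativeRows hV'.isNegativeRows, List.reverse_inj] at h2
  exact ext_parts hS hS' (negativeRows_injOn hU hU' h1)
    (negativeRows_injOn hV hV' (List.map_injective_iff.2 Prod.swap_injective h2))

theorem exists_brsk_eq {B : NotchedTableau (Fin (2 * d)) × NotchedTableau (Fin (2 * d))}
    (hB : IsNonvanishingSemistandard β B) : ∃ S, IsNonvanishingMultiset β S ∧ brsk S = B := by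
  obtain ⟨R, R', hR, hR', rfl⟩ := exists_stackRows hB
  obtain ⟨U, hU, rfl⟩ := exists_negativeRows_eq hR
  obtain ⟨V, hV, rfl⟩ := exists_negativeRows_eq hR'
  obtain ⟨h1, h2, h3⟩ := parts_of_add hU hV
  exact ⟨_, h1, by rw [brsk_eq h1, h2, h3]⟩

end Parts
theorem theorem4p4 (d : ℕ) (hd : 0 < d) (α β γ : Finset (Fin (2 * d)))
    (hα : IsSymplecticIndex α) (hβ : IsSymplecticIndex β) (hγ : IsSymplecticIndex γ)
    (hαβ : SetLE α β) (hβγ : SetLE β γ)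
    (T W : Finset (Fin (2 * d) × Fin (2 * d)))
    (hT : Represents β α T) (hW : Represents β γ W) :
    Set.BijOn brsk (specialMultisets β T W) (starBitableaux β T W) ∧
      ∀ S ∈ specialMultisets β T W, bitableauDegree (brsk S) = Multiset.card S := by
  have hα' := projDiff_of_represents hT
  have hγ' := projDiff_of_represents hW
  -- The unrestricted bijection matches the two sets exactly, so injectivity and surjectivity simply
  -- restrict.
  have hmem : ∀ S, IsNonvanishingMultiset β S →
      (S ∈ specialMultisets β T W ↔ brsk S ∈ starBitableaux β T W) := fun S hS =>
    mem_specialMultisets_iff hβ hS hα' hγ' hαβ hβγ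
  refine ⟨⟨fun S hS => (hmem S hS.1).1 hS, fun S hS S' hS' h => brsk_injOn hS.1 hS'.1 h, ?_⟩,
    fun S hS => bitableauDegree_brsk hS.1⟩
  intro B hB
  obtain ⟨S, hS, rfl⟩ := exists_brsk_eq hB.1
  exact ⟨S, (hmem S hS).2 hB, rfl⟩
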